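/- All graphs are finite and simple. A path in a host graph $H$ is simple (no repeated vertices) and is identified with the subgraph of $H$ that it forms. Two paths $P,Q$ of $H$ are *non-splitting*, $P\sim Q$, if they have a common edge and no vertex has degree at least $3$ in $P\cup Q$. A family $\mathcal P=(P_v)_{v\in V}$ of (not necessarily distinct) paths of $H$ *represents* the graph $G$ on vertex set $V$ in which distinct $u,v$ are adjacent if and only if $P_u\sim P_v$. For $U\subseteq V$ write $\cup\mathcal P_U=\bigcup_{v\in U}P_v$ and $\cup\mathcal P=\cup\mathcal P_V$. A graph is ENPT if it is represented by a family of paths of some tree. A bend of a path of an $m\times n$ grid (the Cartesian product of two path graphs) is an internal vertex of the path at which it changes direction, and a graph is $B_1$-ENPG if it is represented by a family of paths of some $m\times n$ grid, each with at most one bend (a $B_1$-ENPG representation). SPLIT is the class of graphs whose vertex set can be partitioned into a clique and a stable set. A caterpillar with central path $C$ is a tree that contains the path $C$ and all of whose vertices are on $C$ or adjacent to a vertex of $C$. (i) Let $G$ be a connected $B_1$-ENPG graph whose vertex set is partitioned into a non-empty clique $K$ and a stable set $S$. Then $G$ has a $B_1$-ENPG representation $\mathcal P$ such that $\cup\mathcal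 P_K$ is a path, $\cup\mathcal P$ is a caterpillar with a central path that contains $\cup\mathcal P_K$, and every vertex has degree at most $3$ in $\cup\mathcal P$. (ii) $B_1\text{-ENPG}\cap\mathrm{SPLIT}\subseteq\mathrm{ENPT}\cap\mathrm{SPLIT}$. -/

import Mathlib

open SimpleGraph

/-- A subgraph of `H` is a path if it consists of the vertices and edges of a simple path of `H`
(no repeated vertices). -/
def IsPathSubgraph {W : Type*} {H : SimpleGraph W} (P : H.Subgraph) : Prop :=
  ∃ (u v : W) (p : H.Walk u v), p.IsPath ∧ P = p.toSubgraph

/-- Two subgraphs edge-intersect if they have a common edge. -/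
def EdgeIntersect {W : Type*} {H : SimpleGraph W} (P Q : H.Subgraph) : Prop :=
  (P.edgeSet ∩ Q.edgeSet).Nonempty

/-- The splits of `P` and `Q`: the vertices of degree at least `3` in `P ∪ Q`. -/
def splits {W : Type*} {H : SimpleGraph W} (P Q : H.Subgraph) : Set W :=
  {w | 3 ≤ ((P ⊔ Q).neighborSet w).encard}

/-- `P ∼ Q`: the paths edge-intersect and do not split. -/
def NonSplitting {W : Type*} {H : SimpleGraph W} (P Q : H.Subgraph) : Prop :=
  EdgeIntersect P Q ∧ splits P Q = ∅

theorem NonSplitting.symm {W : Type*} {H : SimpleGraph W} {P Q : H.Subgraph}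
    (h : NonSplitting P Q) : NonSplitting Q P := by
  obtain ⟨h1, h2⟩ := h
  refine ⟨?_, ?_⟩
  · unfold EdgeIntersect at *
    rwa [Set.inter_comm]
  · unfold splits at *
    rwa [sup_comm]

/-- The graph of edge-intersecting and non-splitting paths of a family of paths indexed by `V`:
distinct `u`, `v` are adjacent iff `P u ∼ P v`. -/
def enpGraph {V W : Type*} {H : SimpleGraph W} (P : V → H.Subgraph) : SimpleGraph V where
  Adj u v := u ≠ v ∧ NonSplitting (P u) (P v)
  symm := ⟨fun _ _ h => ⟨h.1.symm, h.2.symm⟩⟩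
  loopless := ⟨fun _ h => h.1 rfl⟩

/-- The family `P` of paths of the host graph `H` represents `G`. -/
def IsENPRepresentation {V W : Type*} (G : SimpleGraph V) {H : SimpleGraph W}
    (P : V → H.Subgraph) : Prop :=
  (∀ v, IsPathSubgraph (P v)) ∧ G = enpGraph P

/-- The union of the paths `P v`, `v ∈ U`. -/
def pathUnion {V W : Type*} {H : SimpleGraph W} (P : V → H.Subgraph) (U : Set V) : H.Subgraph :=
  ⨆ v ∈ U, P v

/-- The `m` by `n` grid: the Cartesian product of two path graphs. -/
def gridGraph (m n : ℕ) : SimpleGraph (Fin m × Fin n) :=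
  pathGraph m □ pathGraph n

/-- The bends of a path of a grid: the vertices that are incident (in the path) both with an edge
in one of the two directions and with an edge in the other direction. -/
def bends {m n : ℕ} (P : (gridGraph m n).Subgraph) : Set (Fin m × Fin n) :=
  {w | (∃ a, P.Adj w a ∧ a.2 = w.2) ∧ (∃ b, P.Adj w b ∧ b.1 = w.1)}

/-- `P` is a family of paths of a grid, each with at most `k` bends, that represents `G`. -/
def IsBendENPGRepresentation {V : Type*} (k : ℕ) (G : SimpleGraph V) {m n : ℕ}
    (P : V → (gridGraph m n).Subgraph) : Prop :=
  IsENPRepresentation G P ∧ ∀ v, (bends (P v)).encard ≤ k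

/-- The class of `B_k`-ENPG graphs (on the vertex set `V`). -/
def BendENPG (k : ℕ) (V : Type*) : Set (SimpleGraph V) :=
  {G | ∃ (m n : ℕ) (P : V → (gridGraph m n).Subgraph), IsBendENPGRepresentation k G P}

/-- The class of ENPT graphs (on the vertex set `V`): the host graph is a finite tree. -/
def ENPT (V : Type*) : Set (SimpleGraph V) :=
  {G | ∃ (W : Type) (_ : Finite W) (T : SimpleGraph W), T.IsTree ∧
    ∃ P : V → T.Subgraph, IsENPRepresentation G P}

/-- `V` is partitioned into the clique `K` and the stable set `S` of `G`. -/
def IsSplitPartition {V : Type*} (G : SimpleGraph V) (K S : Set V) : Prop :=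
  G.IsClique K ∧ G.IsIndepSet S ∧ K ∩ S = ∅ ∧ K ∪ S = Set.univ

/-- The class of split graphs (on the vertex set `V`). -/
def SPLIT (V : Type*) : Set (SimpleGraph V) :=
  {G | ∃ K S : Set V, IsSplitPartition G K S}

/-- `T` is a caterpillar with central path `C`: `T` is a tree, `C` is a path contained in `T`, and
every vertex of `T` is on `C` or adjacent in `T` to a vertex of `C`. -/
def IsCaterpillarWithCentralPath {W : Type*} {H : SimpleGraph W} (T C : H.Subgraph) : Prop :=
  T.coe.IsTree ∧ IsPathSubgraph C ∧ C ≤ T ∧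
    ∀ w ∈ T.verts, w ∈ C.verts ∨ ∃ x ∈ C.verts, T.Adj x w

/-! ### Edges of grid subgraphs in integer coordinates -/

namespace GridPath

/-! A grid path with at most one bend is an L-shape, so everything about it is integer arithmetic.
In a clique of pairwise non-splitting L-shapes, either all pairs share a horizontal edge or all
share a vertical one (`forall_shareH_or`), apart from a single edgeless path; after a diagonal
reflection, assume horizontal. Helly's theorem on the line yields a common edge. Since there are no
splits, all vertical legs at left ends lie in one column on one side of the row, and likewise at
right ends (`exists_frame`). So the clique lies on a spine with two turns, which is unrolled to a
line.

A neighbour of a clique member meets this line in an interval and may leave it at either end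
(`IsCore.exists_placed`). Non-splitting with a path that stays on the line is then the condition
`Abs`: the intervals overlap in an edge, and no leaving point is interior to the other interval
(`IsCore.abs_of_ns`, `Placed.ns`). The shape of a path off the spine thus matters only between two
members of the stable set that both leave the spine, and these just have to be kept non-adjacent.

Hence each excursion can be replaced by one pendant edge, giving paths of a comb
(`LineModel.nonempty_combModel`). The line is stretched to make room: paths leaving on the same side
are made to split by moving their leaving points apart, and paths leaving on opposite sides only are
trimmed to be disjoint. The inequalities imposed by having one bend (`OneBend`) survive as
`CombOneBend`, so the comb can be drawn in a grid with a spine of two turns and paths of at most one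
bend. A comb is a caterpillar of maximum degree three, which gives (i); taken as the host tree
itself, it gives (ii). -/

theorem three_le_encard_iff {α : Type*} {s : Set α} :
    3 ≤ s.encard ↔ ∃ a ∈ s, ∃ b ∈ s, ∃ c ∈ s, a ≠ b ∧ a ≠ c ∧ b ≠ c := by
  constructor
  · intro h
    obtain ⟨t, hts, ht⟩ := Set.exists_subset_encard_eq h
    obtain ⟨a, b, c, hab, hac, hbc, rfl⟩ := Set.encard_eq_three.1 ht
    exact ⟨a, hts (by simp), b, hts (by simp), c, hts (by simp), hab, hac, hbc⟩
  · rintro ⟨a, ha, b, hb, c, hc, hab, hac, hbc⟩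
    have h : ({a, b, c} : Set α).encard = 3 := Set.encard_eq_three.2 ⟨a, b, c, hab, hac, hbc, rfl⟩
    rw [← h]
    refine Set.encard_le_encard ?_
    rintro x (rfl | rfl | rfl) <;> assumption

variable {m n : ℕ}

/-- The horizontal coordinate of a grid vertex. -/
def cx (w : Fin m × Fin n) : ℤ := (w.1 : ℕ)

/-- The vertical coordinate of a grid vertex. -/
def cy (w : Fin m × Fin n) : ℤ := (w.2 : ℕ)

theorem coord_ext {w z : Fin m × Fin n} (h1 : cx w = cx z) (h2 : cy w = cy z) : w = z := by
  unfold cx cy at *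
  exact Prod.ext (Fin.ext (by omega)) (Fin.ext (by omega))

theorem fst_eq_iff {w z : Fin m × Fin n} : w.1 = z.1 ↔ cx w = cx z := by
  unfold cx
  rw [Fin.ext_iff]
  omega

theorem snd_eq_iff {w z : Fin m × Fin n} : w.2 = z.2 ↔ cy w = cy z := by
  unfold cy
  rw [Fin.ext_iff]
  omega

theorem grid_adj_iff {w z : Fin m × Fin n} : (gridGraph m n).Adj w z ↔
    ((cx w + 1 = cx z ∨ cx z + 1 = cx w) ∧ cy w = cy z) ∨
    ((cy w + 1 = cy z ∨ cy z + 1 = cy w) ∧ cx w = cx z) := by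
  unfold gridGraph
  rw [boxProd_adj, pathGraph_adj, pathGraph_adj, fst_eq_iff, snd_eq_iff]
  unfold cx cy
  omega

/-- `P` contains the horizontal edge from `(i, j)` to `(i + 1, j)`. -/
def hEdge (P : (gridGraph m n).Subgraph) (i j : ℤ) : Prop :=
  ∃ a b, P.Adj a b ∧ cx a = i ∧ cx b = i + 1 ∧ cy a = j ∧ cy b = j

/-- `P` contains the vertical edge from `(i, j)` to `(i, j + 1)`. -/
def vEdge (P : (gridGraph m n).Subgraph) (i j : ℤ) : Prop :=
  ∃ a b, P.Adj a b ∧ cx a = i ∧ cx b = i ∧ cy a = j ∧ cy b = j + 1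

theorem hEdge_of_adj {P : (gridGraph m n).Subgraph} {a b : Fin m × Fin n} (h : P.Adj a b)
    (h1 : cx a + 1 = cx b) (h2 : cy a = cy b) : hEdge P (cx a) (cy a) :=
  ⟨a, b, h, rfl, h1.symm, rfl, h2.symm⟩

theorem vEdge_of_adj {P : (gridGraph m n).Subgraph} {a b : Fin m × Fin n} (h : P.Adj a b)
    (h1 : cx a = cx b) (h2 : cy a + 1 = cy b) : vEdge P (cx a) (cy a) :=
  ⟨a, b, h, rfl, h1.symm, rfl, h2.symm⟩

theorem hEdge_sup {P Q : (gridGraph m n).Subgraph} {i j : ℤ} :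
    hEdge (P ⊔ Q) i j ↔ hEdge P i j ∨ hEdge Q i j := by
  unfold hEdge
  constructor
  · rintro ⟨a, b, h | h, h'⟩
    · exact Or.inl ⟨a, b, h, h'⟩
    · exact Or.inr ⟨a, b, h, h'⟩
  · rintro (⟨a, b, h, h'⟩ | ⟨a, b, h, h'⟩)
    · exact ⟨a, b, Or.inl h, h'⟩
    · exact ⟨a, b, Or.inr h, h'⟩

theorem vEdge_sup {P Q : (gridGraph m n).Subgraph} {i j : ℤ} :
    vEdge (P ⊔ Q) i j ↔ vEdge P i j ∨ vEdge Q i j := by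
  unfold vEdge
  constructor
  · rintro ⟨a, b, h | h, h'⟩
    · exact Or.inl ⟨a, b, h, h'⟩
    · exact Or.inr ⟨a, b, h, h'⟩
  · rintro (⟨a, b, h, h'⟩ | ⟨a, b, h, h'⟩)
    · exact ⟨a, b, Or.inl h, h'⟩
    · exact ⟨a, b, Or.inr h, h'⟩

theorem exists_bend {P : (gridGraph m n).Subgraph} {i j : ℤ}
    (h : hEdge P i j ∨ hEdge P (i - 1) j) (v : vEdge P i j ∨ vEdge P i (j - 1)) :
    ∃ w ∈ bends P, cx w = i ∧ cy w = j := by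
  obtain ⟨a, a', ha, ha1, ha2, ha3⟩ : ∃ a a', P.Adj a a' ∧ cx a = i ∧ cy a = j ∧ cy a' = j := by
    rcases h with ⟨a, b, h, h1, h2, h3, h4⟩ | ⟨a, b, h, h1, h2, h3, h4⟩
    · exact ⟨a, b, h, h1, h3, h4⟩
    · exact ⟨b, a, h.symm, by omega, h4, h3⟩
  obtain ⟨b, b', hb, hb1, hb2, hb3⟩ : ∃ b b', P.Adj b b' ∧ cx b = i ∧ cy b = j ∧ cx b' = i := by
    rcases v with ⟨a, b, h, h1, h2, h3, h4⟩ | ⟨a, b, h, h1, h2, h3, h4⟩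
    · exact ⟨a, b, h, h1, h3, h2⟩
    · exact ⟨b, a, h.symm, h2, by omega, h1⟩
  obtain rfl : a = b := coord_ext (by omega) (by omega)
  exact ⟨a, ⟨⟨a', ha, snd_eq_iff.2 (by omega)⟩, ⟨b', hb, fst_eq_iff.2 (by omega)⟩⟩, ha1, ha2⟩

/-- At least three of the four propositions hold. -/
def ThreeOf (a b c d : Prop) : Prop :=
  (a ∧ b ∧ c) ∨ (a ∧ b ∧ d) ∨ (a ∧ c ∧ d) ∨ (b ∧ c ∧ d)

theorem threeOf_of_distinct {p q r s : Prop} {x y x₁ y₁ x₂ y₂ x₃ y₃ : ℤ}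
    (h₁₂ : ¬ (x₁ = x₂ ∧ y₁ = y₂)) (h₁₃ : ¬ (x₁ = x₃ ∧ y₁ = y₃)) (h₂₃ : ¬ (x₂ = x₃ ∧ y₂ = y₃))
    (h₁ : (p ∧ x₁ = x + 1 ∧ y₁ = y) ∨ (q ∧ x₁ = x - 1 ∧ y₁ = y) ∨ (r ∧ x₁ = x ∧ y₁ = y + 1) ∨
      (s ∧ x₁ = x ∧ y₁ = y - 1))
    (h₂ : (p ∧ x₂ = x + 1 ∧ y₂ = y) ∨ (q ∧ x₂ = x - 1 ∧ y₂ = y) ∨ (r ∧ x₂ = x ∧ y₂ = y + 1) ∨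
      (s ∧ x₂ = x ∧ y₂ = y - 1))
    (h₃ : (p ∧ x₃ = x + 1 ∧ y₃ = y) ∨ (q ∧ x₃ = x - 1 ∧ y₃ = y) ∨ (r ∧ x₃ = x ∧ y₃ = y + 1) ∨
      (s ∧ x₃ = x ∧ y₃ = y - 1)) : ThreeOf p q r s := by
  unfold ThreeOf
  rcases h₁ with ⟨h, rfl, rfl⟩ | ⟨h, rfl, rfl⟩ | ⟨h, rfl, rfl⟩ | ⟨h, rfl, rfl⟩ <;>
  rcases h₂ with ⟨h', rfl, rfl⟩ | ⟨h', rfl, rfl⟩ | ⟨h', rfl, rfl⟩ | ⟨h', rfl, rfl⟩ <;>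
  first
    | exact absurd ⟨rfl, rfl⟩ h₁₂
    | rcases h₃ with ⟨h'', rfl, rfl⟩ | ⟨h'', rfl, rfl⟩ | ⟨h'', rfl, rfl⟩ | ⟨h'', rfl, rfl⟩ <;>
      first
        | exact absurd ⟨rfl, rfl⟩ h₁₃
        | exact absurd ⟨rfl, rfl⟩ h₂₃
        | simp only [h, h', h'', true_and, and_true, true_or, or_true]

theorem hEdge_or_of_adj {P : (gridGraph m n).Subgraph} {w a : Fin m × Fin n} (h : P.Adj w a) :
    (hEdge P (cx w) (cy w) ∧ cx a = cx w + 1 ∧ cy a = cy w) ∨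
    (hEdge P (cx w - 1) (cy w) ∧ cx a = cx w - 1 ∧ cy a = cy w) ∨
    (vEdge P (cx w) (cy w) ∧ cx a = cx w ∧ cy a = cy w + 1) ∨
    (vEdge P (cx w) (cy w - 1) ∧ cx a = cx w ∧ cy a = cy w - 1) := by
  rcases grid_adj_iff.1 h.adj_sub with ⟨h1 | h1, h2⟩ | ⟨h1 | h1, h2⟩
  · exact Or.inl ⟨hEdge_of_adj h h1 h2, by omega, by omega⟩
  · have := hEdge_of_adj h.symm h1 h2.symm
    rw [show cx a = cx w - 1 by omega, ← h2] at this
    exact Or.inr (Or.inl ⟨this, by omega, by omega⟩)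
  · exact Or.inr (Or.inr (Or.inl ⟨vEdge_of_adj h h2 h1, by omega, by omega⟩))
  · have := vEdge_of_adj h.symm h2.symm h1
    rw [show cy a = cy w - 1 by omega, ← h2] at this
    exact Or.inr (Or.inr (Or.inr ⟨this, by omega, by omega⟩))

/-- Turns vertex degrees into integer predicates. No range condition on `i`, `j` is needed, because
an edge at `(i, j)` already supplies the grid vertex there. -/
theorem exists_three_le_neighborSet_iff {P : (gridGraph m n).Subgraph} :
    (∃ w, 3 ≤ (P.neighborSet w).encard) ↔
      ∃ i j, ThreeOf (hEdge P i j) (hEdge P (i - 1) j) (vEdge P i j) (vEdge P i (j - 1)) := by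
  constructor
  · rintro ⟨w, hw⟩
    obtain ⟨a, ha, b, hb, c, hc, hab, hac, hbc⟩ := three_le_encard_iff.1 hw
    refine ⟨cx w, cy w, ?_⟩
    exact threeOf_of_distinct (fun h => hab (coord_ext h.1 h.2)) (fun h => hac (coord_ext h.1 h.2))
      (fun h => hbc (coord_ext h.1 h.2)) (hEdge_or_of_adj ha) (hEdge_or_of_adj hb)
      (hEdge_or_of_adj hc)
  · rintro ⟨i, j, h⟩
    have key : ∀ (p q r : Fin m × Fin n → Prop),
        (∃ w a, P.Adj w a ∧ cx w = i ∧ cy w = j ∧ p a) →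
        (∃ w a, P.Adj w a ∧ cx w = i ∧ cy w = j ∧ q a) →
        (∃ w a, P.Adj w a ∧ cx w = i ∧ cy w = j ∧ r a) →
        (∀ a, p a → ¬ q a) → (∀ a, p a → ¬ r a) → (∀ a, q a → ¬ r a) →
        ∃ w, 3 ≤ (P.neighborSet w).encard := by
      rintro p q r ⟨w, a, ha, hw1, hw2, hpa⟩ ⟨w', b, hb, hw1', hw2', hqb⟩
        ⟨w'', c, hc, hw1'', hw2'', hrc⟩ hpq hpr hqr
      obtain rfl : w = w' := coord_ext (by omega) (by omega)
      obtain rfl : w = w'' := coord_ext (by omega) (by omega)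
      refine ⟨w, three_le_encard_iff.2 ⟨a, ha, b, hb, c, hc, ?_, ?_, ?_⟩⟩
      · rintro rfl; exact hpq _ hpa hqb
      · rintro rfl; exact hpr _ hpa hrc
      · rintro rfl; exact hqr _ hqb hrc
    have hE : hEdge P i j → ∃ w a, P.Adj w a ∧ cx w = i ∧ cy w = j ∧
        (cx a = i + 1 ∧ cy a = j) := by
      rintro ⟨a, b, h, h1, h2, h3, h4⟩
      exact ⟨a, b, h, h1, h3, h2, h4⟩
    have hW : hEdge P (i - 1) j → ∃ w a, P.Adj w a ∧ cx w = i ∧ cy w = j ∧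
        (cx a = i - 1 ∧ cy a = j) := by
      rintro ⟨a, b, h, h1, h2, h3, h4⟩
      exact ⟨b, a, h.symm, by omega, h4, h1, h3⟩
    have hN : vEdge P i j → ∃ w a, P.Adj w a ∧ cx w = i ∧ cy w = j ∧
        (cx a = i ∧ cy a = j + 1) := by
      rintro ⟨a, b, h, h1, h2, h3, h4⟩
      exact ⟨a, b, h, h1, h3, h2, h4⟩
    have hS : vEdge P i (j - 1) → ∃ w a, P.Adj w a ∧ cx w = i ∧ cy w = j ∧
        (cx a = i ∧ cy a = j - 1) := by
      rintro ⟨a, b, h, h1, h2, h3, h4⟩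
      exact ⟨b, a, h.symm, h2, by omega, h1, h3⟩
    rcases h with ⟨h1, h2, h3⟩ | ⟨h1, h2, h3⟩ | ⟨h1, h2, h3⟩ | ⟨h1, h2, h3⟩
    · exact key _ _ _ (hE h1) (hW h2) (hN h3) (by intros; omega) (by intros; omega)
        (by intros; omega)
    · exact key _ _ _ (hE h1) (hW h2) (hS h3) (by intros; omega) (by intros; omega)
        (by intros; omega)
    · exact key _ _ _ (hE h1) (hN h2) (hS h3) (by intros; omega) (by intros; omega)
        (by intros; omega)
    · exact key _ _ _ (hW h1) (hN h2) (hS h3) (by intros; omega) (by intros; omega)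
        (by intros; omega)

theorem edgeIntersect_iff {P Q : (gridGraph m n).Subgraph} :
    EdgeIntersect P Q ↔
      (∃ i j, hEdge P i j ∧ hEdge Q i j) ∨ ∃ i j, vEdge P i j ∧ vEdge Q i j := by
  constructor
  · rintro ⟨e, he⟩
    induction e with
    | _ a b =>
      obtain ⟨hP, hQ⟩ := he
      rw [Subgraph.mem_edgeSet] at hP hQ
      rcases grid_adj_iff.1 hP.adj_sub with ⟨h1 | h1, h2⟩ | ⟨h1 | h1, h2⟩
      · exact Or.inl ⟨_, _, hEdge_of_adj hP h1 h2, hEdge_of_adj hQ h1 h2⟩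
      · exact Or.inl ⟨_, _, hEdge_of_adj hP.symm h1 h2.symm, hEdge_of_adj hQ.symm h1 h2.symm⟩
      · exact Or.inr ⟨_, _, vEdge_of_adj hP h2 h1, vEdge_of_adj hQ h2 h1⟩
      · exact Or.inr ⟨_, _, vEdge_of_adj hP.symm h2.symm h1, vEdge_of_adj hQ.symm h2.symm h1⟩
  · rintro (⟨i, j, ⟨a, b, h, h1, h2, h3, h4⟩, a', b', h', h1', h2', h3', h4'⟩ |
      ⟨i, j, ⟨a, b, h, h1, h2, h3, h4⟩, a', b', h', h1', h2', h3', h4'⟩) <;>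
    · obtain rfl : a = a' := coord_ext (by omega) (by omega)
      obtain rfl : b = b' := coord_ext (by omega) (by omega)
      exact ⟨s(a, b), h, h'⟩

theorem nonSplitting_iff {P Q : (gridGraph m n).Subgraph} : NonSplitting P Q ↔
    ((∃ i j, hEdge P i j ∧ hEdge Q i j) ∨ ∃ i j, vEdge P i j ∧ vEdge Q i j) ∧
    ∀ i j, ¬ ThreeOf (hEdge P i j ∨ hEdge Q i j) (hEdge P (i - 1) j ∨ hEdge Q (i - 1) j)
      (vEdge P i j ∨ vEdge Q i j) (vEdge P i (j - 1) ∨ vEdge Q i (j - 1)) := by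
  unfold NonSplitting
  rw [edgeIntersect_iff]
  refine and_congr Iff.rfl ?_
  have := exists_three_le_neighborSet_iff (P := P ⊔ Q)
  simp only [hEdge_sup, vEdge_sup] at this
  rw [Set.eq_empty_iff_forall_notMem]
  rw [← not_iff_not] at this
  simpa [splits] using this

/-! ### Paths with at most one bend are L-shaped -/

/-- A horizontal segment in row `r` and a vertical segment in column `c`, sharing an end. -/
structure LShape where
  /-- the row of the horizontal segment -/
  r : ℤ
  /-- the left end of the horizontal segment -/
  lo : ℤ
  /-- the right end of the horizontal segment -/
  hi : ℤ
  /-- the column of the vertical segment -/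
  c : ℤ
  /-- the lower end of the vertical segment -/
  bot : ℤ
  /-- the upper end of the vertical segment -/
  top : ℤ
  lo_le_hi : lo ≤ hi
  bot_le_top : bot ≤ top
  c_eq : c = lo ∨ c = hi
  r_eq : r = bot ∨ r = top

/-- The horizontal edges of an L-shape. -/
def LShape.hE (A : LShape) (i j : ℤ) : Prop := j = A.r ∧ A.lo ≤ i ∧ i < A.hi

/-- The vertical edges of an L-shape. -/
def LShape.vE (A : LShape) (i j : ℤ) : Prop := i = A.c ∧ A.bot ≤ j ∧ j < A.top

theorem hEdge_cons {u v w : Fin m × Fin n} (h : (gridGraph m n).Adj u v)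
    (p : (gridGraph m n).Walk v w) {i j : ℤ} :
    hEdge (Walk.cons h p).toSubgraph i j ↔
      (cy u = j ∧ cy v = j ∧ min (cx u) (cx v) = i ∧ max (cx u) (cx v) = i + 1) ∨
      hEdge p.toSubgraph i j := by
  simp only [Walk.toSubgraph, hEdge_sup]
  refine or_congr ?_ Iff.rfl
  unfold hEdge
  simp only [subgraphOfAdj_adj, Sym2.eq_iff]
  constructor
  · rintro ⟨a, b, ⟨rfl, rfl⟩ | ⟨rfl, rfl⟩, h'⟩ <;> omega
  · rintro ⟨h1, h2, h3, h4⟩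
    by_cases hc : cx u ≤ cx v
    · exact ⟨u, v, Or.inl ⟨rfl, rfl⟩, by omega⟩
    · exact ⟨v, u, Or.inr ⟨rfl, rfl⟩, by omega⟩

theorem vEdge_cons {u v w : Fin m × Fin n} (h : (gridGraph m n).Adj u v)
    (p : (gridGraph m n).Walk v w) {i j : ℤ} :
    vEdge (Walk.cons h p).toSubgraph i j ↔
      (cx u = i ∧ cx v = i ∧ min (cy u) (cy v) = j ∧ max (cy u) (cy v) = j + 1) ∨
      vEdge p.toSubgraph i j := by
  simp only [Walk.toSubgraph, vEdge_sup]
  refine or_congr ?_ Iff.rfl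
  unfold vEdge
  simp only [subgraphOfAdj_adj, Sym2.eq_iff]
  constructor
  · rintro ⟨a, b, ⟨rfl, rfl⟩ | ⟨rfl, rfl⟩, h'⟩ <;> omega
  · rintro ⟨h1, h2, h3, h4⟩
    by_cases hc : cy u ≤ cy v
    · exact ⟨u, v, Or.inl ⟨rfl, rfl⟩, by omega⟩
    · exact ⟨v, u, Or.inr ⟨rfl, rfl⟩, by omega⟩

/-- The walk `p` goes from `(x, y)` to `(x', y')` first horizontally and then vertically. -/
def HorVert {u v : Fin m × Fin n} (p : (gridGraph m n).Walk u v) : Prop :=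
  (∀ i j, hEdge p.toSubgraph i j ↔ j = cy u ∧ min (cx u) (cx v) ≤ i ∧ i < max (cx u) (cx v)) ∧
  (∀ i j, vEdge p.toSubgraph i j ↔ i = cx v ∧ min (cy u) (cy v) ≤ j ∧ j < max (cy u) (cy v)) ∧
  ∀ w, w ∈ p.support ↔ (cy w = cy u ∧ min (cx u) (cx v) ≤ cx w ∧ cx w ≤ max (cx u) (cx v)) ∨
    (cx w = cx v ∧ min (cy u) (cy v) ≤ cy w ∧ cy w ≤ max (cy u) (cy v))

/-- The walk `p` goes from `(x, y)` to `(x', y')` first vertically and then horizontally. -/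
def VertHor {u v : Fin m × Fin n} (p : (gridGraph m n).Walk u v) : Prop :=
  (∀ i j, hEdge p.toSubgraph i j ↔ j = cy v ∧ min (cx u) (cx v) ≤ i ∧ i < max (cx u) (cx v)) ∧
  (∀ i j, vEdge p.toSubgraph i j ↔ i = cx u ∧ min (cy u) (cy v) ≤ j ∧ j < max (cy u) (cy v)) ∧
  ∀ w, w ∈ p.support ↔ (cy w = cy v ∧ min (cx u) (cx v) ≤ cx w ∧ cx w ≤ max (cx u) (cx v)) ∨
    (cx w = cx u ∧ min (cy u) (cy v) ≤ cy w ∧ cy w ≤ max (cy u) (cy v))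

theorem eq_iff_coord {w z : Fin m × Fin n} : w = z ↔ cx w = cx z ∧ cy w = cy z :=
  ⟨fun h => h ▸ ⟨rfl, rfl⟩, fun h => coord_ext h.1 h.2⟩

theorem not_two_bends {P : (gridGraph m n).Subgraph} (hP : (bends P).encard ≤ 1) {i j i' j' : ℤ}
    (h : hEdge P i j ∨ hEdge P (i - 1) j) (v : vEdge P i j ∨ vEdge P i (j - 1))
    (h' : hEdge P i' j' ∨ hEdge P (i' - 1) j') (v' : vEdge P i' j' ∨ vEdge P i' (j' - 1)) :
    i = i' ∧ j = j' := by
  obtain ⟨w, hw, hw1, hw2⟩ := exists_bend h v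
  obtain ⟨w', hw', hw1', hw2'⟩ := exists_bend h' v'
  have := Set.encard_le_one_iff.1 hP w w' hw hw'
  subst this
  omega

theorem bends_mono {P Q : (gridGraph m n).Subgraph} (h : P ≤ Q) : bends P ⊆ bends Q := by
  rintro w ⟨⟨a, ha, ha'⟩, b, hb, hb'⟩
  exact ⟨⟨a, h.2 ha, ha'⟩, b, h.2 hb, hb'⟩

/-- Induction along the walk. The description of the support in `HorVert` and `VertHor` is carried
along because it lets the new first vertex, which is not on the remaining walk, rule out a reversal
of direction. -/
theorem horVert_or_vertHor {u v : Fin m × Fin n} (p : (gridGraph m n).Walk u v) (hp : p.IsPath)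
    (hb : (bends p.toSubgraph).encard ≤ 1) : HorVert p ∨ VertHor p := by
  induction p with
  | nil =>
    refine Or.inl ⟨fun i j => ?_, fun i j => ?_, fun w => ?_⟩
    · unfold hEdge
      simp only [Walk.toSubgraph, singletonSubgraph_adj, Pi.bot_apply, Prop.bot_eq_false]
      constructor
      · rintro ⟨a, b, h, -⟩; exact h.elim
      · intro h; omega
    · unfold vEdge
      simp only [Walk.toSubgraph, singletonSubgraph_adj, Pi.bot_apply, Prop.bot_eq_false]
      constructor
      · rintro ⟨a, b, h, -⟩; exact h.elim
      · intro h; omega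
    · rw [Walk.support_nil, List.mem_singleton, eq_iff_coord]
      omega
  | @cons u v w h p ih =>
    rw [Walk.cons_isPath_iff] at hp
    have hsub : (bends p.toSubgraph).encard ≤ 1 :=
      (Set.encard_le_encard (bends_mono (by simp [Walk.toSubgraph]))).trans hb
    have hH := @hEdge_cons _ _ _ _ _ h p
    have hV := @vEdge_cons _ _ _ _ _ h p
    have hS : ∀ z, z ∈ (Walk.cons h p).support ↔ (cx z = cx u ∧ cy z = cy u) ∨ z ∈ p.support := by
      intro z
      rw [Walk.support_cons, List.mem_cons, eq_iff_coord]
    have hu := hp.2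
    rcases grid_adj_iff.1 h with hd | hd
    · have key : HorVert p := by
        rcases ih hp.1 hsub with h1 | ⟨h1, h2, h3⟩
        · exact h1
        by_cases hy : cy v = cy w
        · refine ⟨fun i j => ?_, fun i j => ?_, fun z => ?_⟩
          · rw [h1]; omega
          · rw [h2]; omega
          · rw [h3]; omega
        by_cases hx : cx v = cx w
        · refine ⟨fun i j => ?_, fun i j => ?_, fun z => ?_⟩
          · rw [h1]; omega
          · rw [h2]; omega
          · rw [h3]; omega
        exfalso
        -- If both legs of the remaining walk are non-degenerate, entering it horizontally creates
        -- bends at `v` and at the corner `(cx v, cy w)`.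
        have := not_two_bends hb (i := cx v) (j := cy v) (i' := cx v) (j' := cy w)
          (by rw [hH, hH]; omega) (by rw [hV, hV, h2, h2]; omega)
          (by rw [hH, hH, h1, h1]; omega) (by rw [hV, hV, h2, h2]; omega)
        omega
      obtain ⟨h1, h2, h3⟩ := key
      rw [h3] at hu
      refine Or.inl ⟨fun i j => ?_, fun i j => ?_, fun z => ?_⟩
      · rw [hH, h1]; omega
      · rw [hV, h2]; omega
      · rw [hS, h3]; omega
    · have key : VertHor p := by
        rcases ih hp.1 hsub with ⟨h1, h2, h3⟩ | h1
        swap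
        · exact h1
        by_cases hy : cy v = cy w
        · refine ⟨fun i j => ?_, fun i j => ?_, fun z => ?_⟩
          · rw [h1]; omega
          · rw [h2]; omega
          · rw [h3]; omega
        by_cases hx : cx v = cx w
        · refine ⟨fun i j => ?_, fun i j => ?_, fun z => ?_⟩
          · rw [h1]; omega
          · rw [h2]; omega
          · rw [h3]; omega
        exfalso
        have := not_two_bends hb (i := cx v) (j := cy v) (i' := cx w) (j' := cy v)
          (by rw [hH, hH, h1, h1]; omega) (by rw [hV, hV]; omega)
          (by rw [hH, hH, h1, h1]; omega) (by rw [hV, hV, h2, h2]; omega)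
        omega
      obtain ⟨h1, h2, h3⟩ := key
      rw [h3] at hu
      refine Or.inr ⟨fun i j => ?_, fun i j => ?_, fun z => ?_⟩
      · rw [hH, h1]; omega
      · rw [hV, h2]; omega
      · rw [hS, h3]; omega

theorem exists_lShape {P : (gridGraph m n).Subgraph} (hP : IsPathSubgraph P)
    (hb : (bends P).encard ≤ 1) :
    ∃ A : LShape, (∀ i j, hEdge P i j ↔ A.hE i j) ∧ ∀ i j, vEdge P i j ↔ A.vE i j := by
  obtain ⟨u, v, p, hp, rfl⟩ := hP
  rcases horVert_or_vertHor p hp hb with ⟨h1, h2, -⟩ | ⟨h1, h2, -⟩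
  · exact ⟨⟨cy u, min (cx u) (cx v), max (cx u) (cx v), cx v, min (cy u) (cy v),
      max (cy u) (cy v), by omega, by omega, by omega, by omega⟩, h1, h2⟩
  · exact ⟨⟨cy v, min (cx u) (cx v), max (cx u) (cx v), cx u, min (cy u) (cy v),
      max (cy u) (cy v), by omega, by omega, by omega, by omega⟩, h1, h2⟩

/-- Two L-shapes share an edge and no vertex has degree at least three in their union. -/
def LShape.NS (A B : LShape) : Prop :=
  ((∃ i j, A.hE i j ∧ B.hE i j) ∨ ∃ i j, A.vE i j ∧ B.vE i j) ∧
  ∀ i j, ¬ ThreeOf (A.hE i j ∨ B.hE i j) (A.hE (i - 1) j ∨ B.hE (i - 1) j)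
    (A.vE i j ∨ B.vE i j) (A.vE i (j - 1) ∨ B.vE i (j - 1))

theorem exists_lShape_family {V : Type*} {G : SimpleGraph V} (h : G ∈ BendENPG 1 V) :
    ∃ A : V → LShape, ∀ u v, G.Adj u v ↔ u ≠ v ∧ (A u).NS (A v) := by
  obtain ⟨m, n, P, ⟨hP, hG⟩, hb⟩ := h
  choose A hA using fun v => exists_lShape (hP v) (hb v)
  refine ⟨A, fun u v => ?_⟩
  rw [hG]
  change u ≠ v ∧ NonSplitting (P u) (P v) ↔ _
  rw [nonSplitting_iff]
  simp only [(hA _).1, (hA _).2, LShape.NS]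


/-! ### Symmetries of L-shapes -/

theorem ThreeOf.swap_right {a b c d : Prop} (h : ThreeOf a b c d) : ThreeOf a b d c := by
  unfold ThreeOf at *
  tauto

theorem ThreeOf.comm {a b c d : Prop} (h : ThreeOf a b c d) : ThreeOf c d a b := by
  unfold ThreeOf at *
  tauto

theorem ThreeOf.swap_left {a b c d : Prop} (h : ThreeOf a b c d) : ThreeOf b a c d :=
  h.comm.swap_right.comm

namespace LShape

/-- The vertex `(i, j)` has degree at least three in `A ∪ B`. -/
def Deg3 (A B : LShape) (i j : ℤ) : Prop :=
  ThreeOf (A.hE i j ∨ B.hE i j) (A.hE (i - 1) j ∨ B.hE (i - 1) j)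
    (A.vE i j ∨ B.vE i j) (A.vE i (j - 1) ∨ B.vE i (j - 1))

theorem ns_iff {A B : LShape} : A.NS B ↔
    ((∃ i j, A.hE i j ∧ B.hE i j) ∨ ∃ i j, A.vE i j ∧ B.vE i j) ∧ ∀ i j, ¬ A.Deg3 B i j := Iff.rfl

/-- Reflection in a horizontal line. -/
def flip (A : LShape) : LShape :=
  ⟨-A.r, A.lo, A.hi, A.c, -A.top, -A.bot, A.lo_le_hi, by have := A.bot_le_top; omega, A.c_eq,
    by have := A.r_eq; omega⟩

/-- Reflection in a vertical line. -/
def mirror (A : LShape) : LShape :=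
  ⟨A.r, -A.hi, -A.lo, -A.c, A.bot, A.top, by have := A.lo_le_hi; omega, A.bot_le_top,
    by have := A.c_eq; omega, A.r_eq⟩

/-- Reflection in the diagonal. -/
def swap (A : LShape) : LShape :=
  ⟨A.c, A.bot, A.top, A.r, A.lo, A.hi, A.bot_le_top, A.lo_le_hi, A.r_eq, A.c_eq⟩

theorem flip_hE {A : LShape} {i j : ℤ} : A.flip.hE i j ↔ A.hE i (-j) := by
  simp only [hE, flip]; omega

theorem flip_vE {A : LShape} {i j : ℤ} : A.flip.vE i j ↔ A.vE i (-j - 1) := by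
  simp only [vE, flip]; omega

theorem mirror_hE {A : LShape} {i j : ℤ} : A.mirror.hE i j ↔ A.hE (-i - 1) j := by
  simp only [hE, mirror]; omega

theorem mirror_vE {A : LShape} {i j : ℤ} : A.mirror.vE i j ↔ A.vE (-i) j := by
  simp only [vE, mirror]; omega

theorem swap_hE {A : LShape} {i j : ℤ} : A.swap.hE i j ↔ A.vE j i := Iff.rfl

theorem swap_vE {A : LShape} {i j : ℤ} : A.swap.vE i j ↔ A.hE j i := Iff.rfl

theorem flip_deg3 {A B : LShape} {i j : ℤ} : A.flip.Deg3 B.flip i j ↔ A.Deg3 B i (-j) := by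
  simp only [Deg3, flip_hE, flip_vE]
  rw [show -(j - 1) - 1 = -j by omega]
  exact ⟨ThreeOf.swap_right, ThreeOf.swap_right⟩

theorem mirror_deg3 {A B : LShape} {i j : ℤ} : A.mirror.Deg3 B.mirror i j ↔ A.Deg3 B (-i) j := by
  simp only [Deg3, mirror_hE, mirror_vE]
  rw [show -(i - 1) - 1 = -i by omega]
  exact ⟨ThreeOf.swap_left, ThreeOf.swap_left⟩

theorem swap_deg3 {A B : LShape} {i j : ℤ} : A.swap.Deg3 B.swap i j ↔ A.Deg3 B j i := by
  simp only [Deg3, swap_hE, swap_vE]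
  exact ⟨ThreeOf.comm, ThreeOf.comm⟩

theorem mirror_mirror (A : LShape) : A.mirror.mirror = A := by
  simp [mirror]

theorem flip_flip (A : LShape) : A.flip.flip = A := by
  simp [flip]

theorem NS.flip {A B : LShape} (h : A.NS B) : A.flip.NS B.flip := by
  refine ⟨?_, fun i j h' => h.2 _ _ (flip_deg3.1 h')⟩
  rcases h.1 with ⟨i, j, h1, h2⟩ | ⟨i, j, h1, h2⟩
  · exact Or.inl ⟨i, -j, by rwa [flip_hE, neg_neg], by rwa [flip_hE, neg_neg]⟩
  · refine Or.inr ⟨i, -j - 1, ?_, ?_⟩ <;> rw [flip_vE] <;> simpa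

theorem NS.mirror {A B : LShape} (h : A.NS B) : A.mirror.NS B.mirror := by
  refine ⟨?_, fun i j h' => h.2 _ _ (mirror_deg3.1 h')⟩
  rcases h.1 with ⟨i, j, h1, h2⟩ | ⟨i, j, h1, h2⟩
  · refine Or.inl ⟨-i - 1, j, ?_, ?_⟩ <;> rw [mirror_hE] <;> simpa
  · exact Or.inr ⟨-i, j, by rwa [mirror_vE, neg_neg], by rwa [mirror_vE, neg_neg]⟩

theorem NS.swap {A B : LShape} (h : A.NS B) : A.swap.NS B.swap := by
  refine ⟨?_, fun i j h' => h.2 _ _ (swap_deg3.1 h')⟩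
  rcases h.1 with ⟨i, j, h1, h2⟩ | ⟨i, j, h1, h2⟩
  · exact Or.inr ⟨j, i, h1, h2⟩
  · exact Or.inl ⟨j, i, h1, h2⟩

theorem flip_ns {A B : LShape} : A.flip.NS B.flip ↔ A.NS B :=
  ⟨fun h => by simpa [flip_flip] using h.flip, NS.flip⟩

theorem mirror_ns {A B : LShape} : A.mirror.NS B.mirror ↔ A.NS B :=
  ⟨fun h => by simpa [mirror_mirror] using h.mirror, NS.mirror⟩

theorem swap_ns {A B : LShape} : A.swap.NS B.swap ↔ A.NS B :=
  ⟨fun h => h.swap, NS.swap⟩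

theorem shareH_iff {A B : LShape} : (∃ i j, A.hE i j ∧ B.hE i j) ↔
    A.r = B.r ∧ A.lo < A.hi ∧ B.lo < B.hi ∧ A.lo < B.hi ∧ B.lo < A.hi := by
  unfold hE
  constructor
  · rintro ⟨i, j, h⟩; omega
  · intro h
    exact ⟨max A.lo B.lo, A.r, by omega⟩

theorem shareV_iff {A B : LShape} : (∃ i j, A.vE i j ∧ B.vE i j) ↔
    A.c = B.c ∧ A.bot < A.top ∧ B.bot < B.top ∧ A.bot < B.top ∧ B.bot < A.top := by
  unfold vE
  constructor
  · rintro ⟨i, j, h⟩; omega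
  · intro h
    exact ⟨A.c, max A.bot B.bot, by omega⟩

/-- `A`, or its reflection in a horizontal line. -/
def orient (b : Bool) (A : LShape) : LShape := if b then A else A.flip

theorem orient_ns {b : Bool} {A B : LShape} : (A.orient b).NS (B.orient b) ↔ A.NS B := by
  cases b
  · exact flip_ns
  · exact Iff.rfl

/-! ### The left end of an L-shape on a spine -/

/-- The left end, on a spine that turns upwards at column `X`, of an L-shape that contains a
horizontal edge to the right of column `X`: the coordinate `l` of the left end of its intersection
with the spine, and whether it leaves the spine there. -/
def LeftEndUp (A : LShape) (X l : ℤ) (f : Prop) : Prop :=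
  (A.lo < X ∧ l = X ∧ f) ∨
  (A.lo = X ∧ A.c = A.lo ∧ A.bot < A.top ∧ A.bot = A.r ∧ l = X - (A.top - A.bot) ∧ ¬ f) ∨
  (A.lo = X ∧ A.c = A.lo ∧ A.bot < A.top ∧ A.top = A.r ∧ l = X ∧ f) ∨
  (A.lo = X ∧ (A.c = A.hi ∨ A.bot = A.top) ∧ l = X ∧ ¬ f) ∨
  (X < A.lo ∧ A.c = A.lo ∧ A.bot < A.top ∧ l = A.lo ∧ f) ∨
  (X < A.lo ∧ (A.c = A.hi ∨ A.bot = A.top) ∧ l = A.lo ∧ ¬ f)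

/-- The six alternatives of `LeftEndUp` are exhaustive. A point of the arm at height `h` above the
middle row has coordinate `X - h` on the unrolled spine. Running straight on past column `X`, or
turning down there, leaves the spine at `X`; a vertical leg in a column to the right of `X` leaves
it in that column. -/
theorem exists_leftEndUp (A : LShape) (X : ℤ) :
    ∃ l f, A.LeftEndUp X l f := by
  have h1 := A.c_eq
  have h2 := A.r_eq
  have h3 := A.bot_le_top
  unfold LeftEndUp
  by_cases hX : A.lo < X
  · exact ⟨X, True, Or.inl ⟨hX, rfl, trivial⟩⟩
  by_cases hv : A.c = A.hi ∨ A.bot = A.top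
  · by_cases hX' : A.lo = X
    · exact ⟨X, False, by simp [hX', hv]⟩
    · exact ⟨A.lo, False, by simp [hv]; omega⟩
  · by_cases hX' : A.lo = X
    · by_cases hr : A.r = A.bot
      · exact ⟨X - (A.top - A.bot), False, by
          simp only [not_false_eq_true, and_true, and_false]; omega⟩
      · exact ⟨X, True, by simp only [not_true, and_true, and_false]; omega⟩
    · exact ⟨A.lo, True, by simp only [not_true, and_true, and_false]; omega⟩

/-- To the left of both right ends, a split can only come from `B` leaving the spine at an interior
point of `A`, which `hf'` forbids. The right ends are treated by reflection. -/
theorem not_deg3_of_leftEndUp {A B : LShape} {X l l' : ℤ} {f f' : Prop} (hr : A.r = B.r)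
    (hA : A.lo < A.hi) (hB : B.lo < B.hi) (hBA : B.lo < A.hi)
    (h : A.LeftEndUp X l f) (h' : B.LeftEndUp X l' f') (hf : ¬ f) (hf' : f' → l' ≤ l)
    {i j : ℤ} (hi : i < A.hi) (hi' : i < B.hi) : ¬ A.Deg3 B i j := by
  have h1 := A.r_eq
  have h2 := B.r_eq
  have h3 := A.c_eq
  have h4 := B.c_eq
  intro hd
  unfold Deg3 ThreeOf hE vE at hd
  rcases h with ⟨-, -, hh⟩ | ⟨a1, a2, a3, a4, a5, -⟩ | ⟨-, -, -, -, -, hh⟩ | ⟨a1, a2, a3, -⟩ |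
    ⟨-, -, -, -, hh⟩ | ⟨a1, a2, a3, -⟩
  · exact hf hh
  rotate_left
  · exact hf hh
  rotate_left
  · exact hf hh
  all_goals
    rcases h' with ⟨b1, b2, b3⟩ | ⟨b1, b2, b3, b4, b5, -⟩ | ⟨b1, b2, b3, b4, b5, b6⟩ |
      ⟨b1, b2, b3, -⟩ | ⟨b1, b2, b3, b4, b5⟩ | ⟨b1, b2, b3, -⟩
  all_goals
    try have hf' := hf' ‹_›
    omega

theorem exists_deg3_of_leftEndUp {A B : LShape} {X l l' : ℤ} {f f' : Prop} (hr : A.r = B.r)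
    (hB : B.lo < B.hi) (hAB : A.lo < B.hi) (hBA : B.lo < A.hi)
    (h : A.LeftEndUp X l f) (h' : B.LeftEndUp X l' f') (hf : ¬ f) (hf' : f') (hl : l < l') :
    ∃ i j, A.Deg3 B i j := by
  -- The vertex where `B` leaves the spine: at the turn if `B.lo ≤ X`, otherwise at its own corner.
  refine ⟨max X B.lo, B.r, ?_⟩
  have h1 := A.r_eq
  have h2 := B.r_eq
  have h3 := A.c_eq
  have h4 := B.c_eq
  unfold Deg3 ThreeOf hE vE
  rcases h with ⟨-, -, hh⟩ | ⟨a1, a2, a3, a4, a5, -⟩ | ⟨-, -, -, -, -, hh⟩ | ⟨a1, a2, a3, -⟩ |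
    ⟨-, -, -, -, hh⟩ | ⟨a1, a2, a3, -⟩
  · exact absurd hh hf
  rotate_left
  · exact absurd hh hf
  rotate_left
  · exact absurd hh hf
  all_goals
    rcases h' with ⟨b1, b2, b3⟩ | ⟨b1, b2, b3, b4, b5, hh⟩ | ⟨b1, b2, b3, b4, b5, b6⟩ |
      ⟨b1, b2, b3, hh⟩ | ⟨b1, b2, b3, b4, b5⟩ | ⟨b1, b2, b3, hh⟩
  all_goals first
    | exact absurd hf' hh
    | (exfalso; omega)
    | skip
  rotate_left
  · exact Or.inl ⟨by omega, by omega, by omega⟩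
  · exact Or.inr (Or.inr (Or.inl ⟨by omega, by omega, by omega⟩))
  all_goals
    rcases h2 with h2 | h2
    · exact Or.inl ⟨by omega, by omega, by omega⟩
    · exact Or.inr (Or.inl ⟨by omega, by omega, by omega⟩)

/-- A vertical segment on the upward left arm of the spine, in column `X` above row `y`. -/
def LeftArmUp (A : LShape) (y X l r : ℤ) (f : Prop) : Prop :=
  A.c = X ∧ y ≤ A.bot ∧ A.bot < A.top ∧ l = X - (A.top - y) ∧ r = X - (A.bot - y) ∧
    ((A.lo < A.hi ∧ A.r = A.top ∧ f) ∨ (A.lo = A.hi ∧ ¬ f))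

theorem ns_of_leftEndUp_of_leftArmUp {A B : LShape} {X l l' r' : ℤ} {f f' : Prop}
    (h : A.LeftEndUp X l f) (h' : B.LeftArmUp A.r X l' r' f') (hf : ¬ f) (hl : l < r')
    (hf' : f' → l' ≤ l) : A.NS B := by
  have h1 := A.r_eq
  have h2 := B.r_eq
  have h3 := A.c_eq
  have h4 := B.c_eq
  obtain ⟨b1, b2, b3, b4, b5, b6⟩ := h'
  rcases h with ⟨-, -, hh⟩ | ⟨a1, a2, a3, a4, a5, -⟩ | ⟨-, -, -, -, -, hh⟩ | ⟨a1, a2, a3, -⟩ |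
    ⟨-, -, -, -, hh⟩ | ⟨a1, a2, a3, -⟩
  · exact absurd hh hf
  · refine ⟨Or.inr (shareV_iff.2 (by omega)), fun i j hd => ?_⟩
    unfold ThreeOf hE vE at hd
    rcases b6 with ⟨b6, b7, b8⟩ | ⟨b6, -⟩
    · have := hf' b8
      omega
    · omega
  · exact absurd hh hf
  · omega
  · exact absurd hh hf
  · omega

theorem of_ns_of_leftEndUp_of_leftArmUp {A B : LShape} {X l l' r' : ℤ} {f f' : Prop}
    (hA : A.lo < A.hi) (hX : X < A.hi)
    (h : A.LeftEndUp X l f) (h' : B.LeftArmUp A.r X l' r' f') (hf : ¬ f) (hns : A.NS B) :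
    l < r' ∧ (f' → l' ≤ l) := by
  have h1 := A.r_eq
  have h2 := B.r_eq
  have h3 := A.c_eq
  have h4 := B.c_eq
  obtain ⟨b1, b2, b3, b4, b5, b6⟩ := h'
  rw [ns_iff, shareH_iff, shareV_iff] at hns
  obtain ⟨hs, hd⟩ := hns
  rcases h with ⟨-, -, hh⟩ | ⟨a1, a2, a3, a4, a5, -⟩ | ⟨-, -, -, -, -, hh⟩ | ⟨a1, a2, a3, -⟩ |
    ⟨-, -, -, -, hh⟩ | ⟨a1, a2, a3, -⟩
  · exact absurd hh hf
  · rcases b6 with ⟨b6, b7, b8⟩ | ⟨b6, b7⟩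
    · refine ⟨by omega, fun _ => ?_⟩
      by_contra hl
      -- `B` leaves the arm at its top, which by `hl` lies strictly below the top of `A`, so `A`
      -- passes through this vertex.
      refine hd X B.top ?_
      unfold Deg3 ThreeOf hE vE
      rcases h4 with h4 | h4
      · exact Or.inr (Or.inr (Or.inl ⟨by omega, by omega, by omega⟩))
      · exact Or.inr (Or.inr (Or.inr ⟨by omega, by omega, by omega⟩))
    · exact ⟨by omega, fun h => absurd h b7⟩
  · exact absurd hh hf
  · omega
  · exact absurd hh hf
  · omega

theorem ns_of_leftArmUp_of_leftEndUp {A B : LShape} {X l r l' : ℤ} {f f' : Prop}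
    (h : A.LeftArmUp B.r X l r f)
    (h' : B.LeftEndUp X l' f') (hf : ¬ f) (hl : l' < r) : A.NS B := by
  have h1 := A.r_eq
  have h2 := B.r_eq
  have h3 := A.c_eq
  have h4 := B.c_eq
  obtain ⟨b1, b2, b3, b4, b5, b6⟩ := h
  rcases b6 with ⟨-, -, hh⟩ | ⟨b6, -⟩
  · exact absurd hh hf
  rcases h' with ⟨a1, a2, a3⟩ | ⟨a1, a2, a3, a4, a5, -⟩ | ⟨a1, a2, a3, a4, a5, a6⟩ |
    ⟨a1, a2, a3, -⟩ | ⟨a1, a2, a3, a4, a5⟩ | ⟨a1, a2, a3, -⟩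
  · omega
  · refine ⟨Or.inr (shareV_iff.2 (by omega)), fun i j hd => ?_⟩
    unfold ThreeOf hE vE at hd
    omega
  all_goals omega

theorem ns_of_leftArmUp {A B : LShape} {y X l r l' r' : ℤ} {f f' : Prop}
    (h : A.LeftArmUp y X l r f) (h' : B.LeftArmUp y X l' r' f') (hf : ¬ f) (hl : l < r')
    (hl' : l' < r) (hf' : f' → l' ≤ l) : A.NS B := by
  have h1 := A.r_eq
  have h2 := B.r_eq
  have h3 := A.c_eq
  have h4 := B.c_eq
  obtain ⟨a1, a2, a3, a4, a5, a6⟩ := h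
  obtain ⟨b1, b2, b3, b4, b5, b6⟩ := h'
  rcases a6 with ⟨-, -, hh⟩ | ⟨a6, -⟩
  · exact absurd hh hf
  refine ⟨Or.inr (shareV_iff.2 (by omega)), fun i j hd => ?_⟩
  unfold ThreeOf hE vE at hd
  rcases b6 with ⟨b6, b7, b8⟩ | ⟨b6, b7⟩
  · have := hf' b8
    omega
  · omega

end LShape


/-! ### Ends and arms for all directions of the turns -/

namespace LShape

theorem orient_lo (b : Bool) (A : LShape) : (A.orient b).lo = A.lo := by cases b <;> rfl

theorem orient_hi (b : Bool) (A : LShape) : (A.orient b).hi = A.hi := by cases b <;> rfl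

theorem orient_c (b : Bool) (A : LShape) : (A.orient b).c = A.c := by cases b <;> rfl

theorem orient_r (b : Bool) (A : LShape) : (A.orient b).r = if b then A.r else -A.r := by
  cases b <;> rfl

theorem orient_vertical (b : Bool) (A : LShape) :
    (A.orient b).bot < (A.orient b).top ↔ A.bot < A.top := by
  cases b
  · simp [orient, flip]
  · exact Iff.rfl

theorem exists_orient_deg3 {b : Bool} {A B : LShape} {i : ℤ} :
    (∃ j, (A.orient b).Deg3 (B.orient b) i j) ↔ ∃ j, A.Deg3 B i j := by
  cases b
  · constructor
    · rintro ⟨j, h⟩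
      exact ⟨-j, flip_deg3.1 h⟩
    · rintro ⟨j, h⟩
      exact ⟨-j, flip_deg3.2 (by rwa [neg_neg])⟩
  · exact Iff.rfl

/-- The left end of an L-shape on a spine that turns at column `X`, upwards if `b` and downwards
otherwise. -/
def LeftEnd (b : Bool) (A : LShape) (X l : ℤ) (f : Prop) : Prop := (A.orient b).LeftEndUp X l f

/-- The right end of an L-shape on a spine that turns at column `Y`. -/
def RightEnd (b : Bool) (A : LShape) (Y r : ℤ) (f : Prop) : Prop := A.mirror.LeftEnd b (-Y) (-r) f

/-- A vertical segment on the left arm of a spine with middle row `y`. -/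
def LeftArm (b : Bool) (A : LShape) (y X l r : ℤ) (f : Prop) : Prop :=
  (A.orient b).LeftArmUp (if b then y else -y) X l r f

/-- A vertical segment on the right arm of a spine with middle row `y`. -/
def RightArm (b : Bool) (A : LShape) (y Y l r : ℤ) (f : Prop) : Prop :=
  A.mirror.LeftArm b y (-Y) (-r) (-l) f

theorem exists_leftEnd (b : Bool) (A : LShape) (X : ℤ) : ∃ l f, A.LeftEnd b X l f :=
  exists_leftEndUp _ _

theorem exists_rightEnd (b : Bool) (A : LShape) (Y : ℤ) : ∃ r f, A.RightEnd b Y r f := by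
  obtain ⟨l, f, h⟩ := exists_leftEnd b A.mirror (-Y)
  exact ⟨-l, f, by unfold RightEnd; rwa [neg_neg]⟩

/-- `l` and `A.lo` agree once both are clamped below by `X`, and `l` passes beyond `X` only by
following the arm. -/
theorem LeftEnd.bounds {b : Bool} {A : LShape} {X l : ℤ} {f : Prop} (h : A.LeftEnd b X l f) :
    A.lo ≤ max l X ∧ l ≤ max A.lo X ∧ (l < X → A.lo = X ∧ A.c = A.lo ∧ A.bot < A.top) := by
  unfold LeftEnd LeftEndUp at h
  rw [orient_lo, orient_hi, orient_c, orient_vertical] at h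
  have := orient_vertical b A
  have := (A.orient b).bot_le_top
  omega

theorem LeftEnd.of_flag {b : Bool} {A : LShape} {X l : ℤ} {f : Prop} (h : A.LeftEnd b X l f)
    (hf : f) : X ≤ l ∧ (l = X ∨ l = A.lo) ∧ (X < A.lo ∨ X < l → A.c = A.lo ∧ A.bot < A.top) := by
  unfold LeftEnd LeftEndUp at h
  simp only [orient_lo, orient_hi, orient_c, orient_vertical, hf, not_true, and_false, or_false,
    false_or, and_true] at h
  omega

theorem LeftEnd.of_not_flag {b : Bool} {A : LShape} {X l : ℤ} {f : Prop} (h : A.LeftEnd b X l f)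
    (hf : ¬ f) : X ≤ A.lo ∧ (X < A.lo → A.c = A.hi ∨ A.bot = A.top) := by
  unfold LeftEnd LeftEndUp at h
  have := orient_vertical b A
  have := (A.orient b).bot_le_top
  have := A.bot_le_top
  simp only [orient_lo, orient_hi, orient_c, hf, not_false_eq_true, and_false,
    false_or, and_true] at h
  omega

theorem LeftEnd.not_deg3 {b : Bool} {A B : LShape} {X l l' : ℤ} {f f' : Prop} (hr : A.r = B.r)
    (hA : A.lo < A.hi) (hB : B.lo < B.hi) (hBA : B.lo < A.hi)
    (h : A.LeftEnd b X l f) (h' : B.LeftEnd b X l' f') (hf : ¬ f) (hf' : f' → l' ≤ l)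
    {i j : ℤ} (hi : i < A.hi) (hi' : i < B.hi) : ¬ A.Deg3 B i j := by
  intro hd
  obtain ⟨j, hd⟩ := exists_orient_deg3.2 ⟨j, hd⟩
  refine not_deg3_of_leftEndUp ?_ ?_ ?_ ?_ h h' hf hf' ?_ ?_ hd <;>
    simp only [orient_r, orient_lo, orient_hi, *]

theorem LeftEnd.exists_deg3 {b : Bool} {A B : LShape} {X l l' : ℤ} {f f' : Prop} (hr : A.r = B.r)
    (hB : B.lo < B.hi) (hAB : A.lo < B.hi) (hBA : B.lo < A.hi)
    (h : A.LeftEnd b X l f) (h' : B.LeftEnd b X l' f') (hf : ¬ f) (hf' : f') (hl : l < l') :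
    ∃ i j, A.Deg3 B i j := by
  obtain ⟨i, hd⟩ := exists_deg3_of_leftEndUp (by simp only [orient_r, hr])
    (by simpa only [orient_lo, orient_hi]) (by simpa only [orient_lo, orient_hi])
    (by simpa only [orient_lo, orient_hi]) h h' hf hf' hl
  exact ⟨i, exists_orient_deg3.1 hd⟩

theorem LeftEnd.ns_leftArm {b : Bool} {A B : LShape} {X l l' r' : ℤ} {f f' : Prop}
    (h : A.LeftEnd b X l f) (h' : B.LeftArm b A.r X l' r' f') (hf : ¬ f) (hl : l < r')
    (hf' : f' → l' ≤ l) : A.NS B := by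
  rw [← orient_ns (b := b)]
  refine ns_of_leftEndUp_of_leftArmUp h ?_ hf hl hf'
  rwa [orient_r]

theorem LeftEnd.of_ns_leftArm {b : Bool} {A B : LShape} {X l l' r' : ℤ} {f f' : Prop}
    (hA : A.lo < A.hi) (hX : X < A.hi) (h : A.LeftEnd b X l f)
    (h' : B.LeftArm b A.r X l' r' f') (hf : ¬ f) (hns : A.NS B) :
    l < r' ∧ (f' → l' ≤ l) := by
  rw [← orient_ns (b := b)] at hns
  refine of_ns_of_leftEndUp_of_leftArmUp ?_ ?_ h ?_ hf hns
  · rwa [orient_lo, orient_hi]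
  · rwa [orient_hi]
  · rwa [orient_r]

theorem LeftArm.ns_leftEnd {b : Bool} {A B : LShape} {X l r l' : ℤ} {f f' : Prop}
    (h : A.LeftArm b B.r X l r f) (h' : B.LeftEnd b X l' f') (hf : ¬ f) (hl : l' < r) :
    A.NS B := by
  rw [← orient_ns (b := b)]
  refine ns_of_leftArmUp_of_leftEndUp (l := l) ?_ h' hf hl
  rwa [orient_r]

theorem LeftArm.ns {b : Bool} {A B : LShape} {y X l r l' r' : ℤ} {f f' : Prop}
    (h : A.LeftArm b y X l r f) (h' : B.LeftArm b y X l' r' f') (hf : ¬ f) (hl : l < r')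
    (hl' : l' < r) (hf' : f' → l' ≤ l) : A.NS B := by
  rw [← orient_ns (b := b)]
  exact ns_of_leftArmUp h h' hf hl hl' hf'

theorem LeftArm.bounds {b : Bool} {A : LShape} {y X l r : ℤ} {f : Prop}
    (h : A.LeftArm b y X l r f) : l < r ∧ r ≤ X := by
  obtain ⟨-, h1, h2, h3, h4, -⟩ := h
  omega

end LShape

open LShape

/-! ### L-shapes on a spine -/

/-- A spine with middle row `y`, containing the edge between columns `z` and `z + 1`, that turns at
the columns `X ≤ z` and `Y > z`. -/
structure Frame where
  /-- the column of the left vertex of the central edge -/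
  z : ℤ
  /-- the middle row -/
  y : ℤ
  /-- the column of the left turn -/
  X : ℤ
  /-- the column of the right turn -/
  Y : ℤ
  /-- whether the left arm goes upwards -/
  bL : Bool
  /-- whether the right arm goes upwards -/
  bR : Bool
  X_le : X ≤ z
  lt_Y : z < Y

/-- The reflection of a frame in a vertical line. -/
def Frame.mirror (F : Frame) : Frame :=
  ⟨-F.z - 1, F.y, -F.Y, -F.X, F.bR, F.bL, by have := F.lt_Y; omega, by have := F.X_le; omega⟩

/-- `A` has horizontal edges in the middle row and meets the spine in `[l, r]`. -/
structure MidPlaced (F : Frame) (A : LShape) (l r : ℤ) (fl fr : Prop) : Prop where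
  row : A.r = F.y
  lo_lt_hi : A.lo < A.hi
  X_lt : F.X < A.hi
  lt_Y : A.lo < F.Y
  left : A.LeftEnd F.bL F.X l fl
  right : A.RightEnd F.bR F.Y r fr
  not_fr : A.hi ≤ F.z → ¬ fr
  not_fl : F.z < A.lo → ¬ fl

/-- `A` meets the spine in `[l, r]`, and `fl`, `fr` say whether it leaves the spine at the ends. -/
def Placed (F : Frame) (A : LShape) (l r : ℤ) (fl fr : Prop) : Prop :=
  MidPlaced F A l r fl fr ∨ (A.LeftArm F.bL F.y F.X l r fl ∧ ¬ fr) ∨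
    (A.RightArm F.bR F.y F.Y l r fr ∧ ¬ fl)

/-- `A` is a part of the spine that contains the central edge. -/
structure IsCore (F : Frame) (A : LShape) (l r : ℤ) (fl fr : Prop) : Prop
    extends MidPlaced F A l r fl fr where
  no_fl : ¬ fl
  no_fr : ¬ fr
  lo_le : A.lo ≤ F.z
  lt_hi : F.z < A.hi

/-- Non-splitting of the interval `[l, r]` of a spine with the interval `[l', r']`, given whether
the latter leaves the spine at its ends. -/
def Abs (l r l' r' : ℤ) (fl' fr' : Prop) : Prop :=
  l < r' ∧ l' < r ∧ (fl' → l' ≤ l) ∧ (fr' → r ≤ r')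

section

variable {F : Frame} {A B : LShape} {l r l' r' : ℤ} {fl fr fl' fr' : Prop}

theorem MidPlaced.mirror (h : MidPlaced F A l r fl fr) :
    MidPlaced F.mirror A.mirror (-r) (-l) fr fl where
  row := h.row
  lo_lt_hi := by have := h.lo_lt_hi; simp [LShape.mirror, this]
  X_lt := by have := h.lt_Y; simp [LShape.mirror, Frame.mirror, this]
  lt_Y := by have := h.X_lt; simp [LShape.mirror, Frame.mirror, this]
  left := h.right
  right := by
    have := h.left
    simpa [RightEnd, mirror_mirror, Frame.mirror] using this
  not_fr := by
    have := h.not_fl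
    simp only [LShape.mirror, Frame.mirror]
    exact fun h => this (by omega)
  not_fl := by
    have := h.not_fr
    simp only [LShape.mirror, Frame.mirror]
    exact fun h => this (by omega)

theorem IsCore.mirror (h : IsCore F A l r fl fr) :
    IsCore F.mirror A.mirror (-r) (-l) fr fl where
  toMidPlaced := h.toMidPlaced.mirror
  no_fl := h.no_fr
  no_fr := h.no_fl
  lo_le := by have := h.lt_hi; simp only [LShape.mirror, Frame.mirror]; omega
  lt_hi := by have := h.lo_le; simp only [LShape.mirror, Frame.mirror]; omega

theorem Placed.mirror (h : Placed F A l r fl fr) :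
    Placed F.mirror A.mirror (-r) (-l) fr fl := by
  rcases h with h | ⟨h, h'⟩ | ⟨h, h'⟩
  · exact Or.inl h.mirror
  · refine Or.inr (Or.inr ⟨?_, h'⟩)
    simpa [RightArm, LShape.mirror_mirror, Frame.mirror] using h
  · exact Or.inr (Or.inl ⟨h, h'⟩)

theorem Abs.mirror (h : Abs l r l' r' fl' fr') : Abs (-r) (-l) (-r') (-l') fr' fl' := by
  obtain ⟨h1, h2, h3, h4⟩ := h
  exact ⟨by omega, by omega, fun h => by have := h4 h; omega, fun h => by have := h3 h; omega⟩

theorem RightEnd.bounds' {b : Bool} {Y : ℤ} (h : A.RightEnd b Y r fr) :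
    min r Y ≤ A.hi ∧ min A.hi Y ≤ r ∧ (Y < r → A.hi = Y ∧ A.c = A.hi ∧ A.bot < A.top) := by
  have := h.bounds
  simp only [LShape.mirror] at this
  omega

theorem RightEnd.of_flag' {b : Bool} {Y : ℤ} (h : A.RightEnd b Y r fr) (hf : fr) :
    r ≤ Y ∧ (r = Y ∨ r = A.hi) ∧ (A.hi < Y ∨ r < Y → A.c = A.hi ∧ A.bot < A.top) := by
  have := h.of_flag hf
  simp only [LShape.mirror] at this
  omega

theorem MidPlaced.ns_of_overlap (h : MidPlaced F A l r fl fr) (h' : MidPlaced F B l' r' fl' fr')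
    (hfl : ¬ fl) (hfr : ¬ fr) (hlr : A.lo < B.hi) (hrl : B.lo < A.hi) (hl : fl' → l' ≤ l)
    (hr : fr' → r ≤ r') : A.NS B := by
  have hrow : A.r = B.r := h.row.trans h'.row.symm
  refine ⟨Or.inl (shareH_iff.2 ⟨hrow, h.lo_lt_hi, h'.lo_lt_hi, hlr, hrl⟩), fun i j hd => ?_⟩
  -- A column not left of both right ends is right of both left ends, because the intervals overlap;
  -- there the reflected statement applies.
  by_cases hi : i < A.hi ∧ i < B.hi
  · exact h.left.not_deg3 hrow h.lo_lt_hi h'.lo_lt_hi hrl h'.left hfl hl hi.1 hi.2 hd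
  · have hA := h.lo_lt_hi
    have hB := h'.lo_lt_hi
    refine LeftEnd.not_deg3 (A := A.mirror) (B := B.mirror) (i := -i) (j := j)
      hrow ?_ ?_ ?_ h.right h'.right hfr ?_ ?_ ?_ (mirror_deg3.2 (by rwa [neg_neg]))
    all_goals try simp only [LShape.mirror]
    · omega
    · omega
    · omega
    · exact fun h => by have := hr h; omega
    · omega
    · omega

theorem MidPlaced.ns (h : MidPlaced F A l r fl fr) (h' : MidPlaced F B l' r' fl' fr')
    (hfl : ¬ fl) (hfr : ¬ fr) (habs : Abs l r l' r' fl' fr') : A.NS B := by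
  obtain ⟨h1, h2, h3, h4⟩ := habs
  have e1 := h.left.bounds
  have e2 := RightEnd.bounds' h.right
  have e3 := h'.left.bounds
  have e4 := RightEnd.bounds' h'.right
  have e5 := h.X_lt
  have e6 := h.lt_Y
  have e7 := h'.X_lt
  have e8 := h'.lt_Y
  have e9 := F.X_le
  have e10 := F.lt_Y
  exact h.ns_of_overlap h' hfl hfr (by omega) (by omega) h3 h4

theorem Placed.ns_of_left (h : Placed F A l r fl fr)
    (h' : B.LeftArm F.bL F.y F.X l' r' fl') (hfl : ¬ fl) (habs : Abs l r l' r' fl' fr') :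
    A.NS B := by
  obtain ⟨h1, h2, h3, h4⟩ := habs
  rcases h with h | ⟨h, -⟩ | ⟨h, -⟩
  · exact h.left.ns_leftArm (h.row ▸ h') hfl h1 h3
  · exact h.ns h' hfl h1 h2 h3
  · have := h.bounds
    have := h'.bounds
    have := F.X_le
    have := F.lt_Y
    omega

theorem Placed.ns_of_mid (h : Placed F A l r fl fr) (h' : MidPlaced F B l' r' fl' fr')
    (hfl : ¬ fl) (hfr : ¬ fr) (habs : Abs l r l' r' fl' fr') : A.NS B := by
  rcases h with h | ⟨h, -⟩ | ⟨h, -⟩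
  · exact h.ns h' hfl hfr habs
  · exact LeftArm.ns_leftEnd (h'.row ▸ h) h'.left hfl habs.2.1
  · rw [← mirror_ns]
    have hrow : B.mirror.r = F.y := h'.row
    exact LeftArm.ns_leftEnd (hrow ▸ h) h'.right hfr (by have := habs.1; omega)

/-- Only the first path has to stay on the spine, and neither needs to contain the central edge. So
this also applies to pairs in the stable set when one of the two paths does not leave the spine. -/
theorem Placed.ns (h : Placed F A l r fl fr) (h' : Placed F B l' r' fl' fr') (hfl : ¬ fl)
    (hfr : ¬ fr) (habs : Abs l r l' r' fl' fr') : A.NS B := by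
  rcases h' with h' | ⟨h', -⟩ | ⟨h', -⟩
  · exact h.ns_of_mid h' hfl hfr habs
  · exact h.ns_of_left h' hfl habs
  · rw [← mirror_ns]
    exact h.mirror.ns_of_left h' hfr habs.mirror

theorem IsCore.vertical (h : IsCore F A l r fl fr) (hv : A.bot < A.top) :
    (A.c = A.lo ∧ A.lo = F.X) ∨ (A.c = A.hi ∧ A.hi = F.Y) := by
  have h1 := h.left.of_not_flag h.no_fl
  have h2 := h.right.of_not_flag h.no_fr
  have h3 := A.c_eq
  have h4 := h.lo_lt_hi
  simp only [LShape.mirror] at h2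
  omega

/-- If the shared edge is vertical, both paths have their corner at the same turn, and both continue
from it into the middle row, where they overlap. -/
theorem IsCore.overlap_of_ns (h : IsCore F A l r fl fr) (hlt : B.lo < B.hi)
    (hX : F.X < B.hi) (hY : B.lo < F.Y) (hns : A.NS B) : A.lo < B.hi ∧ B.lo < A.hi := by
  rcases hns.1 with hs | hs
  · have := shareH_iff.1 hs
    omega
  · have h1 := shareV_iff.1 hs
    have h2 := h.vertical h1.2.1
    have h3 := B.c_eq
    have h4 := h.lo_lt_hi
    omega

theorem IsCore.abs_of_ns_mid (h : IsCore F A l r fl fr) (h' : MidPlaced F B l' r' fl' fr')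
    (hns : A.NS B) : Abs l r l' r' fl' fr' := by
  obtain ⟨o1, o2⟩ := h.overlap_of_ns h'.lo_lt_hi h'.X_lt h'.lt_Y hns
  have e1 := h.left.bounds
  have e2 := RightEnd.bounds' h.right
  have e3 := h'.left.bounds
  have e4 := RightEnd.bounds' h'.right
  have e5 := h.X_lt
  have e6 := h.lt_Y
  have e7 := h'.X_lt
  have e8 := h'.lt_Y
  have e9 := F.X_le
  have e10 := F.lt_Y
  have e11 := (h.left.of_not_flag h.no_fl).1
  have e12 := (h.right.of_not_flag h.no_fr).1
  have hrow : A.r = B.r := h.row.trans h'.row.symm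
  have hlt := h'.lo_lt_hi
  simp only [LShape.mirror] at e12
  refine ⟨by omega, by omega, fun hf => ?_, fun hf => ?_⟩
  · by_contra hl
    obtain ⟨i, j, hd⟩ := h.left.exists_deg3 hrow h'.lo_lt_hi o1 o2 h'.left h.no_fl hf (by omega)
    exact hns.2 i j hd
  · by_contra hl
    obtain ⟨i, j, hd⟩ := LeftEnd.exists_deg3 (A := A.mirror) (B := B.mirror) hrow
      (by simp only [LShape.mirror]; omega) (by simp only [LShape.mirror]; omega)
      (by simp only [LShape.mirror]; omega) h.right h'.right h.no_fr hf (by omega)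
    exact hns.2 _ _ (mirror_deg3.1 hd)

theorem IsCore.interval (h : IsCore F A l r fl fr) : l ≤ F.z ∧ F.z < r := by
  have e1 := h.left.bounds
  have e2 := RightEnd.bounds' h.right
  have e3 := F.X_le
  have e4 := F.lt_Y
  have e5 := h.lo_le
  have e6 := h.lt_hi
  omega

theorem IsCore.abs_of_ns_left (h : IsCore F A l r fl fr) (h' : B.LeftArm F.bL F.y F.X l' r' fl')
    (hfr' : ¬ fr') (hns : A.NS B) : Abs l r l' r' fl' fr' := by
  have h1 := h.left.of_ns_leftArm h.lo_lt_hi h.X_lt (h.row ▸ h') h.no_fl hns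
  have h2 := h.interval
  have h3 := h'.bounds
  have h4 := F.X_le
  exact ⟨h1.1, by omega, h1.2, fun hf => absurd hf hfr'⟩

theorem IsCore.abs_of_ns (h : IsCore F A l r fl fr) (h' : Placed F B l' r' fl' fr')
    (hns : A.NS B) : Abs l r l' r' fl' fr' := by
  rcases h' with h' | ⟨h', hf⟩ | ⟨h', hf⟩
  · exact h.abs_of_ns_mid h' hns
  · exact h.abs_of_ns_left h' hf hns
  · simpa using (h.mirror.abs_of_ns_left (F := F.mirror) (B := B.mirror) h' hf
      (mirror_ns.2 hns)).mirror

end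


/-! ### Neighbours of a core path lie on the spine -/

open LShape

/-- `B` shares an edge with the arm but has no edge in the middle row. If `B` reached below that
row, it would split from `A` at the turn; if its horizontal leg were attached at its lower end, it
would split from `A` there. -/
theorem LShape.exists_leftArmUp {A B : LShape} {X l : ℤ} {f : Prop} (hA : A.lo < A.hi)
    (h : A.LeftEndUp X l f) (hf : ¬ f) (hc : A.c = A.lo) (hv : A.bot < A.top)
    (hrow : B.r = A.r → B.lo = B.hi) (hcol : A.c = B.c) (hns : A.NS B) :
    ∃ l' r' f', B.LeftArmUp A.r X l' r' f' := by
  have h1 := A.r_eq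
  have h2 := B.r_eq
  have h3 := B.c_eq
  have h4 := B.lo_le_hi
  have hX : A.lo = X ∧ A.bot = A.r := by
    unfold LeftEndUp at h
    simp only [hf, not_false_eq_true, and_false, false_or, and_true] at h
    omega
  rw [ns_iff, shareH_iff, shareV_iff] at hns
  obtain ⟨hs, hd⟩ := hns
  have hs : B.bot < B.top ∧ A.bot < B.top ∧ B.bot < A.top := by omega
  have hbot : A.r ≤ B.bot := by
    by_contra hlt
    refine hd X A.r ?_
    unfold Deg3 ThreeOf hE vE
    exact Or.inr (Or.inr (Or.inl ⟨by omega, by omega, by omega⟩))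
  unfold LeftArmUp
  by_cases hlt : B.lo < B.hi
  · have htop : B.r = B.top := by
      by_contra hne
      refine hd X B.bot ?_
      unfold Deg3 ThreeOf hE vE
      rcases h3 with h3 | h3
      · exact Or.inr (Or.inr (Or.inl ⟨by omega, by omega, by omega⟩))
      · exact Or.inr (Or.inr (Or.inr ⟨by omega, by omega, by omega⟩))
    exact ⟨_, _, True, by omega, hbot, hs.1, rfl, rfl, Or.inl ⟨hlt, htop, trivial⟩⟩
  · exact ⟨_, _, False, by omega, hbot, hs.1, rfl, rfl, Or.inr ⟨by omega, not_false⟩⟩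

theorem LShape.lt_hi_of_leftEndUp {A B : LShape} {X l : ℤ} {f : Prop} (hA : A.lo < A.hi)
    (h : A.LeftEndUp X l f) (hf : ¬ f) (hc : A.c = A.lo) (hv : A.bot < A.top)
    (hrow : A.r = B.r) (hB : B.lo < B.hi) (hcol : A.c = B.c) (hns : A.NS B) : X < B.hi := by
  have h1 := A.r_eq
  have h2 := B.r_eq
  have h3 := B.c_eq
  have hX : A.lo = X ∧ A.bot = A.r := by
    unfold LeftEndUp at h
    simp only [hf, not_false_eq_true, and_false, false_or, and_true] at h
    omega
  by_contra hlt
  refine hns.2 X A.r ?_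
  unfold ThreeOf hE vE
  exact Or.inl ⟨by omega, by omega, by omega⟩

variable {F : Frame} {A B : LShape} {l r : ℤ} {fl fr : Prop}

theorem IsCore.X_lt_hi (h : IsCore F A l r fl fr) (hrow : B.r = F.y) (hB : B.lo < B.hi)
    (hns : A.NS B) : F.X < B.hi := by
  have hX := (h.left.of_not_flag h.no_fl).1
  have hr := h.row.trans hrow.symm
  have hlt := h.lo_lt_hi
  have h1 := F.X_le
  have h2 := F.lt_Y
  have h3 := B.c_eq
  rcases hns.1 with hs | hs
  · have := shareH_iff.1 hs
    omega
  · have hv := shareV_iff.1 hs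
    rcases h.vertical hv.2.1 with ⟨hc, hlo⟩ | ⟨hc, hhi⟩
    · have := lt_hi_of_leftEndUp (A := A.orient F.bL) (B := B.orient F.bL)
        (by simpa only [orient_lo, orient_hi]) h.left h.no_fl (by simpa only [orient_c, orient_lo])
        ((orient_vertical _ _).2 hv.2.1) (by simp only [orient_r, hr])
        (by simpa only [orient_lo, orient_hi]) (by simpa only [orient_c] using hv.1)
        (orient_ns.2 hns)
      rwa [orient_hi] at this
    · omega

/-- A path ending at or before the left vertex of the central edge has its right end inside every
core path that it overlaps, so leaving the spine there would create a split. -/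
theorem IsCore.not_fr_of_hi_le (h : IsCore F A l r fl fr) (hrow : B.r = F.y) (hB : B.lo < B.hi)
    (hX : F.X < B.hi) (hY : B.lo < F.Y) (hns : A.NS B) {r' : ℤ} {f : Prop}
    (hr : B.RightEnd F.bR F.Y r' f) (hz : B.hi ≤ F.z) : ¬ f := by
  intro hf
  obtain ⟨o1, o2⟩ := h.overlap_of_ns hB hX hY hns
  have h1 := RightEnd.of_flag' hr hf
  have h2 := F.lt_Y
  have h3 := B.r_eq
  have h4 := h.row
  have h5 := h.lt_hi
  refine hns.2 B.hi B.r ?_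
  unfold ThreeOf hE vE
  rcases h3 with h3 | h3
  · exact Or.inl ⟨by omega, by omega, by omega⟩
  · exact Or.inr (Or.inl ⟨by omega, by omega, by omega⟩)

theorem IsCore.exists_midPlaced (h : IsCore F A l r fl fr) (hrow : B.r = F.y)
    (hB : B.lo < B.hi) (hns : A.NS B) : ∃ l' r' fl' fr', MidPlaced F B l' r' fl' fr' := by
  have hX := h.X_lt_hi hrow hB hns
  have hBm : B.mirror.lo < B.mirror.hi := by simp only [LShape.mirror]; omega
  have hrm : B.mirror.r = F.mirror.y := hrow
  have hYm := h.mirror.X_lt_hi hrm hBm (mirror_ns.2 hns)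
  have hY : B.lo < F.Y := by simp only [LShape.mirror, Frame.mirror] at hYm; omega
  obtain ⟨l', fl', hl⟩ := exists_leftEnd F.bL B F.X
  obtain ⟨r', fr', hr⟩ := exists_rightEnd F.bR B F.Y
  refine ⟨l', r', fl', fr', hrow, hB, hX, hY, hl, hr,
    h.not_fr_of_hi_le hrow hB hX hY hns hr, fun hz => ?_⟩
  refine h.mirror.not_fr_of_hi_le (r' := -l') hrm hBm hYm ?_ (mirror_ns.2 hns) ?_ ?_
  · simp only [LShape.mirror, Frame.mirror]; omega
  · simpa [RightEnd, mirror_mirror, Frame.mirror] using hl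
  · simp only [LShape.mirror, Frame.mirror]; omega

theorem IsCore.exists_leftArm (h : IsCore F A l r fl fr) (hrow : B.r = F.y → B.lo = B.hi)
    (hcol : A.c = B.c) (hv : A.bot < A.top) (hc : A.c = A.lo) (hns : A.NS B) :
    ∃ l' r' f', B.LeftArm F.bL F.y F.X l' r' f' := by
  have hlt := h.lo_lt_hi
  obtain ⟨l', r', f', h'⟩ := exists_leftArmUp (A := A.orient F.bL) (B := B.orient F.bL)
    (by simpa only [orient_lo, orient_hi]) h.left h.no_fl (by simpa only [orient_c, orient_lo])
    ((orient_vertical _ _).2 hv) (by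
      simp only [orient_r, orient_lo, orient_hi]
      intro he
      refine hrow ?_
      rw [← h.row]
      split at he <;> omega) (by simpa only [orient_c]) (orient_ns.2 hns)
  refine ⟨l', r', f', ?_⟩
  rw [orient_r, h.row] at h'
  exact h'

/-- A neighbour without horizontal edges in the middle row must share a vertical edge with the core
path. By `IsCore.vertical` that edge lies on an arm. -/
theorem IsCore.exists_placed (h : IsCore F A l r fl fr) (hns : A.NS B) :
    ∃ l' r' fl' fr', Placed F B l' r' fl' fr' := by
  by_cases hmid : B.r = F.y ∧ B.lo < B.hi
  · obtain ⟨l', r', fl', fr', h'⟩ := h.exists_midPlaced hmid.1 hmid.2 hns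
    exact ⟨l', r', fl', fr', Or.inl h'⟩
  have hle := B.lo_le_hi
  have hv : A.c = B.c ∧ A.bot < A.top := by
    rcases hns.1 with hs | hs
    · have := shareH_iff.1 hs
      have := h.row
      omega
    · have := shareV_iff.1 hs
      omega
  rcases h.vertical hv.2 with ⟨hc, -⟩ | ⟨hc, -⟩
  · obtain ⟨l', r', f', h'⟩ := h.exists_leftArm (by omega) hv.1 hv.2 hc hns
    exact ⟨l', r', f', False, Or.inr (Or.inl ⟨h', not_false⟩)⟩
  · obtain ⟨l', r', f', h'⟩ := h.mirror.exists_leftArm (B := B.mirror)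
      (by simp only [LShape.mirror, Frame.mirror]; omega)
      (by simp only [LShape.mirror]; omega) hv.2 (by simp only [LShape.mirror]; omega)
      (mirror_ns.2 hns)
    refine ⟨-r', -l', False, f', Or.inr (Or.inr ⟨?_, not_false⟩)⟩
    unfold RightArm
    simpa [Frame.mirror] using h'

/-- The constraints on an interval `[l, r]` of a spine with turns at `X` and `Y`, with or without
leaving the spine at its ends, that are imposed by having at most one bend. -/
def OneBend (z X Y l r : ℤ) (fl fr : Prop) : Prop :=
  (¬ fl → ¬ fr → ¬ (l < X ∧ Y < r)) ∧ (¬ fl → fr → r ≤ Y ∨ Y ≤ l) ∧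
  (fl → ¬ fr → X ≤ l ∨ r ≤ X) ∧
  (fl → fr → X ≤ l ∧ r ≤ Y ∧ (l = X ∨ r = Y)) ∧ (fl → l ≤ z) ∧ (fr → z < r)

/-- The single corner is spent either on following a turn or on turning off the spine. Only running
straight on at a turn is free, so a path that leaves at both ends does so at `X` on the left or at
`Y` on the right. -/
theorem MidPlaced.oneBend (h : MidPlaced F A l r fl fr) : OneBend F.z F.X F.Y l r fl fr := by
  have h1 := h.left.bounds
  have h2 := RightEnd.bounds' h.right
  have h3 := h.lo_lt_hi
  have h4 := F.X_le
  have h5 := F.lt_Y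
  refine ⟨fun hl hr => by omega, fun hl hr => ?_, fun hl hr => ?_, fun hl hr => ?_, fun hl => ?_,
    fun hr => ?_⟩
  · have := RightEnd.of_flag' h.right hr
    omega
  · have := h.left.of_flag hl
    omega
  · have e1 := h.left.of_flag hl
    have e2 := RightEnd.of_flag' h.right hr
    have e3 : ¬ A.hi ≤ F.z := fun hz => h.not_fr hz hr
    have e4 : ¬ F.z < A.lo := fun hz => h.not_fl hz hl
    have := h.X_lt
    have := h.lt_Y
    omega
  · have : ¬ F.z < A.lo := fun hz => h.not_fl hz hl
    omega
  · have : ¬ A.hi ≤ F.z := fun hz => h.not_fr hz hr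
    omega

theorem MidPlaced.lt (h : MidPlaced F A l r fl fr) : l < r := by
  have h1 := h.left.bounds
  have h2 := RightEnd.bounds' h.right
  have h3 := h.lo_lt_hi
  have h4 := F.X_le
  have h5 := F.lt_Y
  have := h.X_lt
  have := h.lt_Y
  omega

theorem Placed.oneBend (h : Placed F A l r fl fr) : OneBend F.z F.X F.Y l r fl fr := by
  have h4 := F.X_le
  have h5 := F.lt_Y
  rcases h with h | ⟨h, hf⟩ | ⟨h, hf⟩
  · exact h.oneBend
  · have := h.bounds
    exact ⟨fun _ _ => by omega, fun _ hr => absurd hr hf, fun _ _ => by omega,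
      fun _ hr => absurd hr hf, fun _ => by omega, fun hr => absurd hr hf⟩
  · have := h.bounds
    exact ⟨fun _ _ => by omega, fun _ _ => by omega, fun hl => absurd hl hf,
      fun hl => absurd hl hf, fun hl => absurd hl hf, fun _ => by omega⟩

theorem Placed.lt (h : Placed F A l r fl fr) : l < r := by
  rcases h with h | ⟨h, hf⟩ | ⟨h, hf⟩
  · exact h.lt
  · exact h.bounds.1
  · have := h.bounds.1
    omega


open LShape

/-! ### Cliques of L-shapes lie on a spine -/

/-- Two L-shapes share a horizontal edge. -/
def ShareH (A B : LShape) : Prop := ∃ i j, A.hE i j ∧ B.hE i j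

theorem ShareH.symm {A B : LShape} (h : ShareH A B) : ShareH B A := by
  obtain ⟨i, j, h1, h2⟩ := h
  exact ⟨i, j, h2, h1⟩

theorem ShareH.refl_left {A B : LShape} (h : ShareH A B) : ShareH A A := by
  obtain ⟨i, j, h1, h2⟩ := h
  exact ⟨i, j, h1, h1⟩

theorem shareH_or_swap_of_ns {A B : LShape} (h : A.NS B) :
    ShareH A B ∨ ShareH A.swap B.swap :=
  h.1.imp id fun ⟨i, j, h'⟩ => ⟨j, i, h'⟩

/-- All three horizontal segments lie in one row. If those of `A` and `C` shared no edge but their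
vertical segments did, then the common corner would have an edge to the left, one to the right and a
vertical one. -/
theorem ShareH.trans {A B C : LShape} (h1 : ShareH A B) (h2 : ShareH B C) (h3 : A.NS C) :
    ShareH A C := by
  by_contra hn
  have hs := h3.1.resolve_left hn
  have e1 := shareH_iff.1 h1
  have e2 := shareH_iff.1 h2
  have e3 := shareV_iff.1 hs
  have a1 := A.c_eq
  have a2 := C.c_eq
  have a3 := A.r_eq
  have hAC : A.hi ≤ C.lo ∨ C.hi ≤ A.lo := by
    by_contra hc
    exact hn (shareH_iff.2 (by omega))
  refine h3.2 A.c A.r ?_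
  unfold ThreeOf hE vE
  rcases a3 with a3 | a3
  · exact Or.inl ⟨by omega, by omega, by omega⟩
  · exact Or.inr (Or.inl ⟨by omega, by omega, by omega⟩)

/-- Two relations, each transitive on the clique by `ShareH.trans`, together cover all pairs, so one
of them holds for all pairs. The third alternative is for a single path without edges. -/
theorem forall_shareH_or {V : Type*} {A : V → LShape} {K : Set V}
    (hK : ∀ u ∈ K, ∀ v ∈ K, u ≠ v → (A u).NS (A v)) :
    (∀ u ∈ K, ∀ v ∈ K, ShareH (A u) (A v)) ∨
    (∀ u ∈ K, ∀ v ∈ K, ShareH (A u).swap (A v).swap) ∨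
    ∀ u ∈ K, ∀ B : LShape, ¬ (A u).NS B := by
  by_cases hsub : K.Subsingleton
  · by_cases h1 : ∀ u ∈ K, ShareH (A u) (A u)
    · exact Or.inl fun u hu v hv => hsub hu hv ▸ h1 u hu
    by_cases h2 : ∀ u ∈ K, ShareH (A u).swap (A u).swap
    · exact Or.inr (Or.inl fun u hu v hv => hsub hu hv ▸ h2 u hu)
    push Not at h1 h2
    obtain ⟨u, hu, hu'⟩ := h1
    obtain ⟨v, hv, hv'⟩ := h2
    obtain rfl := hsub hu hv
    refine Or.inr (Or.inr fun w hw B hB => ?_)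
    obtain rfl := hsub hu hw
    rcases shareH_or_swap_of_ns hB with h | h
    · exact hu' h.refl_left
    · exact hv' h.refl_left
  have hrefl : ∀ f : LShape → LShape,
      (∀ u ∈ K, ∀ v ∈ K, u ≠ v → ShareH (f (A u)) (f (A v))) →
      ∀ u ∈ K, ∀ v ∈ K, ShareH (f (A u)) (f (A v)) := by
    intro f h u hu v hv
    by_cases huv : u = v
    · subst huv
      obtain ⟨w, hw, hwu⟩ := (Set.not_subsingleton_iff.1 hsub).exists_ne u
      exact (h u hu w hw hwu.symm).refl_left
    · exact h u hu v hv huv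
  by_cases hall : ∀ u ∈ K, ∀ v ∈ K, u ≠ v → ShareH (A u) (A v)
  · exact Or.inl (hrefl id hall)
  push Not at hall
  obtain ⟨u, hu, v, hv, huv, hn⟩ := hall
  have hor : ∀ x ∈ K, ∀ y ∈ K, x ≠ y → ¬ ShareH (A x) (A y) → ShareH (A x).swap (A y).swap :=
    fun x hx y hy hxy h => (shareH_or_swap_of_ns (hK x hx y hy hxy)).resolve_left h
  have htr : ∀ x ∈ K, ∀ y ∈ K, ∀ z ∈ K, x ≠ z → ShareH (A x).swap (A y).swap →
      ShareH (A y).swap (A z).swap → ShareH (A x).swap (A z).swap :=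
    fun x hx y _ z hz hxz h1 h2 => h1.trans h2 (hK x hx z hz hxz).swap
  have huv' := hor u hu v hv huv hn
  -- Relative to a pair `u`, `v` that shares only vertical edges, every other member shares a
  -- vertical edge with `u`, directly or through `v`; any two members are then linked through `u`.
  have hstar : ∀ w ∈ K, w ≠ u → ShareH (A w).swap (A u).swap := by
    intro w hw hwu
    by_cases hwv : w = v
    · subst hwv
      exact huv'.symm
    by_cases h : ShareH (A w) (A u)
    · have hwv' : ¬ ShareH (A w) (A v) := fun h' =>
        hn (h.symm.trans h' (hK u hu v hv huv))
      exact htr w hw v hv u hu hwu (hor w hw v hv hwv hwv') huv'.symm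
    · exact hor w hw u hu hwu h
  refine Or.inr (Or.inl (hrefl LShape.swap fun x hx y hy hxy => ?_))
  by_cases hxu : x = u
  · subst hxu
    exact (hstar y hy hxy.symm).symm
  by_cases hyu : y = u
  · subst hyu
    exact hstar x hx hxu
  exact htr x hx u hu y hy hxy (hstar x hx hxu) (hstar y hy hyu).symm

theorem LShape.LeftEnd.not_flag {b : Bool} {A : LShape} {X l : ℤ} {f : Prop} (h : A.LeftEnd b X l f)
    (hX : X ≤ A.lo)
    (hv : A.c = A.lo → A.bot < A.top → A.lo = X ∧ if b then A.bot = A.r else A.top = A.r) :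
    ¬ f := by
  intro hf
  have := h.of_flag hf
  have := A.r_eq
  unfold LeftEnd LeftEndUp at h
  cases b
  · simp only [Bool.false_eq_true, if_false] at hv
    simp only [orient, Bool.false_eq_true, if_false, LShape.flip, hf, not_true, and_false,
      or_false, false_or, and_true] at h
    omega
  · simp only [if_true] at hv
    simp only [orient, if_true, hf, not_true, and_false, or_false, false_or, and_true] at h
    omega

/-- The turn is put at the least left end. A vertical leg at a left end further to the right would
split from the member that attains the minimum, and two such legs on opposite sides of the row would
split from each other. -/
theorem exists_leftEnd_of_clique {V : Type*} [Finite V] {A : V → LShape} {K : Set V}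
    (hne : K.Nonempty) (hK : ∀ u ∈ K, ∀ v ∈ K, u ≠ v → (A u).NS (A v))
    (hH : ∀ u ∈ K, ∀ v ∈ K, ShareH (A u) (A v)) :
    ∃ (X : ℤ) (b : Bool), ∀ k ∈ K, X ≤ (A k).lo ∧ ∃ l f, (A k).LeftEnd b X l f ∧ ¬ f := by
  obtain ⟨m, hm, hmin⟩ := Set.exists_min_image K (fun k => (A k).lo) K.toFinite hne
  have hshare : ∀ u ∈ K, ∀ v ∈ K, _ := fun u hu v hv => shareH_iff.1 (hH u hu v hv)
  have hlo : ∀ u ∈ K, (A u).c = (A u).lo → (A u).bot < (A u).top → (A u).lo = (A m).lo := by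
    intro u hu hc hv
    by_contra hlt
    have hum : u ≠ m := fun h => hlt (h ▸ rfl)
    have h1 := hshare u hu m hm
    have h2 := hmin u hu
    have h3 := (A u).r_eq
    refine (hK u hu m hm hum).2 (A u).c (A u).r ?_
    unfold ThreeOf hE vE
    rcases h3 with h3 | h3
    · exact Or.inl ⟨by omega, by omega, by omega⟩
    · exact Or.inr (Or.inl ⟨by omega, by omega, by omega⟩)
  have hdir : ∀ u ∈ K, ∀ v ∈ K, (A u).c = (A u).lo → (A u).bot < (A u).top →
      (A v).c = (A v).lo → (A v).bot < (A v).top → (A u).bot = (A u).r → (A v).bot = (A v).r := by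
    intro u hu v hv hcu hvu hcv hvv hbu
    by_contra hbv
    have huv : u ≠ v := by rintro rfl; exact hbv hbu
    have h1 := hshare u hu v hv
    have h2 := (A v).r_eq
    have h3 := hlo u hu hcu hvu
    have h4 := hlo v hv hcv hvv
    refine (hK u hu v hv huv).2 (A u).c (A u).r ?_
    unfold ThreeOf hE vE
    exact Or.inr (Or.inr (Or.inl ⟨by omega, by omega, by omega⟩))
  obtain ⟨b, hb⟩ : ∃ b : Bool, ∀ k ∈ K, (A k).c = (A k).lo → (A k).bot < (A k).top →
      if b then (A k).bot = (A k).r else (A k).top = (A k).r := by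
    by_cases h : ∃ u ∈ K, (A u).c = (A u).lo ∧ (A u).bot < (A u).top ∧ (A u).bot = (A u).r
    · obtain ⟨u, hu, h1, h2, h3⟩ := h
      exact ⟨true, fun k hk hc hv => by simpa using hdir u hu k hk h1 h2 hc hv h3⟩
    · refine ⟨false, fun k hk hc hv => ?_⟩
      have h1 := (A k).r_eq
      have h2 : (A k).bot ≠ (A k).r := fun h' => h ⟨k, hk, hc, hv, h'⟩
      simp only [Bool.false_eq_true, if_false]
      omega
  refine ⟨(A m).lo, b, fun k hk => ⟨hmin k hk, ?_⟩⟩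
  obtain ⟨l, f, h⟩ := exists_leftEnd b (A k) (A m).lo
  exact ⟨l, f, h, h.not_flag (hmin k hk)
    fun hc hv => ⟨hlo k hk hc hv, hb k hk hc hv⟩⟩

theorem exists_frame {V : Type*} [Finite V] {A : V → LShape} {K : Set V}
    (hne : K.Nonempty) (hK : ∀ u ∈ K, ∀ v ∈ K, u ≠ v → (A u).NS (A v))
    (hH : ∀ u ∈ K, ∀ v ∈ K, ShareH (A u) (A v)) :
    ∃ F : Frame, ∀ k ∈ K, ∃ l r fl fr, IsCore F (A k) l r fl fr := by
  have hshare : ∀ u ∈ K, ∀ v ∈ K, _ := fun u hu v hv => shareH_iff.1 (hH u hu v hv)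
  obtain ⟨m, hm, hmax⟩ := Set.exists_max_image K (fun k => (A k).lo) K.toFinite hne
  obtain ⟨X, bL, hL⟩ := exists_leftEnd_of_clique hne hK hH
  obtain ⟨Y', bR, hR⟩ := exists_leftEnd_of_clique (A := fun v => (A v).mirror) hne
    (fun u hu v hv huv => (hK u hu v hv huv).mirror) (fun u hu v hv => by
      have := hshare u hu v hv
      refine shareH_iff.2 ?_
      simp only [LShape.mirror]
      omega)
  have hY : ∀ k ∈ K, (A k).hi ≤ -Y' := fun k hk => by
    have := (hR k hk).1
    simp only [LShape.mirror] at this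
    omega
  -- Helly on a line: pairwise overlapping intervals all contain the edge that starts at the
  -- greatest left end. The right turn comes from the reflected family, hence `-Y'`.
  refine ⟨⟨(A m).lo, (A m).r, X, -Y', bL, bR, (hL m hm).1, ?_⟩, fun k hk => ?_⟩
  · have := hY m hm
    have := hshare m hm m hm
    omega
  · have h1 := hshare k hk m hm
    have h2 : (A k).lo ≤ (A m).lo := hmax k hk
    have h3 := hY k hk
    obtain ⟨h4, l, fl, hl, hfl⟩ := hL k hk
    obtain ⟨-, r, fr, hr, hfr⟩ := hR k hk
    refine ⟨l, -r, fl, fr, ⟨h1.1, h1.2.1, ?_, ?_, hl, ?_, fun _ => hfr, fun _ => hfl⟩, hfl, hfr,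
      h2, ?_⟩
    · dsimp only; omega
    · dsimp only; omega
    · unfold RightEnd
      simpa using hr
    · dsimp only; omega

/-- The vertices of `K` and their neighbours. -/
def Live {V : Type*} (G : SimpleGraph V) (K : Set V) (v : V) : Prop :=
  v ∈ K ∨ ∃ k ∈ K, G.Adj k v

/-- Intervals of a line, with marks for leaving the line at the ends, that describe how the
neighbours of `K` meet a line that contains the members of `K`. -/
structure LineModel {V : Type*} (G : SimpleGraph V) (K : Set V) where
  /-- the central edge is `[z, z + 1]` -/
  z : ℤ
  /-- the left turn -/
  X : ℤ
  /-- the right turn -/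
  Y : ℤ
  /-- the left ends -/
  l : V → ℤ
  /-- the right ends -/
  r : V → ℤ
  /-- whether the line is left at the left end -/
  fl : V → Prop
  /-- whether the line is left at the right end -/
  fr : V → Prop
  X_le : X ≤ z
  lt_Y : z < Y
  core : ∀ k ∈ K, l k ≤ z ∧ z < r k ∧ ¬ fl k ∧ ¬ fr k
  lt : ∀ v, Live G K v → l v < r v
  oneBend : ∀ v, Live G K v → OneBend z X Y (l v) (r v) (fl v) (fr v)
  abs_of_adj : ∀ k ∈ K, ∀ v, G.Adj k v → Abs (l k) (r k) (l v) (r v) (fl v) (fr v)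
  adj_of_abs : ∀ u v, u ≠ v → Live G K u → Live G K v → ¬ fl u → ¬ fr u →
    Abs (l u) (r u) (l v) (r v) (fl v) (fr v) → G.Adj u v

theorem nonempty_lineModel_of_shareH {V : Type*} [Finite V] {G : SimpleGraph V} {K : Set V}
    (hne : K.Nonempty) (hcl : G.IsClique K) {A : V → LShape}
    (hA : ∀ u v, G.Adj u v ↔ u ≠ v ∧ (A u).NS (A v))
    (hH : ∀ u ∈ K, ∀ v ∈ K, ShareH (A u) (A v)) : Nonempty (LineModel G K) := by
  obtain ⟨F, hF⟩ := exists_frame hne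
    (fun u hu v hv huv => ((hA u v).1 (hcl hu hv huv)).2) hH
  have key : ∀ v, ∃ l r fl fr, (v ∈ K → IsCore F (A v) l r fl fr) ∧
      (Live G K v → Placed F (A v) l r fl fr) := by
    intro v
    by_cases hv : v ∈ K
    · obtain ⟨l, r, fl, fr, h⟩ := hF v hv
      exact ⟨l, r, fl, fr, fun _ => h, fun _ => Or.inl h.toMidPlaced⟩
    by_cases hl : Live G K v
    · obtain ⟨k, hk, hkv⟩ := hl.resolve_left hv
      obtain ⟨l, r, fl, fr, h⟩ := hF k hk
      obtain ⟨l', r', fl', fr', h'⟩ := h.exists_placed ((hA k v).1 hkv).2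
      exact ⟨l', r', fl', fr', fun h => absurd h hv, fun _ => h'⟩
    · exact ⟨0, 0, False, False, fun h => absurd h hv, fun h => absurd h hl⟩
  choose l r fl fr hcore hplaced using key
  exact ⟨{
    z := F.z
    X := F.X
    Y := F.Y
    l := l
    r := r
    fl := fl
    fr := fr
    X_le := F.X_le
    lt_Y := F.lt_Y
    core := fun k hk => ⟨(hcore k hk).interval.1, (hcore k hk).interval.2, (hcore k hk).no_fl,
      (hcore k hk).no_fr⟩
    lt := fun v hv => (hplaced v hv).lt
    oneBend := fun v hv => (hplaced v hv).oneBend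
    abs_of_adj := fun k hk v hkv =>
      (hcore k hk).abs_of_ns (hplaced v (Or.inr ⟨k, hk, hkv⟩)) ((hA k v).1 hkv).2
    adj_of_abs := fun u v huv hu hv h1 h2 h =>
      (hA u v).2 ⟨huv, (hplaced u hu).ns (hplaced v hv) h1 h2 h⟩ }⟩

theorem nonempty_lineModel {V : Type*} [Finite V] {G : SimpleGraph V} {K : Set V}
    (hne : K.Nonempty) (hcl : G.IsClique K) (hG : G ∈ BendENPG 1 V) :
    Nonempty (LineModel G K) := by
  obtain ⟨A, hA⟩ := exists_lShape_family hG
  rcases forall_shareH_or (fun u hu v hv huv => ((hA u v).1 (hcl hu hv huv)).2) with h | h | h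
  · exact nonempty_lineModel_of_shareH hne hcl hA h
  · exact nonempty_lineModel_of_shareH hne hcl (A := fun v => (A v).swap)
      (fun u v => by rw [hA, swap_ns]) h
  · have hno : ∀ k ∈ K, ∀ v, ¬ G.Adj k v := fun k hk v hkv => h k hk _ ((hA k v).1 hkv).2
    have hlive : ∀ v, Live G K v → v ∈ K := by
      rintro v (hv | ⟨k, hk, hkv⟩)
      · exact hv
      · exact absurd hkv (hno k hk v)
    -- `K` has no neighbours here, so only its own members are live and they may all receive the
    -- interval `[0, 1]`.
    exact ⟨{
      z := 0
      X := 0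
      Y := 1
      l := fun _ => 0
      r := fun _ => 1
      fl := fun _ => False
      fr := fun _ => False
      X_le := le_rfl
      lt_Y := zero_lt_one
      core := fun k hk => by simp
      lt := fun v hv => zero_lt_one
      oneBend := fun v hv => by simp [OneBend]
      abs_of_adj := fun k hk v hkv => absurd hkv (hno k hk v)
      adj_of_abs := fun u v huv hu hv _ _ _ => hcl (hlive u hu) (hlive v hv) huv }⟩


/-! ### Paths of a comb -/

/-- The pendant edges of a path of a comb: at its ends, if it leaves the spine there. -/
def pendants (L R : ℤ) (fl fr : Prop) : Set ℤ := {t | (fl ∧ t = L) ∨ (fr ∧ t = R)}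

/-- Non-splitting of the paths of a comb with spine intervals `[L, R]`, `[L', R']` and with pendant
edges at the members of `D`, `D'`. -/
def CombNS (L R : ℤ) (D : Set ℤ) (L' R' : ℤ) (D' : Set ℤ) : Prop :=
  ((∃ t, (L ≤ t ∧ t < R) ∧ (L' ≤ t ∧ t < R')) ∨ ∃ t, t ∈ D ∧ t ∈ D') ∧
  ∀ t, ¬ ((L ≤ t - 1 ∧ t - 1 < R ∨ L' ≤ t - 1 ∧ t - 1 < R') ∧
    (L ≤ t ∧ t < R ∨ L' ≤ t ∧ t < R') ∧ (t ∈ D ∨ t ∈ D'))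

theorem CombNS.symm {L R L' R' : ℤ} {D D' : Set ℤ} (h : CombNS L R D L' R' D') :
    CombNS L' R' D' L R D := by
  refine ⟨?_, fun t ht => h.2 t ⟨ht.1.symm, ht.2.1.symm, ht.2.2.symm⟩⟩
  exact h.1.imp (fun ⟨t, h1, h2⟩ => ⟨t, h2, h1⟩) (fun ⟨t, h1, h2⟩ => ⟨t, h2, h1⟩)

theorem combNS_iff_abs {L R L' R' : ℤ} {fl fr fl' fr' : Prop} (hL : L < R) (hL' : L' < R')
    (hfl : ¬ fl) (hfr : ¬ fr) :
    CombNS L R (pendants L R fl fr) L' R' (pendants L' R' fl' fr') ↔ Abs L R L' R' fl' fr' := by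
  unfold CombNS pendants Abs
  simp only [Set.mem_ofPred_eq, hfl, hfr, false_and, or_self, exists_false, or_false, false_or]
  constructor
  · rintro ⟨⟨t, h1, h2⟩, h⟩
    refine ⟨by omega, by omega, fun hf => ?_, fun hf => ?_⟩
    · by_contra hlt
      exact h L' ⟨by omega, by omega, Or.inl ⟨hf, rfl⟩⟩
    · by_contra hlt
      exact h R' ⟨by omega, by omega, Or.inr ⟨hf, rfl⟩⟩
  · rintro ⟨h1, h2, h3, h4⟩
    refine ⟨⟨max L L', by omega, by omega⟩, ?_⟩
    rintro t ⟨e1, e2, ⟨hf, rfl⟩ | ⟨hf, rfl⟩⟩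
    · have := h3 hf
      omega
    · have := h4 hf
      omega

/-- With pendants on the same side at different places, the inner one sits at an interior vertex of
the union as soon as the paths share an edge, so they split. The last two alternatives make the
spine intervals edge-disjoint and rule out a common pendant on either side. -/
theorem not_combNS_of_flags {c L R L' R' : ℤ} {fl fr fl' fr' : Prop} (hL : L < R) (hL' : L' < R')
    (hl : fl → L < c) (hr : fr → c < R) (hl' : fl' → L' < c) (hr' : fr' → c < R')
    (h : (fl ∧ fl' ∧ L ≠ L') ∨ (fr ∧ fr' ∧ R ≠ R') ∨ (¬ fr ∧ ¬ fl' ∧ R ≤ L') ∨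
      (¬ fl ∧ ¬ fr' ∧ R' ≤ L)) :
    ¬ CombNS L R (pendants L R fl fr) L' R' (pendants L' R' fl' fr') := by
  unfold CombNS pendants
  simp only [Set.mem_ofPred_eq]
  rintro ⟨h1, h2⟩
  -- Left pendants lie before `c` and right pendants after it, so a left and a right pendant never
  -- coincide, and any common edge forces overlap.
  have ho : L < R' ∧ L' < R := by
    rcases h1 with ⟨t, h3, h4⟩ | ⟨t, ⟨h3, rfl⟩ | ⟨h3, rfl⟩, ⟨h4, h5⟩ | ⟨h4, h5⟩⟩
    · omega
    · omega
    · have := hl h3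
      have := hr' h4
      omega
    · have := hr h3
      have := hl' h4
      omega
    · omega
  rcases h with ⟨f, f', hne⟩ | ⟨f, f', hne⟩ | ⟨f, f', hne⟩ | ⟨f, f', hne⟩
  · by_cases hlt : L < L'
    · exact h2 L' ⟨by omega, by omega, Or.inr (Or.inl ⟨f', rfl⟩)⟩
    · exact h2 L ⟨by omega, by omega, Or.inl (Or.inl ⟨f, rfl⟩)⟩
  · by_cases hlt : R < R'
    · exact h2 R ⟨by omega, by omega, Or.inl (Or.inr ⟨f, rfl⟩)⟩
    · exact h2 R' ⟨by omega, by omega, Or.inr (Or.inr ⟨f', rfl⟩)⟩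
  · omega
  · omega

/-- The constraints on a path of a comb under which it has at most one bend when the comb is drawn
in a grid with turns of the spine at `X` and `Y`. -/
def CombOneBend (X Y L R : ℤ) (fl fr : Prop) : Prop :=
  (¬ fl → ¬ fr → ¬ (L < X ∧ Y < R)) ∧ (¬ fl → fr → X < L ∧ (R ≤ Y ∨ Y ≤ L)) ∧
  (fl → ¬ fr → R < Y ∧ (X ≤ L ∨ R ≤ X)) ∧ (fl → fr → X ≤ L ∧ R ≤ Y ∧ (L = X ∨ R = Y))

/-- Paths of a comb that represent `G`. -/
structure CombModel {V : Type*} (G : SimpleGraph V) (K : Set V) where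
  /-- a vertex of the spine that lies on all members of `K` -/
  c : ℤ
  /-- the left turn -/
  X : ℤ
  /-- the right turn -/
  Y : ℤ
  /-- the left ends of the spine intervals -/
  L : V → ℤ
  /-- the right ends of the spine intervals -/
  R : V → ℤ
  /-- whether there is a pendant edge at the left end -/
  fl : V → Prop
  /-- whether there is a pendant edge at the right end -/
  fr : V → Prop
  X_lt_Y : X < Y
  core : ∀ k ∈ K, L k ≤ c ∧ c ≤ R k ∧ ¬ fl k ∧ ¬ fr k
  le : ∀ v, L v ≤ R v
  lt : ∀ v, fl v ∨ fr v → L v < R v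
  meets : ∀ v, ∃ k ∈ K, L v ≤ R k ∧ L k ≤ R v
  oneBend : ∀ v, CombOneBend X Y (L v) (R v) (fl v) (fr v)
  adj_iff : ∀ u v, G.Adj u v ↔ u ≠ v ∧
    CombNS (L u) (R u) (pendants (L u) (R u) (fl u) (fr u))
      (L v) (R v) (pendants (L v) (R v) (fl v) (fr v))

/-- The position in a comb of an interval of a line: `s` stretches the line, and `i` makes the
pendant edges of different intervals distinct. -/
def Stretched (s : ℤ → ℤ) (N z X Y i l r : ℤ) (fl fr : Prop) (L R : ℤ) : Prop :=
  (¬ fl ∧ ¬ fr ∧ L = s l ∧ R = s r) ∨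
  (fl ∧ ¬ fr ∧ L = s l - i ∧ R = s (min r (z + 1) - 1) + 1) ∨
  (¬ fl ∧ fr ∧ L = s (max l z + 1) - 1 ∧ R = s r + i) ∨
  (fl ∧ fr ∧ l = X ∧ L = s X - N - 1 ∧ R = s r + i) ∨
  (fl ∧ fr ∧ l ≠ X ∧ L = s l - i ∧ R = s Y + N + 1)

/-- On the choices in `Stretched`: a leaving point moves outwards by the private amount `i`. A path
leaving on one side only is cut back at its other end, to at most `s z + 1` or at least `s (z + 1) -
1`, which separates the two kinds. A path leaving on both sides has one end at a turn; that end goes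
to the new turn `s X - N - 1` or `s Y + N + 1`, where going straight on costs no bend, and `i` is
applied at the other end. -/
theorem exists_stretched (s : ℤ → ℤ) (N z X Y i l r : ℤ) (fl fr : Prop) :
    ∃ L R, Stretched s N z X Y i l r fl fr L R := by
  unfold Stretched
  by_cases hl : fl <;> by_cases hr : fr <;> by_cases hX : l = X <;> simp [hl, hr, hX]

theorem stretch_trichotomy {s : ℤ → ℤ} {N : ℤ} (hs : ∀ a b, a < b → s a + N + 2 ≤ s b) (a b : ℤ) :
    (a < b ∧ s a + N + 2 ≤ s b) ∨ (a = b ∧ s a = s b) ∨ (b < a ∧ s b + N + 2 ≤ s a) := by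
  rcases lt_trichotomy a b with h | h | h
  · exact Or.inl ⟨h, hs _ _ h⟩
  · exact Or.inr (Or.inl ⟨h, h ▸ rfl⟩)
  · exact Or.inr (Or.inr ⟨h, hs _ _ h⟩)

/-- The new turns lie just beyond all points `s X - i` and `s Y + i` with `i ≤ N`, and still short
of `s (X - 1)` and `s (Y + 1)`; this is why consecutive points are at least `N + 2` apart. -/
theorem Stretched.basic {s : ℤ → ℤ} {N z X Y i l r L R : ℤ} {fl fr : Prop}
    (hs : ∀ a b, a < b → s a + N + 2 ≤ s b) (hi : 1 ≤ i) (hiN : i ≤ N) (hX : X ≤ z) (hY : z < Y)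
    (hlr : l < r) (hb : OneBend z X Y l r fl fr) (h : Stretched s N z X Y i l r fl fr L R) :
    L < R ∧ (fl → L < s z + 1) ∧ (fr → s z + 1 < R) ∧
      CombOneBend (s X - N - 1) (s Y + N + 1) L R fl fr := by
  obtain ⟨h1, h2, h3, h4, h5, h6⟩ := hb
  have T := stretch_trichotomy hs
  unfold CombOneBend
  rcases h with ⟨f, f', rfl, rfl⟩ | ⟨f, f', rfl, rfl⟩ | ⟨f, f', rfl, rfl⟩ |
    ⟨f, f', rfl, rfl, rfl⟩ | ⟨f, f', hne, rfl, rfl⟩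
  · have := h1 f f'
    have := T l r
    have := T l X
    have := T r Y
    simp only [f, f', not_false_eq_true, true_implies, false_implies, and_true, true_and,
      implies_true]
    omega
  · have := h3 f f'
    have := h5 f
    have := T l (min r (z + 1) - 1)
    have := T l X
    have := T l z
    have := T (min r (z + 1) - 1) X
    have := T (min r (z + 1) - 1) Y
    simp only [f, f', not_false_eq_true, true_implies, false_implies, and_true, true_and,
      not_true, implies_true]
    omega
  · have := h2 f f'
    have := h6 f'
    have := T r (max l z + 1)
    have := T r Y
    have := T r z
    have := T (max l z + 1) X
    have := T (max l z + 1) Y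
    simp only [f, f', not_false_eq_true, true_implies, false_implies, and_true, true_and,
      not_true, implies_true]
    omega
  · have := h4 f f'
    have := h5 f
    have := h6 f'
    have := T l r
    have := T l z
    have := T r z
    have := T r Y
    simp only [f, f', true_implies, false_implies, and_true, true_and,
      not_true, implies_true, true_or]
    omega
  · have := h4 f f'
    have := h5 f
    have := h6 f'
    have := T l r
    have := T l z
    have := T l X
    have := T z Y
    have := T l Y
    simp only [f, f', true_implies, false_implies, and_true, true_and,
      not_true, implies_true, or_true]
    omega

/-- Moving a leaving point outwards can create a new overlap only with an interval ending at the old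
point. In that case the leaving point is interior to that interval, contradicting the flag condition
in `ha`. -/
theorem Stretched.abs_of_abs {s : ℤ → ℤ} {N z X Y i l r L R l' r' : ℤ} {fl fr : Prop}
    (hs : ∀ a b, a < b → s a + N + 2 ≤ s b) (hi : 1 ≤ i) (hiN : i ≤ N) (hX : X ≤ z)
    (hlr' : l' < r') (hb : OneBend z X Y l r fl fr)
    (h : Stretched s N z X Y i l r fl fr L R) (ha : Abs (s l') (s r') L R fl fr) :
    Abs l' r' l r fl fr := by
  obtain ⟨h1, h2, h3, h4, h5, h6⟩ := hb
  obtain ⟨a1, a2, a3, a4⟩ := ha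
  have T := stretch_trichotomy hs
  unfold Abs
  rcases h with ⟨f, f', rfl, rfl⟩ | ⟨f, f', rfl, rfl⟩ | ⟨f, f', rfl, rfl⟩ |
    ⟨f, f', rfl, rfl, rfl⟩ | ⟨f, f', hne, rfl, rfl⟩
  · have := T l r'
    have := T l' r
    exact ⟨by omega, by omega, fun h => absurd h f, fun h => absurd h f'⟩
  · have := a3 f
    have := T l l'
    have := T l' (min r (z + 1) - 1)
    exact ⟨by omega, by omega, fun _ => by omega, fun h => absurd h f'⟩
  · have := a4 f'
    have := T r r'
    have := T r' (max l z + 1)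
    exact ⟨by omega, by omega, fun h => absurd h f, fun _ => by omega⟩
  · have := a3 f
    have := a4 f'
    have := T l l'
    have := T r r'
    exact ⟨by omega, by omega, fun _ => by omega, fun _ => by omega⟩
  · have := a3 f
    have := a4 f'
    have := h4 f f'
    have := T l l'
    have := T Y r'
    exact ⟨by omega, by omega, fun _ => by omega, fun _ => by omega⟩

/-- The cut-back ends stop next to the central edge. Since `[l', r']` contains that edge, cutting
back does not lose the overlap. -/
theorem Stretched.abs_of_core {s : ℤ → ℤ} {N z X Y i l r L R l' r' : ℤ} {fl fr : Prop}
    (hs : ∀ a b, a < b → s a + N + 2 ≤ s b) (hi : 1 ≤ i) (hiN : i ≤ N)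
    (hl' : l' ≤ z) (hr' : z < r') (hlr : l < r) (hb : OneBend z X Y l r fl fr)
    (h : Stretched s N z X Y i l r fl fr L R) (ha : Abs l' r' l r fl fr) :
    Abs (s l') (s r') L R fl fr := by
  obtain ⟨h1, h2, h3, h4, h5, h6⟩ := hb
  obtain ⟨a1, a2, a3, a4⟩ := ha
  have T := stretch_trichotomy hs
  unfold Abs
  rcases h with ⟨f, f', rfl, rfl⟩ | ⟨f, f', rfl, rfl⟩ | ⟨f, f', rfl, rfl⟩ |
    ⟨f, f', rfl, rfl, rfl⟩ | ⟨f, f', hne, rfl, rfl⟩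
  · have := T l r'
    have := T l' r
    exact ⟨by omega, by omega, fun h => absurd h f, fun h => absurd h f'⟩
  · have := a3 f
    have := T l l'
    have := T l' (min r (z + 1) - 1)
    have := T l r'
    exact ⟨by omega, by omega, fun _ => by omega, fun h => absurd h f'⟩
  · have := a4 f'
    have := T r r'
    have := T r' (max l z + 1)
    have := T r l'
    exact ⟨by omega, by omega, fun h => absurd h f, fun _ => by omega⟩
  · have := a3 f
    have := a4 f'
    have := T l l'
    have := T r r'
    have := T l r'
    have := T l' r
    exact ⟨by omega, by omega, fun _ => by omega, fun _ => by omega⟩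
  · have := a3 f
    have := a4 f'
    have := h4 f f'
    have := T l l'
    have := T Y r'
    have := T l r'
    have := T l' Y
    exact ⟨by omega, by omega, fun _ => by omega, fun _ => by omega⟩

/-- Distinct shifts separate paths leaving on the same side, and a shift never reaches a new turn.
Two paths both sent to the same turn are separated at their other ends. -/
theorem Stretched.ne {s : ℤ → ℤ} {N z X Y i l r L R i' l' r' L' R' : ℤ} {fl fr fl' fr' : Prop}
    (hs : ∀ a b, a < b → s a + N + 2 ≤ s b) (hi : 1 ≤ i) (hiN : i ≤ N) (hi' : 1 ≤ i')
    (hiN' : i' ≤ N) (hne : i ≠ i')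
    (hf : fl ∨ fr) (hf' : fl' ∨ fr')
    (h : Stretched s N z X Y i l r fl fr L R) (h' : Stretched s N z X Y i' l' r' fl' fr' L' R') :
    (fl ∧ fl' ∧ L ≠ L') ∨ (fr ∧ fr' ∧ R ≠ R') ∨ (¬ fr ∧ ¬ fl' ∧ R ≤ L') ∨
      (¬ fl ∧ ¬ fr' ∧ R' ≤ L) := by
  have T := stretch_trichotomy hs
  rcases h with ⟨f, g, rfl, rfl⟩ | ⟨f, g, rfl, rfl⟩ | ⟨f, g, rfl, rfl⟩ |
    ⟨f, g, rfl, rfl, rfl⟩ | ⟨f, g, -, rfl, rfl⟩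
  · exact absurd hf (not_or.2 ⟨f, g⟩)
  all_goals
    rcases h' with ⟨f', g', rfl, rfl⟩ | ⟨f', g', rfl, rfl⟩ | ⟨f', g', rfl, rfl⟩ |
      ⟨f', g', hX, rfl, rfl⟩ | ⟨f', g', -, rfl, rfl⟩
    · exact absurd hf' (not_or.2 ⟨f', g'⟩)
  · exact Or.inl ⟨f, f', by have := T l l'; omega⟩
  · refine Or.inr (Or.inr (Or.inl ⟨g, f', ?_⟩))
    have := T (min r (z + 1) - 1) (max l' z + 1)
    omega
  · exact Or.inl ⟨f, f', by have := T l X; omega⟩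
  · exact Or.inl ⟨f, f', by have := T l l'; omega⟩
  · refine Or.inr (Or.inr (Or.inr ⟨f, g', ?_⟩))
    have := T (min r' (z + 1) - 1) (max l z + 1)
    omega
  · exact Or.inr (Or.inl ⟨g, g', by have := T r r'; omega⟩)
  · exact Or.inr (Or.inl ⟨g, g', by have := T r r'; omega⟩)
  · exact Or.inr (Or.inl ⟨g, g', by have := T r Y; omega⟩)
  · exact Or.inl ⟨f, f', by have := T l l'; omega⟩
  · exact Or.inr (Or.inl ⟨g, g', by have := T r r'; omega⟩)
  · exact Or.inr (Or.inl ⟨g, g', by have := T r r'; omega⟩)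
  · exact Or.inl ⟨f, f', by have := T l l'; omega⟩
  · exact Or.inl ⟨f, f', by have := T l l'; omega⟩
  · exact Or.inr (Or.inl ⟨g, g', by have := T r' Y; omega⟩)
  · exact Or.inl ⟨f, f', by have := T l X; omega⟩
  · exact Or.inl ⟨f, f', by have := T l l'; omega⟩

theorem LineModel.nonempty_combModel {V : Type*} [Finite V] {G : SimpleGraph V} {K S : Set V}
    (hKS : IsSplitPartition G K S) (hne : K.Nonempty) (M : LineModel G K) :
    Nonempty (CombModel G K) := by
  classical
  obtain ⟨N, ⟨e⟩⟩ := Finite.exists_equiv_fin V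
  obtain ⟨i, hi1, hiN, hinj⟩ : ∃ i : V → ℤ, (∀ v, 1 ≤ i v) ∧ (∀ v, i v ≤ N) ∧
      ∀ u v, u ≠ v → i u ≠ i v := by
    refine ⟨fun v => (e v : ℕ) + 1, fun v => ?_, fun v => ?_, fun u v huv h => huv ?_⟩
    · dsimp only
      omega
    · have := (e v).2
      dsimp only
      omega
    · dsimp only at h
      exact e.injective (Fin.ext (by omega))
  obtain ⟨s, hs⟩ : ∃ s : ℤ → ℤ, ∀ a b, a < b → s a + N + 2 ≤ s b := by
    refine ⟨fun a => (N + 2) * a, fun a b hab => ?_⟩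
    have : (N + 2 : ℤ) * (a + 1) ≤ (N + 2) * b :=
      mul_le_mul_of_nonneg_left (by omega) (by omega)
    linarith
  have hX := M.X_le
  have hY := M.lt_Y
  have key : ∀ v, ∃ L R fl fr,
      (Live G K v → Stretched s N M.z M.X M.Y (i v) (M.l v) (M.r v) (M.fl v) (M.fr v) L R ∧
        fl = M.fl v ∧ fr = M.fr v) ∧
      -- A vertex outside `K` without neighbours in `K` is isolated, by stability of `S`; it gets a
      -- one-vertex path at `c`, which meets every core path but shares no edge with any path.
      (¬ Live G K v → L = s M.z + 1 ∧ R = s M.z + 1 ∧ fl = False ∧ fr = False) := by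
    intro v
    by_cases h : Live G K v
    · obtain ⟨L, R, hLR⟩ := exists_stretched s N M.z M.X M.Y (i v) (M.l v) (M.r v) (M.fl v) (M.fr v)
      exact ⟨L, R, M.fl v, M.fr v, fun _ => ⟨hLR, rfl, rfl⟩, fun h' => absurd h h'⟩
    · exact ⟨s M.z + 1, s M.z + 1, False, False, fun h' => absurd h' h,
        fun _ => ⟨rfl, rfl, rfl, rfl⟩⟩
  choose L R fl fr hlive hdead using key
  have hbasic : ∀ v, Live G K v → L v < R v ∧ (fl v → L v < s M.z + 1) ∧
      (fr v → s M.z + 1 < R v) ∧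
      CombOneBend (s M.X - N - 1) (s M.Y + N + 1) (L v) (R v) (fl v) (fr v) := by
    intro v hv
    obtain ⟨h, h1, h2⟩ := hlive v hv
    rw [h1, h2]
    exact h.basic hs (hi1 v) (hiN v) hX hY (M.lt v hv) (M.oneBend v hv)
  have hunflag : ∀ v, Live G K v → ¬ fl v → ¬ fr v → L v = s (M.l v) ∧ R v = s (M.r v) := by
    intro v hv h1 h2
    obtain ⟨h, h3, h4⟩ := hlive v hv
    rw [h3] at h1
    rw [h4] at h2
    unfold Stretched at h
    simpa only [h1, h2, not_false_eq_true, false_and, true_and, or_false] using h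
  have hcore : ∀ k ∈ K, L k ≤ s M.z + 1 ∧ s M.z + 1 ≤ R k ∧ ¬ fl k ∧ ¬ fr k := by
    intro k hk
    obtain ⟨h1, h2, h3, h4⟩ := M.core k hk
    obtain ⟨-, h5, h6⟩ := hlive k (Or.inl hk)
    rw [← h5] at h3
    rw [← h6] at h4
    obtain ⟨h7, h8⟩ := hunflag k (Or.inl hk) h3 h4
    have t1 := stretch_trichotomy hs (M.l k) M.z
    have t2 := stretch_trichotomy hs (M.r k) M.z
    exact ⟨by omega, by omega, h3, h4⟩
  have hns_core : ∀ k ∈ K, ∀ v, G.Adj k v →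
      CombNS (L k) (R k) (pendants (L k) (R k) (fl k) (fr k))
        (L v) (R v) (pendants (L v) (R v) (fl v) (fr v)) := by
    intro k hk v hkv
    have hv : Live G K v := Or.inr ⟨k, hk, hkv⟩
    have hkl : Live G K k := Or.inl hk
    obtain ⟨h1, h2, h3, h4⟩ := hcore k hk
    rw [combNS_iff_abs (hbasic k hkl).1 (hbasic v hv).1 h3 h4, (hunflag k hkl h3 h4).1,
      (hunflag k hkl h3 h4).2]
    obtain ⟨h5, h6, h7⟩ := hlive v hv
    rw [h6, h7]
    exact h5.abs_of_core hs (hi1 v) (hiN v) (M.core k hk).1 (M.core k hk).2.1 (M.lt v hv)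
      (M.oneBend v hv) (M.abs_of_adj k hk v hkv)
  have hunflag_ns : ∀ u v, u ≠ v → Live G K u → Live G K v → ¬ fl u → ¬ fr u →
      CombNS (L u) (R u) (pendants (L u) (R u) (fl u) (fr u))
        (L v) (R v) (pendants (L v) (R v) (fl v) (fr v)) → G.Adj u v := by
    intro u v huv hu hv h1 h2 hns
    rw [combNS_iff_abs (hbasic u hu).1 (hbasic v hv).1 h1 h2, (hunflag u hu h1 h2).1,
      (hunflag u hu h1 h2).2] at hns
    obtain ⟨h5, h6, h7⟩ := hlive v hv
    obtain ⟨-, h8, h9⟩ := hlive u hu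
    rw [h6, h7] at hns
    exact M.adj_of_abs u v huv hu hv (h8 ▸ h1) (h9 ▸ h2)
      (h5.abs_of_abs hs (hi1 v) (hiN v) hX (M.lt u hu) (M.oneBend v hv) hns)
  have hdead_ns : ∀ u v, ¬ Live G K u →
      ¬ CombNS (L u) (R u) (pendants (L u) (R u) (fl u) (fr u))
        (L v) (R v) (pendants (L v) (R v) (fl v) (fr v)) := by
    intro u v hu
    obtain ⟨h1, h2, h3, h4⟩ := hdead u hu
    rw [h1, h2, h3, h4]
    rintro ⟨⟨t, h, -⟩ | ⟨t, h, -⟩, -⟩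
    · omega
    · rcases h with h | h
      · exact h.1
      · exact h.1
  exact ⟨{
    c := s M.z + 1
    X := s M.X - N - 1
    Y := s M.Y + N + 1
    L := L
    R := R
    fl := fl
    fr := fr
    X_lt_Y := by
      have := stretch_trichotomy hs M.X M.Y
      omega
    core := hcore
    le := fun v => by
      by_cases h : Live G K v
      · exact (hbasic v h).1.le
      · rw [(hdead v h).1, (hdead v h).2.1]
    lt := fun v hv => by
      by_cases h : Live G K v
      · exact (hbasic v h).1
      · rw [(hdead v h).2.2.1, (hdead v h).2.2.2] at hv
        exact absurd hv (by simp)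
    meets := fun v => by
      by_cases h : Live G K v
      · rcases h with hv | ⟨k, hk, hkv⟩
        · exact ⟨v, hv, (hbasic v (Or.inl hv)).1.le, (hbasic v (Or.inl hv)).1.le⟩
        · refine ⟨k, hk, ?_⟩
          obtain ⟨h1, h2, h3, h4⟩ := hcore k hk
          have hv : Live G K v := Or.inr ⟨k, hk, hkv⟩
          have := hns_core k hk v hkv
          rw [combNS_iff_abs (hbasic k (Or.inl hk)).1 (hbasic v hv).1 h3 h4] at this
          exact ⟨this.2.1.le, this.1.le⟩
      · obtain ⟨k, hk⟩ := hne
        refine ⟨k, hk, ?_⟩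
        rw [(hdead v h).1, (hdead v h).2.1]
        exact ⟨(hcore k hk).2.1, (hcore k hk).1⟩
    oneBend := fun v => by
      by_cases h : Live G K v
      · exact (hbasic v h).2.2.2
      · obtain ⟨h1, h2, h3, h4⟩ := hdead v h
        rw [h1, h2, h3, h4]
        have t1 := stretch_trichotomy hs M.X M.z
        simp only [CombOneBend, not_false_eq_true, true_implies, false_implies, and_true]
        omega
    adj_iff := fun u v => by
      constructor
      · intro huv
        refine ⟨huv.ne, ?_⟩
        by_cases hu : u ∈ K
        · exact hns_core u hu v huv
        by_cases hv : v ∈ K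
        · exact (hns_core v hv u huv.symm).symm
        · have hu' : u ∈ S := (hKS.2.2.2 ▸ Set.mem_univ u : u ∈ K ∪ S).resolve_left hu
          have hv' : v ∈ S := (hKS.2.2.2 ▸ Set.mem_univ v : v ∈ K ∪ S).resolve_left hv
          exact absurd huv (hKS.2.1 hu' hv' huv.ne)
      · rintro ⟨huv, hns⟩
        by_cases hu : Live G K u
        swap
        · exact absurd hns (hdead_ns u v hu)
        by_cases hv : Live G K v
        swap
        · exact absurd hns.symm (hdead_ns v u hv)
        by_cases hfu : fl u ∨ fr u
        swap
        · exact hunflag_ns u v huv hu hv (fun h => hfu (Or.inl h)) (fun h => hfu (Or.inr h)) hns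
        by_cases hfv : fl v ∨ fr v
        swap
        · exact (hunflag_ns v u huv.symm hv hu (fun h => hfv (Or.inl h))
            (fun h => hfv (Or.inr h)) hns.symm).symm
        obtain ⟨su, hu1, hu2⟩ := hlive u hu
        obtain ⟨sv, hv1, hv2⟩ := hlive v hv
        obtain ⟨bu, bu1, bu2, -⟩ := hbasic u hu
        obtain ⟨bv, bv1, bv2, -⟩ := hbasic v hv
        -- Both paths leave the spine, so the line model says nothing about their adjacency; the
        -- construction guarantees that they are not adjacent.
        refine absurd hns (not_combNS_of_flags bu bv bu1 bu2 bv1 bv2 ?_)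
        rw [hu1, hu2] at hfu ⊢
        rw [hv1, hv2] at hfv ⊢
        exact su.ne hs (hi1 u) (hiN u) (hi1 v) (hiN v) (hinj u v huv) hfu hfv sv }⟩


/-! ### Sequences of vertices as paths -/

section

variable {W : Type*} {H : SimpleGraph W}

theorem exists_isPath_of_seq (n : ℕ) (f : ℕ → W) (hadj : ∀ i < n, H.Adj (f i) (f (i + 1)))
    (hinj : ∀ i ≤ n, ∀ j ≤ n, f i = f j → i = j) :
    ∃ p : H.Walk (f 0) (f n), p.IsPath ∧ (∀ x, x ∈ p.support ↔ ∃ i ≤ n, x = f i) ∧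
      ∀ x y, p.toSubgraph.Adj x y ↔ ∃ i < n, s(x, y) = s(f i, f (i + 1)) := by
  induction n generalizing f with
  | zero =>
    refine ⟨Walk.nil, Walk.IsPath.nil, fun x => by simp, fun x y => by simp⟩
  | succ n ih =>
    obtain ⟨p, hp, hs, ha⟩ := ih (fun i => f (i + 1)) (fun i hi => hadj (i + 1) (by omega))
      (fun i hi j hj h => by have := hinj (i + 1) (by omega) (j + 1) (by omega) h; omega)
    refine ⟨Walk.cons (hadj 0 (by omega)) p, ?_, fun x => ?_, fun x y => ?_⟩
    · rw [Walk.cons_isPath_iff]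
      refine ⟨hp, fun h => ?_⟩
      obtain ⟨i, hi, h⟩ := (hs _).1 h
      have := hinj 0 (by omega) (i + 1) (by omega) h
      omega
    · rw [Walk.support_cons, List.mem_cons, hs]
      constructor
      · rintro (rfl | ⟨i, hi, rfl⟩)
        · exact ⟨0, by omega, rfl⟩
        · exact ⟨i + 1, by omega, rfl⟩
      · rintro ⟨i, hi, rfl⟩
        rcases i with - | i
        · exact Or.inl rfl
        · exact Or.inr ⟨i, by omega, rfl⟩
    · simp only [Walk.toSubgraph, Subgraph.sup_adj, subgraphOfAdj_adj, ha]
      constructor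
      · rintro (h | ⟨i, hi, h⟩)
        · exact ⟨0, by omega, h.symm⟩
        · exact ⟨i + 1, by omega, h⟩
      · rintro ⟨i, hi, h⟩
        rcases i with - | i
        · exact Or.inl h.symm
        · exact Or.inr ⟨i, by omega, h⟩

theorem isPathSubgraph_of_seq {P : H.Subgraph} (g : ℤ → W) {a b : ℤ} (hab : a ≤ b)
    (hinj : ∀ s t, a ≤ s → s ≤ b → a ≤ t → t ≤ b → g s = g t → s = t)
    (hverts : ∀ x, x ∈ P.verts ↔ ∃ t, a ≤ t ∧ t ≤ b ∧ x = g t)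
    (hadj : ∀ x y, P.Adj x y ↔ ∃ t, a ≤ t ∧ t < b ∧ s(x, y) = s(g t, g (t + 1))) :
    IsPathSubgraph P := by
  obtain ⟨n, hn⟩ := Int.eq_ofNat_of_zero_le (a := b - a) (by omega)
  obtain ⟨p, hp, hs, ha⟩ := exists_isPath_of_seq (H := H) n (fun i => g (a + i))
    (fun i hi => ((hadj _ _).2 ⟨a + i, by omega, by omega, by push_cast; rw [add_assoc]⟩).adj_sub)
    (fun i hi j hj h => by
      have := hinj _ _ (by omega) (by omega) (by omega) (by omega) h
      omega)
  refine ⟨_, _, p, hp, Subgraph.ext (Set.ext fun x => ?_) (funext₂ fun x y => propext ?_)⟩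
  · rw [hverts, Walk.mem_verts_toSubgraph, hs]
    constructor
    · rintro ⟨t, h1, h2, rfl⟩
      exact ⟨(t - a).toNat, by omega, by congr 1; omega⟩
    · rintro ⟨i, h1, rfl⟩
      exact ⟨a + i, by omega, by omega, rfl⟩
  · rw [hadj, ha]
    constructor
    · rintro ⟨t, h1, h2, h⟩
      refine ⟨(t - a).toNat, by omega, ?_⟩
      rw [h]
      congr 2
      · omega
      · push_cast; omega
    · rintro ⟨i, h1, h⟩
      refine ⟨a + i, by omega, by omega, ?_⟩
      rw [h]
      push_cast
      rw [add_assoc]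

/-- A graph is acyclic if its vertices are ranked in such a way that every vertex has at most one
neighbour of at most its own rank. -/
theorem isAcyclic_of_rank (f : W → ℤ)
    (h : ∀ v x y, H.Adj v x → H.Adj v y → f x ≤ f v → f y ≤ f v → x = y) : H.IsAcyclic := by
  classical
  intro v p hp
  -- Start the cycle at a vertex of greatest rank: its two neighbours on the cycle are distinct, yet
  -- neither exceeds its rank.
  obtain ⟨m, hm, hmax⟩ := Finset.exists_max_image p.support.toFinset f ⟨v, by simp⟩
  rw [List.mem_toFinset] at hm
  have hq := hp.rotate hm
  have hle : ∀ x ∈ (p.rotate m hm).support, f x ≤ f m := by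
    intro x hx
    refine hmax x ?_
    rw [List.mem_toFinset]
    rw [← Walk.mem_verts_toSubgraph] at hx ⊢
    rwa [Walk.toSubgraph_rotate] at hx
  have hnil := hq.not_nil
  refine hq.snd_ne_penultimate (h m _ _ (Walk.adj_snd hnil) (Walk.adj_penultimate hnil).symm
    (hle _ ?_) (hle _ ?_))
  · exact Walk.getVert_mem_support _ _
  · exact Walk.getVert_mem_support _ _

/-! ### Combs in a host graph -/

/-- A comb in `H`: a path `sp A, …, sp B` with a pendant vertex `pd t` at each `sp t`. -/
structure Comb (H : SimpleGraph W) (sp pd : ℤ → W) (A B : ℤ) : Prop where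
  sp_adj : ∀ t, A ≤ t → t < B → H.Adj (sp t) (sp (t + 1))
  pd_adj : ∀ t, A ≤ t → t ≤ B → H.Adj (sp t) (pd t)
  sp_inj : ∀ s t, A ≤ s → s ≤ B → A ≤ t → t ≤ B → sp s = sp t → s = t
  pd_inj : ∀ s t, A ≤ s → s ≤ B → A ≤ t → t ≤ B → pd s = pd t → s = t
  sp_ne_pd : ∀ s t, A ≤ s → s ≤ B → A ≤ t → t ≤ B → sp s ≠ pd t

/-- The part of a comb with spine `[L, R]` and with the pendant vertices at the members of `D`. -/
def combSub (H : SimpleGraph W) (sp pd : ℤ → W) (L R : ℤ) (D : Set ℤ) : H.Subgraph where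
  verts := {x | (∃ t, L ≤ t ∧ t ≤ R ∧ x = sp t) ∨ ∃ t, L ≤ t ∧ t ≤ R ∧ t ∈ D ∧ x = pd t}
  -- The conjunct `H.Adj x y` makes this a subgraph for arbitrary `sp` and `pd`, before they are
  -- known to form a comb.
  Adj x y := H.Adj x y ∧ ((∃ t, L ≤ t ∧ t < R ∧ s(x, y) = s(sp t, sp (t + 1))) ∨
    ∃ t, L ≤ t ∧ t ≤ R ∧ t ∈ D ∧ s(x, y) = s(sp t, pd t))
  adj_sub h := h.1
  edge_vert := by
    rintro x y ⟨-, ⟨t, h1, h2, h⟩ | ⟨t, h1, h2, h3, h⟩⟩ <;>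
    rcases Sym2.eq_iff.1 h with ⟨rfl, rfl⟩ | ⟨rfl, rfl⟩
    · exact Or.inl ⟨t, h1, h2.le, rfl⟩
    · exact Or.inl ⟨t + 1, by omega, by omega, rfl⟩
    · exact Or.inl ⟨t, h1, h2, rfl⟩
    · exact Or.inr ⟨t, h1, h2, h3, rfl⟩
  symm := ⟨fun x y h => ⟨h.1.symm, by rw [Sym2.eq_swap]; exact h.2⟩⟩

variable {sp pd : ℤ → W} {A B L R L' R' : ℤ} {D D' : Set ℤ}

theorem combSub_mono (hL : L' ≤ L) (hR : R ≤ R') (hD : D ⊆ D') :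
    combSub H sp pd L R D ≤ combSub H sp pd L' R' D' := by
  refine ⟨?_, ?_⟩
  · rintro x (⟨t, h1, h2, h⟩ | ⟨t, h1, h2, h3, h⟩)
    · exact Or.inl ⟨t, by omega, by omega, h⟩
    · exact Or.inr ⟨t, by omega, by omega, hD h3, h⟩
  · rintro x y ⟨h0, ⟨t, h1, h2, h⟩ | ⟨t, h1, h2, h3, h⟩⟩
    · exact ⟨h0, Or.inl ⟨t, by omega, by omega, h⟩⟩
    · exact ⟨h0, Or.inr ⟨t, by omega, by omega, hD h3, h⟩⟩

theorem Comb.combSub_adj (hC : Comb H sp pd A B) (hA : A ≤ L) (hB : R ≤ B) {x y : W} :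
    (combSub H sp pd L R D).Adj x y ↔ (∃ t, L ≤ t ∧ t < R ∧ s(x, y) = s(sp t, sp (t + 1))) ∨
      ∃ t, L ≤ t ∧ t ≤ R ∧ t ∈ D ∧ s(x, y) = s(sp t, pd t) := by
  refine ⟨fun h => h.2, fun h => ⟨?_, h⟩⟩
  rw [← mem_edgeSet]
  rcases h with ⟨t, h1, h2, h⟩ | ⟨t, h1, h2, h3, h⟩
  · rw [h]
    exact hC.sp_adj t (by omega) (by omega)
  · rw [h]
    exact hC.pd_adj t (by omega) (by omega)

theorem Comb.combSub_adj_spine (hC : Comb H sp pd A B) (hA : A ≤ L) (hB : R ≤ B) {t : ℤ}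
    (ht : A ≤ t) (ht' : t < B) :
    (combSub H sp pd L R D).Adj (sp t) (sp (t + 1)) ↔ L ≤ t ∧ t < R := by
  rw [hC.combSub_adj hA hB]
  constructor
  · rintro (⟨t', h1, h2, h⟩ | ⟨t', h1, h2, -, h⟩)
    · rcases Sym2.eq_iff.1 h with ⟨h3, h4⟩ | ⟨h3, h4⟩
      · have := hC.sp_inj _ _ (by omega) (by omega) (by omega) (by omega) h3
        omega
      · have := hC.sp_inj _ _ (by omega) (by omega) (by omega) (by omega) h3
        have := hC.sp_inj _ _ (by omega) (by omega) (by omega) (by omega) h4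
        omega
    · rcases Sym2.eq_iff.1 h with ⟨h3, h4⟩ | ⟨h3, h4⟩
      · exact absurd h4 (hC.sp_ne_pd _ _ (by omega) (by omega) (by omega) (by omega))
      · exact absurd h3 (hC.sp_ne_pd _ _ (by omega) (by omega) (by omega) (by omega))
  · rintro ⟨h1, h2⟩
    exact Or.inl ⟨t, h1, h2, rfl⟩

theorem Comb.combSub_adj_pendant (hC : Comb H sp pd A B) (hA : A ≤ L) (hB : R ≤ B) {t : ℤ}
    (ht : A ≤ t) (ht' : t ≤ B) :
    (combSub H sp pd L R D).Adj (sp t) (pd t) ↔ L ≤ t ∧ t ≤ R ∧ t ∈ D := by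
  rw [hC.combSub_adj hA hB]
  constructor
  · rintro (⟨t', h1, h2, h⟩ | ⟨t', h1, h2, h3, h⟩)
    · rcases Sym2.eq_iff.1 h with ⟨h3, h4⟩ | ⟨h3, h4⟩
      · exact absurd h4.symm (hC.sp_ne_pd _ _ (by omega) (by omega) (by omega) (by omega))
      · exact absurd h4.symm (hC.sp_ne_pd _ _ (by omega) (by omega) (by omega) (by omega))
    · rcases Sym2.eq_iff.1 h with ⟨h4, h5⟩ | ⟨h4, h5⟩
      · obtain rfl := hC.sp_inj _ _ (by omega) (by omega) (by omega) (by omega) h4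
        exact ⟨h1, h2, h3⟩
      · exact absurd h4 (hC.sp_ne_pd _ _ (by omega) (by omega) (by omega) (by omega))
  · rintro ⟨h1, h2, h3⟩
    exact Or.inr ⟨t, h1, h2, h3, rfl⟩

theorem combSub_neighbor (hA : A ≤ L) (hB : R ≤ B) {w x : W}
    (h : (combSub H sp pd L R D).Adj w x) :
    (∃ t, A ≤ t ∧ t ≤ B ∧ w = sp t ∧ ((x = sp (t + 1) ∧ L ≤ t ∧ t < R) ∨
      (x = sp (t - 1) ∧ L ≤ t - 1 ∧ t - 1 < R) ∨ (x = pd t ∧ L ≤ t ∧ t ≤ R ∧ t ∈ D))) ∨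
    ∃ t, A ≤ t ∧ t ≤ B ∧ w = pd t ∧ x = sp t := by
  rcases h.2 with ⟨t, h1, h2, h⟩ | ⟨t, h1, h2, h3, h⟩ <;>
  rcases Sym2.eq_iff.1 h with ⟨rfl, rfl⟩ | ⟨rfl, rfl⟩
  · exact Or.inl ⟨t, by omega, by omega, rfl, Or.inl ⟨rfl, h1, h2⟩⟩
  · exact Or.inl ⟨t + 1, by omega, by omega, rfl,
      Or.inr (Or.inl ⟨by rw [add_sub_cancel_right], by omega, by omega⟩)⟩
  · exact Or.inl ⟨t, by omega, by omega, rfl, Or.inr (Or.inr ⟨rfl, h1, h2, h3⟩)⟩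
  · exact Or.inr ⟨t, by omega, by omega, rfl, rfl⟩

theorem encard_pair_lt_three {α : Type*} {s : Set α} {a b : α} (h : s ⊆ {a, b}) :
    ¬ 3 ≤ s.encard := by
  intro h3
  obtain ⟨x, hx, y, hy, z, hz, hxy, hxz, hyz⟩ := three_le_encard_iff.1 h3
  have hx := h hx
  have hy := h hy
  have hz := h hz
  simp only [Set.mem_insert_iff, Set.mem_singleton_iff] at hx hy hz
  grind

/-- A pendant vertex has at most one neighbour, so a split is exactly a spine vertex whose two spine
edges and pendant edge all occur in the union. -/
theorem Comb.nonSplitting_iff (hC : Comb H sp pd A B) (hA : A ≤ L) (hB : R ≤ B) (hA' : A ≤ L')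
    (hB' : R' ≤ B) (hD : ∀ t ∈ D, L ≤ t ∧ t ≤ R) (hD' : ∀ t ∈ D', L' ≤ t ∧ t ≤ R') :
    NonSplitting (combSub H sp pd L R D) (combSub H sp pd L' R' D') ↔
      CombNS L R D L' R' D' := by
  have hspine : ∀ t, L ≤ t ∧ t < R ∨ L' ≤ t ∧ t < R' → A ≤ t ∧ t < B := fun t _ => by omega
  have hpend : ∀ t, t ∈ D ∨ t ∈ D' → A ≤ t ∧ t ≤ B := fun t ht => by
    rcases ht with ht | ht
    · have := hD t ht; omega
    · have := hD' t ht; omega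
  have hsadj : ∀ t, A ≤ t → t < B →
      ((combSub H sp pd L R D ⊔ combSub H sp pd L' R' D').Adj (sp t) (sp (t + 1)) ↔
        L ≤ t ∧ t < R ∨ L' ≤ t ∧ t < R') := fun t h1 h2 => by
    rw [Subgraph.sup_adj, hC.combSub_adj_spine hA hB h1 h2, hC.combSub_adj_spine hA' hB' h1 h2]
  have hpadj : ∀ t, A ≤ t → t ≤ B →
      ((combSub H sp pd L R D ⊔ combSub H sp pd L' R' D').Adj (sp t) (pd t) ↔
        t ∈ D ∨ t ∈ D') := fun t h1 h2 => by
    rw [Subgraph.sup_adj, hC.combSub_adj_pendant hA hB h1 h2,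
      hC.combSub_adj_pendant hA' hB' h1 h2]
    refine or_congr ⟨fun h => h.2.2, fun h => ?_⟩ ⟨fun h => h.2.2, fun h => ?_⟩
    · exact ⟨(hD t h).1, (hD t h).2, h⟩
    · exact ⟨(hD' t h).1, (hD' t h).2, h⟩
  refine and_congr ⟨?_, ?_⟩ ⟨?_, ?_⟩
  · rintro ⟨e, he, he'⟩
    induction e with
    | _ a b =>
      rw [Subgraph.mem_edgeSet] at he he'
      rcases he.2 with ⟨t, h1, h2, h⟩ | ⟨t, h1, h2, h3, h⟩
      · refine Or.inl ⟨t, ⟨h1, h2⟩, ?_⟩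
        rw [← Subgraph.mem_edgeSet, h, Subgraph.mem_edgeSet,
          hC.combSub_adj_spine hA' hB' (by omega) (by omega)] at he'
        exact he'
      · refine Or.inr ⟨t, h3, ?_⟩
        rw [← Subgraph.mem_edgeSet, h, Subgraph.mem_edgeSet,
          hC.combSub_adj_pendant hA' hB' (by omega) (by omega)] at he'
        exact he'.2.2
  · rintro (⟨t, h1, h2⟩ | ⟨t, h1, h2⟩)
    · refine ⟨s(sp t, sp (t + 1)), ?_, ?_⟩ <;> rw [Subgraph.mem_edgeSet]
      · rwa [hC.combSub_adj_spine hA hB (by omega) (by omega)]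
      · rwa [hC.combSub_adj_spine hA' hB' (by omega) (by omega)]
    · have e1 := hD t h1
      have e2 := hD' t h2
      refine ⟨s(sp t, pd t), ?_, ?_⟩ <;> rw [Subgraph.mem_edgeSet]
      · rw [hC.combSub_adj_pendant hA hB (by omega) (by omega)]
        exact ⟨e1.1, e1.2, h1⟩
      · rw [hC.combSub_adj_pendant hA' hB' (by omega) (by omega)]
        exact ⟨e2.1, e2.2, h2⟩
  · rintro h t ⟨h1, h2, h3⟩
    have e1 := hspine _ h1
    have e2 := hspine _ h2
    have hmem : sp t ∈ splits (combSub H sp pd L R D) (combSub H sp pd L' R' D') := by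
      refine three_le_encard_iff.2 ⟨sp (t - 1), ?_, sp (t + 1), ?_, pd t, ?_, ?_, ?_, ?_⟩
      · have := (hsadj (t - 1) e1.1 e1.2).2 h1
        rw [sub_add_cancel] at this
        exact this.symm
      · exact (hsadj t e2.1 e2.2).2 h2
      · exact (hpadj t e2.1 e2.2.le).2 h3
      · intro he
        have := hC.sp_inj _ _ (by omega) (by omega) (by omega) (by omega) he
        omega
      · exact hC.sp_ne_pd _ _ (by omega) (by omega) (by omega) (by omega)
      · exact hC.sp_ne_pd _ _ (by omega) (by omega) (by omega) (by omega)
    rw [h] at hmem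
    exact hmem
  · intro h
    refine Set.eq_empty_iff_forall_notMem.2 fun w hw => ?_
    have hnb : ∀ x ∈ (combSub H sp pd L R D ⊔ combSub H sp pd L' R' D').neighborSet w,
        (∃ t, A ≤ t ∧ t ≤ B ∧ w = sp t ∧
          ((x = sp (t + 1) ∧ (L ≤ t ∧ t < R ∨ L' ≤ t ∧ t < R')) ∨
          (x = sp (t - 1) ∧ (L ≤ t - 1 ∧ t - 1 < R ∨ L' ≤ t - 1 ∧ t - 1 < R')) ∨
          (x = pd t ∧ (t ∈ D ∨ t ∈ D')))) ∨ ∃ t, A ≤ t ∧ t ≤ B ∧ w = pd t ∧ x = sp t := by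
      rintro x (hx | hx)
      · rcases combSub_neighbor hA hB hx with ⟨t, h1, h2, h3, h4⟩ | h4
        · refine Or.inl ⟨t, h1, h2, h3, ?_⟩
          rcases h4 with ⟨e, h4⟩ | ⟨e, h4⟩ | ⟨e, h4⟩
          · exact Or.inl ⟨e, Or.inl h4⟩
          · exact Or.inr (Or.inl ⟨e, Or.inl h4⟩)
          · exact Or.inr (Or.inr ⟨e, Or.inl h4.2.2⟩)
        · exact Or.inr h4
      · rcases combSub_neighbor hA' hB' hx with ⟨t, h1, h2, h3, h4⟩ | h4
        · refine Or.inl ⟨t, h1, h2, h3, ?_⟩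
          rcases h4 with ⟨e, h4⟩ | ⟨e, h4⟩ | ⟨e, h4⟩
          · exact Or.inl ⟨e, Or.inr h4⟩
          · exact Or.inr (Or.inl ⟨e, Or.inr h4⟩)
          · exact Or.inr (Or.inr ⟨e, Or.inr h4.2.2⟩)
        · exact Or.inr h4
    obtain ⟨x₀, hx₀⟩ : ((combSub H sp pd L R D ⊔
        combSub H sp pd L' R' D').neighborSet w).Nonempty := by
      obtain ⟨x₀, hx₀, -⟩ := three_le_encard_iff.1 hw
      exact ⟨x₀, hx₀⟩
    rcases hnb x₀ hx₀ with ⟨t, h1, h2, rfl, -⟩ | ⟨t, h1, h2, rfl, -⟩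
    · have hnb' : ∀ x ∈ (combSub H sp pd L R D ⊔ combSub H sp pd L' R' D').neighborSet (sp t),
          (x = sp (t + 1) ∧ (L ≤ t ∧ t < R ∨ L' ≤ t ∧ t < R')) ∨
          (x = sp (t - 1) ∧ (L ≤ t - 1 ∧ t - 1 < R ∨ L' ≤ t - 1 ∧ t - 1 < R')) ∨
          (x = pd t ∧ (t ∈ D ∨ t ∈ D')) := by
        intro x hx
        rcases hnb x hx with ⟨t', h1', h2', h3', h4'⟩ | ⟨t', h1', h2', h3', -⟩
        · obtain rfl := hC.sp_inj _ _ h1 h2 h1' h2' h3'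
          exact h4'
        · exact absurd h3' (hC.sp_ne_pd _ _ h1 h2 h1' h2')
      have ht := h t
      rw [not_and_or, not_and_or] at ht
      rcases ht with ht | ht | ht
      · refine encard_pair_lt_three (a := sp (t + 1)) (b := pd t) (fun x hx => ?_) hw
        rcases hnb' x hx with ⟨e, -⟩ | ⟨-, e⟩ | ⟨e, -⟩
        · exact Or.inl e
        · exact absurd e ht
        · exact Or.inr e
      · refine encard_pair_lt_three (a := sp (t - 1)) (b := pd t) (fun x hx => ?_) hw
        rcases hnb' x hx with ⟨-, e⟩ | ⟨e, -⟩ | ⟨e, -⟩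
        · exact absurd e ht
        · exact Or.inl e
        · exact Or.inr e
      · refine encard_pair_lt_three (a := sp (t - 1)) (b := sp (t + 1)) (fun x hx => ?_) hw
        rcases hnb' x hx with ⟨e, -⟩ | ⟨e, -⟩ | ⟨-, e⟩
        · exact Or.inr e
        · exact Or.inl e
        · exact absurd e ht
    · refine encard_pair_lt_three (a := sp t) (b := sp t) (fun x hx => ?_) hw
      rcases hnb x hx with ⟨t', h1', h2', h3', -⟩ | ⟨t', h1', h2', h3', h4'⟩
      · exact absurd h3'.symm (hC.sp_ne_pd _ _ h1' h2' h1 h2)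
      · obtain rfl := hC.pd_inj _ _ h1 h2 h1' h2' h3'
        exact Or.inl h4'

theorem Comb.encard_neighborSet_le (hC : Comb H sp pd A B) (hA : A ≤ L) (hB : R ≤ B) (w : W) :
    ((combSub H sp pd L R D).neighborSet w).encard ≤ 3 := by
  have hle : ∀ a b c : W, ((combSub H sp pd L R D).neighborSet w) ⊆ {a, b, c} →
      ((combSub H sp pd L R D).neighborSet w).encard ≤ 3 := by
    intro a b c h
    refine (Set.encard_le_encard h).trans ?_
    refine (Set.encard_insert_le _ _).trans ?_
    refine (add_le_add_left (Set.encard_insert_le _ _) 1).trans ?_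
    rw [Set.encard_singleton]
    norm_num
  by_cases hw : ∃ t, A ≤ t ∧ t ≤ B ∧ w = sp t
  · obtain ⟨t, h1, h2, rfl⟩ := hw
    refine hle (sp (t + 1)) (sp (t - 1)) (pd t) fun x hx => ?_
    rcases combSub_neighbor hA hB hx with ⟨t', h1', h2', h3', h4'⟩ | ⟨t', h1', h2', h3', -⟩
    · obtain rfl := hC.sp_inj _ _ h1 h2 h1' h2' h3'
      exact h4'.imp And.left (Or.imp And.left And.left)
    · exact absurd h3' (hC.sp_ne_pd _ _ h1 h2 h1' h2')
  · by_cases hw' : ∃ t, A ≤ t ∧ t ≤ B ∧ w = pd t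
    · obtain ⟨t, h1, h2, rfl⟩ := hw'
      refine hle (sp t) (sp t) (sp t) fun x hx => ?_
      rcases combSub_neighbor hA hB hx with ⟨t', h1', h2', h3', -⟩ | ⟨t', h1', h2', h3', h4'⟩
      · exact absurd ⟨t', h1', h2', h3'⟩ hw
      · obtain rfl := hC.pd_inj _ _ h1 h2 h1' h2' h3'
        exact Or.inl h4'
    · refine hle w w w fun x hx => ?_
      rcases combSub_neighbor hA hB hx with ⟨t', h1', h2', h3', -⟩ | ⟨t', h1', h2', h3', h4'⟩
      · exact absurd ⟨t', h1', h2', h3'⟩ hw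
      · exact absurd ⟨t', h1', h2', h3'⟩ hw'

/-- The vertex sequence is the spine interval, extended by `pd L` at position `L - 1` and by `pd R`
at position `R + 1` as the flags require. `hlt` keeps these two pendants distinct when both occur.
-/
theorem Comb.isPathSubgraph_combSub (hC : Comb H sp pd A B) (hA : A ≤ L) (hB : R ≤ B)
    (hLR : L ≤ R) {fl fr : Prop} (hlt : fl ∨ fr → L < R) :
    IsPathSubgraph (combSub H sp pd L R (pendants L R fl fr)) := by
  classical
  obtain ⟨a, ha⟩ : ∃ a, a = if fl then L - 1 else L := ⟨_, rfl⟩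
  obtain ⟨b, hb⟩ : ∃ b, b = if fr then R + 1 else R := ⟨_, rfl⟩
  have ha' : (a = L - 1 ∧ fl) ∨ (a = L ∧ ¬ fl) := by
    rw [ha]; by_cases h : fl <;> simp [h]
  have hb' : (b = R + 1 ∧ fr) ∨ (b = R ∧ ¬ fr) := by
    rw [hb]; by_cases h : fr <;> simp [h]
  clear ha hb
  obtain ⟨g, hg1, hg2, hg3⟩ : ∃ g : ℤ → W, (∀ t, t < L → g t = pd L) ∧
      (∀ t, L ≤ t → t ≤ R → g t = sp t) ∧ ∀ t, R < t → g t = pd R := by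
    refine ⟨fun t => if t < L then pd L else if t ≤ R then sp t else pd R, fun t h => ?_,
      fun t h h' => ?_, fun t h => ?_⟩
    · exact if_pos h
    · exact (if_neg (by omega)).trans (if_pos h')
    · exact (if_neg (by omega)).trans (if_neg (by omega))
  refine isPathSubgraph_of_seq g (a := a) (b := b) (by omega) ?_ ?_ ?_
  · intro s t h1 h2 h3 h4 h
    have hcase : ∀ u, u < L ∨ (L ≤ u ∧ u ≤ R) ∨ R < u := fun u => by omega
    rcases hcase s with hs | hs | hs <;> rcases hcase t with ht | ht | ht
    · omega
    · rw [hg1 s hs, hg2 t ht.1 ht.2] at h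
      exact absurd h.symm (hC.sp_ne_pd _ _ (by omega) (by omega) (by omega) (by omega))
    · rw [hg1 s hs, hg3 t ht] at h
      have := hC.pd_inj _ _ (by omega) (by omega) (by omega) (by omega) h
      rcases ha' with ⟨-, hf⟩ | ⟨ha', -⟩
      · have := hlt (Or.inl hf)
        omega
      · omega
    · rw [hg2 s hs.1 hs.2, hg1 t ht] at h
      exact absurd h (hC.sp_ne_pd _ _ (by omega) (by omega) (by omega) (by omega))
    · rw [hg2 s hs.1 hs.2, hg2 t ht.1 ht.2] at h
      exact hC.sp_inj _ _ (by omega) (by omega) (by omega) (by omega) h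
    · rw [hg2 s hs.1 hs.2, hg3 t ht] at h
      exact absurd h (hC.sp_ne_pd _ _ (by omega) (by omega) (by omega) (by omega))
    · rw [hg3 s hs, hg1 t ht] at h
      have := hC.pd_inj _ _ (by omega) (by omega) (by omega) (by omega) h
      rcases ha' with ⟨-, hf⟩ | ⟨ha', -⟩
      · have := hlt (Or.inl hf)
        omega
      · omega
    · rw [hg3 s hs, hg2 t ht.1 ht.2] at h
      exact absurd h.symm (hC.sp_ne_pd _ _ (by omega) (by omega) (by omega) (by omega))
    · omega
  · intro x
    constructor
    · rintro (⟨t, h1, h2, rfl⟩ | ⟨t, h1, h2, ⟨hf, rfl⟩ | ⟨hf, rfl⟩, rfl⟩)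
      · exact ⟨t, by omega, by omega, (hg2 t h1 h2).symm⟩
      · have : a = t - 1 := by
          rcases ha' with h | h
          · exact h.1
          · exact absurd hf h.2
        exact ⟨t - 1, by omega, by omega, (hg1 _ (by omega)).symm⟩
      · have : b = t + 1 := by
          rcases hb' with h | h
          · exact h.1
          · exact absurd hf h.2
        exact ⟨t + 1, by omega, by omega, (hg3 _ (by omega)).symm⟩
    · rintro ⟨t, h1, h2, rfl⟩
      by_cases hl : t < L
      · rw [hg1 t hl]
        have hf : fl := by
          rcases ha' with h | h
          · exact h.2
          · omega
        exact Or.inr ⟨L, le_rfl, hLR, Or.inl ⟨hf, rfl⟩, rfl⟩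
      · by_cases hr : t ≤ R
        · rw [hg2 t (by omega) hr]
          exact Or.inl ⟨t, by omega, by omega, rfl⟩
        · rw [hg3 t (by omega)]
          have hf : fr := by
            rcases hb' with h | h
            · exact h.2
            · omega
          exact Or.inr ⟨R, hLR, le_rfl, Or.inr ⟨hf, rfl⟩, rfl⟩
  · intro x y
    rw [hC.combSub_adj hA hB]
    constructor
    · rintro (⟨t, h1, h2, h⟩ | ⟨t, h1, h2, ⟨hf, rfl⟩ | ⟨hf, rfl⟩, h⟩)
      · exact ⟨t, by omega, by omega, by rw [h, hg2 t h1 h2.le, hg2 (t + 1) (by omega) (by omega)]⟩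
      · have : a = t - 1 := by
          rcases ha' with h | h
          · exact h.1
          · exact absurd hf h.2
        refine ⟨t - 1, by omega, by omega, ?_⟩
        rw [h, sub_add_cancel, hg1 (t - 1) (by omega), hg2 t h1 h2, Sym2.eq_swap]
      · have : b = t + 1 := by
          rcases hb' with h | h
          · exact h.1
          · exact absurd hf h.2
        refine ⟨t, by omega, by omega, ?_⟩
        rw [h, hg3 (t + 1) (by omega), hg2 t h1 h2]
    · rintro ⟨t, h1, h2, h⟩
      by_cases hl : t < L
      · obtain ⟨hat, hf⟩ : a = L - 1 ∧ fl := by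
          rcases ha' with h | h
          · exact h
          · omega
        obtain rfl : t = L - 1 := by omega
        rw [sub_add_cancel, hg1 _ hl, hg2 L le_rfl hLR, Sym2.eq_swap] at h
        exact Or.inr ⟨L, le_rfl, hLR, Or.inl ⟨hf, rfl⟩, by rw [Sym2.eq_swap, h, Sym2.eq_swap]⟩
      · by_cases hr : t < R
        · rw [hg2 t (by omega) (by omega), hg2 (t + 1) (by omega) (by omega)] at h
          exact Or.inl ⟨t, by omega, hr, h⟩
        · obtain ⟨hbt, hf⟩ : b = R + 1 ∧ fr := by
            rcases hb' with h | h
            · exact h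
            · omega
          obtain rfl : t = R := by omega
          rw [hg2 t (by omega) le_rfl, hg3 (t + 1) (by omega)] at h
          exact Or.inr ⟨t, hLR, le_rfl, Or.inr ⟨hf, rfl⟩, h⟩

theorem Comb.isTree_combSub (hC : Comb H sp pd A B) (hA : A ≤ L) (hB : R ≤ B) (hLR : L ≤ R) :
    (combSub H sp pd L R D).coe.IsTree := by
  classical
  have hmem : ∀ t, L ≤ t → t ≤ R → sp t ∈ (combSub H sp pd L R D).verts :=
    fun t h1 h2 => Or.inl ⟨t, h1, h2, rfl⟩
  refine ⟨?_, ?_⟩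
  · have hne : Nonempty (combSub H sp pd L R D).verts := ⟨⟨sp L, hmem L le_rfl hLR⟩⟩
    have hspine : ∀ n : ℕ, ∀ h : L + n ≤ R, (combSub H sp pd L R D).coe.Reachable
        ⟨sp L, hmem L le_rfl hLR⟩ ⟨sp (L + n), hmem (L + n) (by omega) h⟩ := by
      intro n
      induction n with
      | zero =>
        intro h
        simp
      | succ n ih =>
        intro h
        refine (ih (by omega)).trans (Adj.reachable ?_)
        rw [Subgraph.coe_adj]
        have := (hC.combSub_adj_spine (D := D) hA hB (t := L + n) (by omega) (by omega)).2
          ⟨by omega, by omega⟩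
        push_cast
        rwa [← add_assoc]
    have hspine' : ∀ t, ∀ h1 : L ≤ t, ∀ h2 : t ≤ R, (combSub H sp pd L R D).coe.Reachable
        ⟨sp L, hmem L le_rfl hLR⟩ ⟨sp t, hmem t h1 h2⟩ := by
      intro t h1 h2
      obtain ⟨n, hn⟩ := Int.eq_ofNat_of_zero_le (a := t - L) (by omega)
      obtain rfl : t = L + n := by omega
      exact hspine n h2
    have hall : ∀ x, (combSub H sp pd L R D).coe.Reachable ⟨sp L, hmem L le_rfl hLR⟩ x := by
      rintro ⟨x, hx⟩
      rcases id hx with ⟨t, h1, h2, rfl⟩ | ⟨t, h1, h2, h3, rfl⟩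
      · exact hspine' t h1 h2
      · refine (hspine' t h1 h2).trans (Adj.reachable ?_)
        rw [Subgraph.coe_adj]
        exact (hC.combSub_adj_pendant hA hB (by omega) (by omega)).2 ⟨h1, h2, h3⟩
    exact ⟨fun x y => (hall x).symm.trans (hall y)⟩
  -- Rank spine vertices by position and all pendants above them. The only neighbour of no greater
  -- rank is the preceding spine vertex, or the foot of a pendant.
  · obtain ⟨f, hf1, hf2⟩ : ∃ f : W → ℤ, (∀ t, A ≤ t → t ≤ B → f (sp t) = t) ∧
        ∀ t, A ≤ t → t ≤ B → f (pd t) = B + 1 := by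
      refine ⟨fun w => if h : ∃ t, A ≤ t ∧ t ≤ B ∧ w = sp t then h.choose else B + 1,
        fun t h1 h2 => ?_, fun t h1 h2 => ?_⟩
      · have h : ∃ t', A ≤ t' ∧ t' ≤ B ∧ sp t = sp t' := ⟨t, h1, h2, rfl⟩
        have hs := h.choose_spec
        refine (dif_pos h).trans ?_
        exact (hC.sp_inj _ _ h1 h2 hs.1 hs.2.1 hs.2.2).symm
      · refine dif_neg ?_
        rintro ⟨t', h1', h2', h⟩
        exact hC.sp_ne_pd _ _ h1' h2' h1 h2 h.symm
    refine isAcyclic_of_rank (fun x => f x.1) ?_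
    rintro ⟨v, hv⟩ ⟨x, hx⟩ ⟨y, hy⟩ hvx hvy hfx hfy
    rw [Subgraph.coe_adj] at hvx hvy
    dsimp only at hvx hvy hfx hfy
    refine Subtype.ext ?_
    dsimp only
    rcases combSub_neighbor hA hB hvx with ⟨t, h1, h2, rfl, h4⟩ | ⟨t, h1, h2, rfl, rfl⟩
    · rw [hf1 t h1 h2] at hfx hfy
      have key : ∀ z, f z ≤ t → (combSub H sp pd L R D).Adj (sp t) z → z = sp (t - 1) := by
        intro z hfz hz
        rcases combSub_neighbor hA hB hz with ⟨t', h1', h2', h3', h4'⟩ | ⟨t', h1', h2', h3', -⟩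
        · obtain rfl := hC.sp_inj _ _ h1 h2 h1' h2' h3'
          rcases h4' with ⟨rfl, h5⟩ | ⟨h5, -⟩ | ⟨rfl, h5⟩
          · rw [hf1 (t + 1) (by omega) (by omega)] at hfz
            omega
          · exact h5
          · rw [hf2 t h1 h2] at hfz
            omega
        · exact absurd h3' (hC.sp_ne_pd _ _ h1 h2 h1' h2')
      rw [key x hfx hvx, key y hfy hvy]
    · rcases combSub_neighbor hA hB hvy with ⟨t', h1', h2', h3', -⟩ | ⟨t', h1', h2', h3', rfl⟩
      · exact absurd h3'.symm (hC.sp_ne_pd _ _ h1' h2' h1 h2)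
      · rw [hC.pd_inj _ _ h1 h2 h1' h2' h3']

/-- Every interval meets one that contains `c`, so there are no gaps: an outermost interval and the
one joining it to `c` cover everything between. -/
theorem exists_pathUnion_combSub {V : Type*} [Finite V] (sp pd : ℤ → W) {U : Set V}
    (hU : U.Nonempty) {L R : V → ℤ} {D : V → Set ℤ} {c : ℤ}
    (hD : ∀ v ∈ U, ∀ t ∈ D v, L v ≤ t ∧ t ≤ R v)
    (hmeet : ∀ v ∈ U, ∃ k ∈ U, L k ≤ c ∧ c ≤ R k ∧ L v ≤ R k ∧ L k ≤ R v) :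
    ∃ L₀ R₀, (∃ v ∈ U, L₀ = L v) ∧ (∃ v ∈ U, R₀ = R v) ∧ L₀ ≤ c ∧ c ≤ R₀ ∧
      (∀ v ∈ U, L₀ ≤ L v ∧ R v ≤ R₀) ∧
      pathUnion (fun v => combSub H sp pd (L v) (R v) (D v)) U =
        combSub H sp pd L₀ R₀ {t | ∃ v ∈ U, t ∈ D v} := by
  obtain ⟨a, ha, hamin⟩ := Set.exists_min_image U L U.toFinite hU
  obtain ⟨b, hb, hbmax⟩ := Set.exists_max_image U R U.toFinite hU
  obtain ⟨k, hk, k1, k2, k3, k4⟩ := hmeet a ha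
  obtain ⟨k', hk', k1', k2', k3', k4'⟩ := hmeet b hb
  have hL : L a ≤ c := (hamin k hk).trans k1
  have hR : c ≤ R b := k2.trans (hbmax k hk)
  have hedge : ∀ t, L a ≤ t → t < R b → ∃ v ∈ U, L v ≤ t ∧ t < R v := by
    intro t h1 h2
    by_cases htc : t < c
    · by_cases hta : t < R a
      · exact ⟨a, ha, h1, hta⟩
      · exact ⟨k, hk, by omega, by omega⟩
    · by_cases htb : L b ≤ t
      · exact ⟨b, hb, htb, h2⟩
      · exact ⟨k', hk', by omega, by omega⟩
  have hvert : ∀ t, L a ≤ t → t ≤ R b → ∃ v ∈ U, L v ≤ t ∧ t ≤ R v := by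
    intro t h1 h2
    by_cases htc : t < c
    · obtain ⟨v, hv, h3, h4⟩ := hedge t h1 (by omega)
      exact ⟨v, hv, h3, h4.le⟩
    · by_cases htb : L b ≤ t
      · exact ⟨b, hb, htb, h2⟩
      · exact ⟨k', hk', by omega, by omega⟩
  refine ⟨L a, R b, ⟨a, ha, rfl⟩, ⟨b, hb, rfl⟩, hL, hR, fun v hv => ⟨hamin v hv, hbmax v hv⟩, ?_⟩
  refine le_antisymm ?_ (show _ ∧ _ from ⟨?_, ?_⟩)
  · refine iSup₂_le fun v hv => combSub_mono (hamin v hv) (hbmax v hv) fun t ht => ⟨v, hv, ht⟩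
  · intro x hx
    simp only [pathUnion, Subgraph.verts_iSup, Set.mem_iUnion]
    rcases hx with ⟨t, h1, h2, rfl⟩ | ⟨t, h1, h2, ⟨v, hv, h3⟩, rfl⟩
    · obtain ⟨v, hv, h3, h4⟩ := hvert t h1 h2
      exact ⟨v, hv, Or.inl ⟨t, h3, h4, rfl⟩⟩
    · exact ⟨v, hv, Or.inr ⟨t, (hD v hv t h3).1, (hD v hv t h3).2, h3, rfl⟩⟩
  · rintro x y ⟨h0, ⟨t, h1, h2, h⟩ | ⟨t, h1, h2, ⟨v, hv, h3⟩, h⟩⟩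
    · simp only [pathUnion, Subgraph.iSup_adj]
      obtain ⟨v, hv, h3, h4⟩ := hedge t h1 h2
      exact ⟨v, hv, h0, Or.inl ⟨t, h3, h4, h⟩⟩
    · simp only [pathUnion, Subgraph.iSup_adj]
      exact ⟨v, hv, h0, Or.inr ⟨t, (hD v hv t h3).1, (hD v hv t h3).2, h3, h⟩⟩

end


/-! ### Representations by paths of a comb in a host graph -/

theorem mem_pendants_bounds {L R t : ℤ} {fl fr : Prop} (hLR : L ≤ R)
    (ht : t ∈ pendants L R fl fr) : L ≤ t ∧ t ≤ R := by
  rcases ht with ⟨-, rfl⟩ | ⟨-, rfl⟩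
  · exact ⟨le_rfl, hLR⟩
  · exact ⟨hLR, le_rfl⟩

namespace CombModel

variable {V W : Type*} {G : SimpleGraph V} {K : Set V} {H : SimpleGraph W} {sp pd : ℤ → W}
  {A B : ℤ}

/-- The path of a comb in `H` that a model assigns to the vertex `v`. -/
def path (M : CombModel G K) (H : SimpleGraph W) (sp pd : ℤ → W) (v : V) : H.Subgraph :=
  combSub H sp pd (M.L v) (M.R v) (pendants (M.L v) (M.R v) (M.fl v) (M.fr v))

theorem isENPRepresentation (M : CombModel G K) (hC : Comb H sp pd A B)
    (hAB : ∀ v, A ≤ M.L v ∧ M.R v ≤ B) : IsENPRepresentation G (M.path H sp pd) := by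
  refine ⟨fun v => hC.isPathSubgraph_combSub (hAB v).1 (hAB v).2 (M.le v) (M.lt v), ?_⟩
  ext u v
  rw [M.adj_iff, ← hC.nonSplitting_iff (hAB u).1 (hAB u).2 (hAB v).1 (hAB v).2
    (fun t => mem_pendants_bounds (M.le u)) (fun t => mem_pendants_bounds (M.le v))]
  exact Iff.rfl

theorem pendants_core (M : CombModel G K) {k : V} (hk : k ∈ K) :
    pendants (M.L k) (M.R k) (M.fl k) (M.fr k) = ∅ := by
  obtain ⟨-, -, h1, h2⟩ := M.core k hk
  simp [pendants, h1, h2]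

theorem isPathSubgraph_core [Finite V] (M : CombModel G K) (hK : K.Nonempty)
    (hC : Comb H sp pd A B) (hAB : ∀ v, A ≤ M.L v ∧ M.R v ≤ B) :
    IsPathSubgraph (pathUnion (M.path H sp pd) K) := by
  obtain ⟨L₀, R₀, ⟨a, -, rfl⟩, ⟨b, -, rfl⟩, h1, h2, -, h⟩ :=
    exists_pathUnion_combSub (H := H) (L := M.L) (R := M.R)
      (D := fun v => pendants (M.L v) (M.R v) (M.fl v) (M.fr v)) (c := M.c) sp pd hK
      (fun v _ t => mem_pendants_bounds (M.le v))
      fun v hv => ⟨v, hv, (M.core v hv).1, (M.core v hv).2.1, M.le v, M.le v⟩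
  change IsPathSubgraph (pathUnion (fun v => combSub H sp pd _ _ _) K)
  rw [h, show {t | ∃ v ∈ K, t ∈ pendants (M.L v) (M.R v) (M.fl v) (M.fr v)} =
    pendants (M.L a) (M.R b) False False from ?_]
  · exact hC.isPathSubgraph_combSub (hAB a).1 (hAB b).2 (by omega) (by simp)
  · rw [show pendants (M.L a) (M.R b) False False = ∅ by simp [pendants],
      Set.eq_empty_iff_forall_notMem]
    rintro t ⟨k, hk, ht⟩
    rw [M.pendants_core hk] at ht
    exact ht

theorem caterpillar [Finite V] (M : CombModel G K) (hK : K.Nonempty) (hC : Comb H sp pd A B)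
    (hAB : ∀ v, A ≤ M.L v ∧ M.R v ≤ B) :
    (∃ C : H.Subgraph,
      IsCaterpillarWithCentralPath (pathUnion (M.path H sp pd) Set.univ) C ∧
        pathUnion (M.path H sp pd) K ≤ C) ∧
      ∀ w, ((pathUnion (M.path H sp pd) Set.univ).neighborSet w).encard ≤ 3 := by
  obtain ⟨k₀, hk₀⟩ := hK
  obtain ⟨L₀, R₀, ⟨a, -, rfl⟩, ⟨b, -, rfl⟩, h1, h2, h3, h⟩ :=
    exists_pathUnion_combSub (H := H) (L := M.L) (R := M.R) (U := Set.univ)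
      (D := fun v => pendants (M.L v) (M.R v) (M.fl v) (M.fr v)) (c := M.c) sp pd ⟨k₀, trivial⟩
      (fun v _ t => mem_pendants_bounds (M.le v)) fun v _ => by
        obtain ⟨k, hk, h1, h2⟩ := M.meets v
        exact ⟨k, trivial, (M.core k hk).1, (M.core k hk).2.1, h1, h2⟩
  change pathUnion (M.path H sp pd) Set.univ = _ at h
  rw [h]
  -- The central path is the whole spine of the union, without pendants.
  refine ⟨⟨combSub H sp pd (M.L a) (M.R b) (pendants (M.L a) (M.R b) False False), ⟨?_, ?_, ?_, ?_⟩,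
    ?_⟩, fun w => hC.encard_neighborSet_le (hAB a).1 (hAB b).2 w⟩
  · exact hC.isTree_combSub (hAB a).1 (hAB b).2 (by omega)
  · exact hC.isPathSubgraph_combSub (hAB a).1 (hAB b).2 (by omega) (by simp)
  · exact combSub_mono le_rfl le_rfl (by simp [pendants])
  · rintro w (⟨t, e1, e2, rfl⟩ | ⟨t, e1, e2, e3, rfl⟩)
    · exact Or.inl (Or.inl ⟨t, e1, e2, rfl⟩)
    · refine Or.inr ⟨sp t, Or.inl ⟨t, e1, e2, rfl⟩, ?_⟩
      exact (hC.combSub_adj_pendant (hAB a).1 (hAB b).2 (e1.trans' (hAB a).1)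
        (e2.trans (hAB b).2)).2 ⟨e1, e2, e3⟩
  · refine iSup₂_le fun k hk => combSub_mono (h3 k trivial).1 (h3 k trivial).2 ?_
    rw [M.pendants_core hk]
    exact Set.empty_subset _

theorem exists_bounds [Finite V] (M : CombModel G K) :
    ∃ A B, A ≤ M.X ∧ M.Y ≤ B ∧ ∀ v, A ≤ M.L v ∧ M.R v ≤ B := by
  obtain ⟨a, ha⟩ := (Set.finite_range M.L).bddBelow
  obtain ⟨b, hb⟩ := (Set.finite_range M.R).bddAbove
  refine ⟨min a M.X, max b M.Y, by omega, by omega, fun v => ?_⟩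
  have := ha ⟨v, rfl⟩
  have := hb ⟨v, rfl⟩
  omega

end CombModel

/-! ### A comb in a grid -/

/-- The point of a grid with the given coordinates, if they are in range. -/
def gridPoint (m n : ℕ) (x y : ℤ) : Fin (m + 1) × Fin (n + 1) :=
  (⟨min x.toNat m, by omega⟩, ⟨min y.toNat n, by omega⟩)

theorem cx_gridPoint {m n : ℕ} {x y : ℤ} (h : 0 ≤ x) (h' : x ≤ m) :
    cx (gridPoint m n x y) = x := by
  simp only [cx, gridPoint]
  omega

theorem cy_gridPoint {m n : ℕ} {x y : ℤ} (h : 0 ≤ y) (h' : y ≤ n) :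
    cy (gridPoint m n x y) = y := by
  simp only [cy, gridPoint]
  omega

/-- A drawing of a comb in a grid whose spine is horizontal between `X` and `Y` and vertical
elsewhere. -/
structure GridComb {m n : ℕ} (sp pd : ℤ → Fin m × Fin n) (A X Y B : ℤ) : Prop where
  cx_sp : ∀ t, A ≤ t → t ≤ B → cx (sp t) = max X (min t Y) - X + 1
  cy_sp : ∀ t, A ≤ t → t ≤ B → cy (sp t) = min (t - X) 0 + max (t - Y) 0 + (X - A) + 1
  pd_mid : ∀ t, A ≤ t → t ≤ B → X < t → t < Y → cx (pd t) = t - X + 1 ∧ cy (pd t) = X - A + 2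
  pd_left : ∀ t, A ≤ t → t ≤ B → t ≤ X → cx (pd t) = 0 ∧ cy (pd t) = t - A + 1
  pd_right : ∀ t, A ≤ t → t ≤ B → Y ≤ t →
    cx (pd t) = Y - X + 2 ∧ cy (pd t) = t - Y + (X - A) + 1

/-- The left arm goes down in column `1`, the right arm goes up in column `Y - X + 1`. Pendants
point up from the open middle, left from the left arm and its turn, and right from the right arm and
its turn, hence the spare column on each side. At a turn the pendant continues the middle row. -/
theorem exists_gridComb {A X Y B : ℤ} (hA : A ≤ X) (hXY : X < Y) (hB : Y ≤ B) :
    ∃ (m n : ℕ) (sp pd : ℤ → Fin m × Fin n), GridComb sp pd A X Y B := by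
  obtain ⟨m, hm⟩ := Int.eq_ofNat_of_zero_le (a := Y - X + 2) (by omega)
  obtain ⟨n, hn⟩ := Int.eq_ofNat_of_zero_le (a := B - Y + (X - A) + 2) (by omega)
  refine ⟨m + 1, n + 1,
    fun t => gridPoint m n (max X (min t Y) - X + 1) (min (t - X) 0 + max (t - Y) 0 + (X - A) + 1),
    fun t => gridPoint m n (if t ≤ X then 0 else if t < Y then t - X + 1 else Y - X + 2)
      (if t ≤ X then t - A + 1 else if t < Y then X - A + 2 else t - Y + (X - A) + 1),
    ⟨fun t h1 h2 => ?_, fun t h1 h2 => ?_, fun t h1 h2 h3 h4 => ?_, fun t h1 h2 h3 => ?_,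
      fun t h1 h2 h3 => ?_⟩⟩
  · exact cx_gridPoint (by omega) (by omega)
  · exact cy_gridPoint (by omega) (by omega)
  · rw [if_neg (by omega), if_pos h4, if_neg (by omega), if_pos h4]
    exact ⟨cx_gridPoint (by omega) (by omega), cy_gridPoint (by omega) (by omega)⟩
  · rw [if_pos h3, if_pos h3]
    exact ⟨cx_gridPoint (by omega) (by omega), cy_gridPoint (by omega) (by omega)⟩
  · rw [if_neg (by omega), if_neg (by omega), if_neg (by omega), if_neg (by omega)]
    exact ⟨cx_gridPoint (by omega) (by omega), cy_gridPoint (by omega) (by omega)⟩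

section

variable {m n : ℕ} {sp pd : ℤ → Fin m × Fin n} {A X Y B : ℤ}

theorem GridComb.pd_cases (h : GridComb sp pd A X Y B) {t : ℤ} (h1 : A ≤ t) (h2 : t ≤ B) :
    (X < t ∧ t < Y ∧ cx (pd t) = t - X + 1 ∧ cy (pd t) = X - A + 2) ∨
    (t ≤ X ∧ cx (pd t) = 0 ∧ cy (pd t) = t - A + 1) ∨
    (Y ≤ t ∧ cx (pd t) = Y - X + 2 ∧ cy (pd t) = t - Y + (X - A) + 1) := by
  by_cases hX : t ≤ X
  · exact Or.inr (Or.inl ⟨hX, h.pd_left t h1 h2 hX⟩)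
  by_cases hY : t < Y
  · exact Or.inl ⟨by omega, hY, h.pd_mid t h1 h2 (by omega) hY⟩
  · exact Or.inr (Or.inr ⟨by omega, h.pd_right t h1 h2 (by omega)⟩)

theorem GridComb.comb (h : GridComb sp pd A X Y B) (hXY : X < Y) :
    Comb (gridGraph m n) sp pd A B where
  sp_adj t h1 h2 := by
    rw [grid_adj_iff, h.cx_sp t h1 h2.le, h.cy_sp t h1 h2.le,
      h.cx_sp (t + 1) (by omega) (by omega), h.cy_sp (t + 1) (by omega) (by omega)]
    omega
  pd_adj t h1 h2 := by
    have h3 := h.cx_sp t h1 h2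
    have h4 := h.cy_sp t h1 h2
    have h5 := h.pd_cases h1 h2
    rw [grid_adj_iff]
    omega
  sp_inj s t h1 h2 h3 h4 he := by
    have e1 := h.cx_sp s h1 h2
    have e2 := h.cy_sp s h1 h2
    rw [he, h.cx_sp t h3 h4] at e1
    rw [he, h.cy_sp t h3 h4] at e2
    omega
  pd_inj s t h1 h2 h3 h4 he := by
    have e1 := h.pd_cases h1 h2
    have e2 := h.pd_cases h3 h4
    rw [he] at e1
    omega
  sp_ne_pd s t h1 h2 h3 h4 he := by
    have e1 := h.cx_sp s h1 h2
    have e2 := h.cy_sp s h1 h2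
    have e3 := h.pd_cases h3 h4
    rw [he] at e1 e2
    omega

theorem GridComb.row_eq (h : GridComb sp pd A X Y B) {L R t : ℤ} {D : Set ℤ} (hA : A ≤ L)
    (hB : R ≤ B) (h1 : A ≤ t) (h2 : t ≤ B) {a : Fin m × Fin n} (ha : cy a = cy (sp t))
    (hn : (a = sp (t + 1) ∧ L ≤ t ∧ t < R) ∨ (a = sp (t - 1) ∧ L ≤ t - 1 ∧ t - 1 < R) ∨
      (a = pd t ∧ L ≤ t ∧ t ≤ R ∧ t ∈ D)) :
    (L ≤ t ∧ t < R ∧ X ≤ t ∧ t < Y) ∨ (L < t ∧ t ≤ R ∧ X < t ∧ t ≤ Y) ∨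
      (t ∈ D ∧ (t ≤ X ∨ Y ≤ t)) := by
  rw [h.cy_sp t h1 h2] at ha
  rcases hn with ⟨rfl, h3, h4⟩ | ⟨rfl, h3, h4⟩ | ⟨rfl, -, -, h3⟩
  · rw [h.cy_sp (t + 1) (by omega) (by omega)] at ha
    omega
  · rw [h.cy_sp (t - 1) (by omega) (by omega)] at ha
    omega
  · have := h.pd_cases h1 h2
    exact Or.inr (Or.inr ⟨h3, by omega⟩)

theorem GridComb.column_eq (h : GridComb sp pd A X Y B) (hXY : X < Y) {L R t : ℤ} {D : Set ℤ}
    (hA : A ≤ L) (hB : R ≤ B) (h1 : A ≤ t) (h2 : t ≤ B) {a : Fin m × Fin n}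
    (ha : cx a = cx (sp t))
    (hn : (a = sp (t + 1) ∧ L ≤ t ∧ t < R) ∨ (a = sp (t - 1) ∧ L ≤ t - 1 ∧ t - 1 < R) ∨
      (a = pd t ∧ L ≤ t ∧ t ≤ R ∧ t ∈ D)) :
    (L ≤ t ∧ t < R ∧ (t < X ∨ Y ≤ t)) ∨ (L < t ∧ t ≤ R ∧ (t ≤ X ∨ Y < t)) ∨
      (t ∈ D ∧ X < t ∧ t < Y) := by
  rw [h.cx_sp t h1 h2] at ha
  rcases hn with ⟨rfl, h3, h4⟩ | ⟨rfl, h3, h4⟩ | ⟨rfl, -, -, h3⟩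
  · rw [h.cx_sp (t + 1) (by omega) (by omega)] at ha
    omega
  · rw [h.cx_sp (t - 1) (by omega) (by omega)] at ha
    omega
  · have := h.pd_cases h1 h2
    exact Or.inr (Or.inr ⟨h3, by omega, by omega⟩)

/-- A path bends where it follows a turn and where it takes a pendant, except for a left pendant at
`X` or a right pendant at `Y`, which is in line with the middle row. -/
theorem GridComb.bend_cases (h : GridComb sp pd A X Y B) (hXY : X < Y) {L R : ℤ} {fl fr : Prop}
    (hA : A ≤ L) (hB : R ≤ B) (hlt : fl ∨ fr → L < R) {w : Fin m × Fin n}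
    (hw : w ∈ bends (combSub (gridGraph m n) sp pd L R (pendants L R fl fr))) :
    ∃ t, w = sp t ∧ ((t = X ∧ L < X ∧ X < R) ∨ (t = Y ∧ L < Y ∧ Y < R) ∨
      (fl ∧ t = L ∧ t ≠ X) ∨ (fr ∧ t = R ∧ t ≠ Y)) := by
  have hC := h.comb hXY
  obtain ⟨⟨a, ha, ha'⟩, b, hb, hb'⟩ := hw
  rw [snd_eq_iff] at ha'
  rw [fst_eq_iff] at hb'
  rcases combSub_neighbor hA hB ha with ⟨t, h1, h2, rfl, h4⟩ | ⟨t, h1, h2, rfl, rfl⟩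
  · refine ⟨t, rfl, ?_⟩
    have hr := h.row_eq hA hB h1 h2 ha' h4
    have hc := h.column_eq hXY (D := pendants L R fl fr) hA hB h1 h2 hb' (by
      rcases combSub_neighbor hA hB hb with ⟨t', h1', h2', h3', h4'⟩ | ⟨t', h1', h2', h3', -⟩
      · obtain rfl := hC.sp_inj _ _ h1 h2 h1' h2' h3'
        exact h4'
      · exact absurd h3' (hC.sp_ne_pd _ _ h1 h2 h1' h2'))
    by_cases hl : fl ∧ t = L
    · have := hlt (Or.inl hl.1)
      by_cases hr' : fr ∧ t = R
      · omega
      have hX : t ≠ X := by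
        rintro rfl
        omega
      exact Or.inr (Or.inr (Or.inl ⟨hl.1, hl.2, hX⟩))
    · by_cases hr' : fr ∧ t = R
      · have := hlt (Or.inr hr'.1)
        have hY : t ≠ Y := by
          rintro rfl
          omega
        exact Or.inr (Or.inr (Or.inr ⟨hr'.1, hr'.2, hY⟩))
      · have hD : t ∉ pendants L R fl fr := fun ht => ht.elim hl hr'
        have hr'' := hr.imp id fun hr => hr.resolve_right fun h => hD h.1
        have hc'' := hc.imp id fun hc => hc.resolve_right fun h => hD h.1
        omega
  · rcases combSub_neighbor hA hB hb with ⟨t', h1', h2', h3', -⟩ | ⟨t', h1', h2', h3', rfl⟩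
    · exact absurd h3'.symm (hC.sp_ne_pd _ _ h1' h2' h1 h2)
    · obtain rfl := hC.pd_inj _ _ h1 h2 h1' h2' h3'
      exact absurd (coord_ext hb' ha') (hC.sp_ne_pd _ _ h1 h2 h1 h2)

theorem GridComb.encard_bends_le (h : GridComb sp pd A X Y B) (hXY : X < Y) {L R : ℤ}
    {fl fr : Prop} (hA : A ≤ L) (hB : R ≤ B) (hlt : fl ∨ fr → L < R)
    (hb : CombOneBend X Y L R fl fr) :
    (bends (combSub (gridGraph m n) sp pd L R (pendants L R fl fr))).encard ≤ 1 := by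
  rw [Set.encard_le_one_iff]
  intro w w' hw hw'
  obtain ⟨t, rfl, ht⟩ := h.bend_cases hXY hA hB hlt hw
  obtain ⟨t', rfl, ht'⟩ := h.bend_cases hXY hA hB hlt hw'
  congr 1
  obtain ⟨h1, h2, h3, h4⟩ := hb
  by_cases hl : fl <;> by_cases hr : fr <;>
  simp only [hl, hr, not_true, not_false_eq_true, true_implies, false_implies, true_and, false_and,
    false_or, or_false] at h1 h2 h3 h4 ht ht' <;>
  omega

end

/-! ### From a comb model to both claims -/

theorem CombModel.exists_gridRepresentation {V : Type*} [Finite V] {G : SimpleGraph V} {K : Set V}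
    (M : CombModel G K) (hK : K.Nonempty) :
    ∃ (m n : ℕ) (P : V → (gridGraph m n).Subgraph),
      IsBendENPGRepresentation 1 G P ∧ IsPathSubgraph (pathUnion P K) ∧
      (∃ C : (gridGraph m n).Subgraph,
        IsCaterpillarWithCentralPath (pathUnion P Set.univ) C ∧ pathUnion P K ≤ C) ∧
      ∀ w, ((pathUnion P Set.univ).neighborSet w).encard ≤ 3 := by
  obtain ⟨A, B, hA, hB, hAB⟩ := M.exists_bounds
  obtain ⟨m, n, sp, pd, h⟩ := exists_gridComb hA M.X_lt_Y hB
  have hC := h.comb M.X_lt_Y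
  exact ⟨m, n, M.path _ sp pd, ⟨M.isENPRepresentation hC hAB, fun v =>
    h.encard_bends_le M.X_lt_Y (hAB v).1 (hAB v).2 (M.lt v) (M.oneBend v)⟩,
    M.isPathSubgraph_core hK hC hAB, M.caterpillar hK hC hAB⟩

/-- The host tree is the full comb with every pendant, and the same intervals and flags represent
`G` in it. -/
theorem CombModel.mem_ENPT {V : Type*} [Finite V] {G : SimpleGraph V} {K : Set V}
    (M : CombModel G K) : G ∈ ENPT V := by
  obtain ⟨A, B, hA, hB, hAB⟩ := M.exists_bounds
  obtain ⟨m, n, sp, pd, h⟩ := exists_gridComb hA M.X_lt_Y hB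
  have hC := h.comb M.X_lt_Y
  have hAB' : A ≤ B := hA.trans (M.X_lt_Y.le.trans hB)
  let T : (gridGraph m n).Subgraph := combSub (gridGraph m n) sp pd A B Set.univ
  -- Clamping positions to `[A, B]` makes `sp` and `pd` total functions into the vertices of the
  -- tree.
  have hclamp : ∀ t, A ≤ max A (min t B) ∧ max A (min t B) ≤ B := fun t => by omega
  have hclamp' : ∀ t, A ≤ t → t ≤ B → max A (min t B) = t := fun t => by omega
  let sp' : ℤ → T.verts := fun t =>
    ⟨sp (max A (min t B)), Or.inl ⟨_, (hclamp t).1, (hclamp t).2, rfl⟩⟩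
  let pd' : ℤ → T.verts := fun t =>
    ⟨pd (max A (min t B)), Or.inr ⟨_, (hclamp t).1, (hclamp t).2, trivial, rfl⟩⟩
  have hsp : ∀ t, A ≤ t → t ≤ B → (sp' t : Fin m × Fin n) = sp t := fun t h1 h2 => by
    change sp _ = _
    rw [hclamp' t h1 h2]
  have hpd : ∀ t, A ≤ t → t ≤ B → (pd' t : Fin m × Fin n) = pd t := fun t h1 h2 => by
    change pd _ = _
    rw [hclamp' t h1 h2]
  have hC' : Comb T.coe sp' pd' A B := by
    refine ⟨fun t h1 h2 => ?_, fun t h1 h2 => ?_, fun s t h1 h2 h3 h4 he => ?_,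
      fun s t h1 h2 h3 h4 he => ?_, fun s t h1 h2 h3 h4 he => ?_⟩
    · rw [Subgraph.coe_adj, hsp t h1 h2.le, hsp (t + 1) (by omega) (by omega)]
      exact (hC.combSub_adj_spine le_rfl le_rfl h1 h2).2 ⟨h1, h2⟩
    · rw [Subgraph.coe_adj, hsp t h1 h2, hpd t h1 h2]
      exact (hC.combSub_adj_pendant le_rfl le_rfl h1 h2).2 ⟨h1, h2, trivial⟩
    · have he := congrArg Subtype.val he
      rw [hsp s h1 h2, hsp t h3 h4] at he
      exact hC.sp_inj _ _ h1 h2 h3 h4 he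
    · have he := congrArg Subtype.val he
      rw [hpd s h1 h2, hpd t h3 h4] at he
      exact hC.pd_inj _ _ h1 h2 h3 h4 he
    · have he := congrArg Subtype.val he
      rw [hsp s h1 h2, hpd t h3 h4] at he
      exact hC.sp_ne_pd _ _ h1 h2 h3 h4 he
  exact ⟨T.verts, inferInstance, T.coe, hC.isTree_combSub le_rfl le_rfl hAB',
    M.path _ sp' pd', M.isENPRepresentation hC' hAB⟩

theorem bot_mem_ENPT (V : Type*) : (⊥ : SimpleGraph V) ∈ ENPT V := by
  refine ⟨Unit, inferInstance, ⊥, IsTree.of_subsingleton, fun _ => ⊤, fun _ => ?_, ?_⟩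
  · refine ⟨(), (), Walk.nil, Walk.IsPath.nil, Subgraph.ext (by ext; simp) ?_⟩
    ext x y
    simp
  · ext u v
    simp only [bot_adj, false_iff]
    rintro ⟨-, ⟨e, he, -⟩, -⟩
    induction e with
    | _ a b => exact he

theorem exists_combModel {V : Type*} [Finite V] {G : SimpleGraph V} {K S : Set V}
    (hKS : IsSplitPartition G K S) (hK : K.Nonempty) (hG : G ∈ BendENPG 1 V) :
    Nonempty (CombModel G K) := by
  obtain ⟨M⟩ := nonempty_lineModel hK hKS.1 hG
  exact M.nonempty_combModel hKS hK

end GridPath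

theorem mainTheorem9 (V : Type*) [Finite V] :
    (∀ (G : SimpleGraph V) (K S : Set V),
      IsSplitPartition G K S → K.Nonempty → G.Connected → G ∈ BendENPG 1 V →
      ∃ (m n : ℕ) (P : V → (gridGraph m n).Subgraph),
        IsBendENPGRepresentation 1 G P ∧
        IsPathSubgraph (pathUnion P K) ∧
        (∃ C : (gridGraph m n).Subgraph,
          IsCaterpillarWithCentralPath (pathUnion P Set.univ) C ∧ pathUnion P K ≤ C) ∧
        ∀ w, ((pathUnion P Set.univ).neighborSet w).encard ≤ 3) ∧
    BendENPG 1 V ∩ SPLIT V ⊆ ENPT V ∩ SPLIT V := by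
  refine ⟨fun G K S hKS hK _ hG => ?_, ?_⟩
  · obtain ⟨M⟩ := GridPath.exists_combModel hKS hK hG
    exact M.exists_gridRepresentation hK
  · rintro G ⟨hG, K, S, hKS⟩
    refine ⟨?_, K, S, hKS⟩
    -- The comb model needs a non-empty clique; without one, `G` is edgeless, and one-vertex paths
    -- suffice.
    rcases K.eq_empty_or_nonempty with rfl | hK
    · have hbot : G = ⊥ := by
        ext u v
        have hmem : ∀ w, w ∈ S := fun w =>
          (hKS.2.2.2 ▸ Set.mem_univ w : w ∈ (∅ : Set V) ∪ S).resolve_left fun h => h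
        simp only [SimpleGraph.bot_adj, iff_false]
        exact fun h => hKS.2.1 (hmem u) (hmem v) h.ne h
      rw [hbot]
      exact GridPath.bot_mem_ENPT V
    · obtain ⟨M⟩ := GridPath.exists_combModel hKS hK hG
      exact M.mem_ENPT
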